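/- **Setting.** Let $A=(a_{ij})_{0\le i,j\le l}$ be a generalized Cartan matrix of affine type, and let $\mathcal G\subset\mathfrak{gl}_n(\mathbb C)$ be a simple Lie algebra of matrices generated by $E_i,F_i$ $(0\le i\le l)$ such that, with $H_i=[E_i,F_i]$, one has $[H_i,H_j]=0$, $[E_i,F_j]=\delta_{ij}H_i$, $[H_i,E_j]=a_{ij}E_j$, $[H_i,F_j]=-a_{ij}F_j$ (all these matrices are then trace-less). Let $\mathfrak g$ be the associated affine Kac–Moody algebra modulo its centre in the homogeneous realization, that is, the Lie algebra of matrix Laurent polynomials in $z$ generated by $e_i=z^{\delta_{i0}}E_i$, $f_i=z^{-\delta_{i0}}F_i$. Write $\mathfrak g=\bigoplus_d\mathfrak g_{d[\mathrm s^0]}$ for its homogeneous gradation ($\deg e_i=-\deg f_i=\delta_{i0}$) and $\mathfrak g=\bigoplus_d\mathfrak g_{d[\mathrm s^1]}$ for the principal one ($\deg e_i=-\deg f_i=1$). Let $(\Lambda_j)_{j\in E_{>0}}$ be a basis, homogeneous and of positive degrees for the principal gradation, of the positive part of the principal Heisenberg subalgebra (the centralizer of $e_0+\dots+e_l$); the $\Lambda_j$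 commute. Here $E_{>0}$ is the set of positive exponents with multiplicity. Let $H^{(n)}=L^2(S^1,\mathbb C^n)=H^{(n)}_+\oplus H^{(n)}_-$ be the splitting into nonnegative and negative Fourier modes, with projections $p_\pm$. $\mathrm{Gr}^{(n)}$ is the set of closed subspaces $W$ such that $p_+|_W:W\to H_+^{(n)}$ is Fredholm, $p_-|_W:W\to H_-^{(n)}$ is compact and $zW\subseteq W$; $W$ is *transversal* if $p_+|_W:W\to H^{(n)}_+$ is bijective; $\mathrm{Gr}^0_{(n)}$ is the set of transversal points of $\mathrm{Gr}^{(n)}$. $L_{1/2}GL_n$ is the group of almost everywhere invertible measurable matrix loops $\gamma$ such that both $\gamma$ and $\gamma^{-1}$ have finite norms $\|\gamma\|_\infty$ and $\|\gamma\|_{2,1/2}=(\sum_k|k|\,\|\gamma_k\|^2)^{1/2}$. Let $$G_-=\{e^X\in L_{1/2}GL_n\mid X=\textstyle\sum_{m\ge1}X_mz^{-m},\ X_mz^{-m}\in\mathfrak g_{-m[\mathrm s^0]}\},$$ where the Fourier series of $e^X$ is the exponential of the series $X$ in $z^{-1}$. Fix a set of flows $J\subseteq E_{>0}$ (for instance $J=E_{>0}$).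 Let $\mathcal T$ be the space of real families $t=(t_j)_{j\in J}$ with $\sum_j|t_j|\,\|\Lambda_j\|_R<\infty$ for all $R\in\mathbb N$, where $\|\sum_kX_kz^k\|_R=\sum_kR^{|k|}\|X_k\|$, with the topology defined by these seminorms; then $g(t;z)=\exp\big(\sum_{j\in J}t_j\Lambda_j\big)$ is entire in $z$, and $G^a_+=\{g(t;z)\mid t\in\mathcal T\}$. Let $D\subseteq\mathcal T$ be a connected open neighbourhood of $0$ (for instance $D=\mathcal T$), and let $\Theta(t;z)$, $t\in D$, be a $G_-$-valued solution of the Drinfeld–Sokolov hierarchy in dressing form $$\frac{\partial\Theta}{\partial t_j}=\big(\Theta\Lambda_j\Theta^{-1}\big)_{<0}\,\Theta,\qquad j\in J,$$ where $(\cdot)_{<0}$ is the part with negative powers of $z$. The derivative is taken for every Fourier coefficient in $z$, the Fourier coefficients of $\Theta$ are continuous in $t$, and $\|\Theta(t;\cdot)\|_\infty$ is locally bounded in $t$. A matrix function $w(t;z)$, $t\in D$, is called a *Baker function* of $W\in\mathrm{Gr}^0_{(n)}$ if (1) the columns of $w(t;\cdot)$ belong to $W$ for every $t\in D$ such that $g(t;\cdot)^{-1}W$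 is transversal, and (2) $p_+(g^{-1}(t;z)w(t;z))=\mathrm{Id}$ for every $t\in D$. **Proposition 4.3.** Put $\gamma(z)=\Theta^{-1}(0;z)$, $W=\gamma H_+^{(n)}$ and $w(t;z)=g(t;z)\Theta^{-1}(t;z)$. Then $\gamma\in G_-$ and $W\in\mathrm{Gr}^0_{(n)}$; for every $t\in D$ the subspace $g(t;\cdot)^{-1}W$ is transversal; $w$ is a Baker function of $W$; and it is the only one: every Baker function of $W$ on $D$ agrees with $w$ for every $t\in D$ and almost every $z\in S^1$. -/

import Mathlib

open MeasureTheory AddCircle Filter Topology LaurentPolynomial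

noncomputable section

namespace DSBaker

/- The Lie bracket of an associative ring is the commutator. -/
attribute [local instance 100] LieRing.ofAssociativeRing

/-! ## Matrices, matrix Laurent polynomials -/

/-- Complex `n × n` matrices. -/
abbrev Mat (n : ℕ) : Type := Matrix (Fin n) (Fin n) ℂ

/-- Matrix Laurent polynomials `∑ zᵏ Xₖ`; the variable `z` is central, so that the commutator is
the bracket of the loop algebra of `gl_n` (the canonical central element `c` acts as `0`). -/
abbrev LoopPoly (n : ℕ) : Type := LaurentPolynomial (Mat n)

/-- The monomial `zᵏ X`. -/
def mono {n : ℕ} (k : ℤ) (X : Mat n) : LoopPoly n := LaurentPolynomial.C X * LaurentPolynomial.T k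

/-- The value at `z` of a matrix Laurent polynomial. -/
def evalAt {n : ℕ} (P : LoopPoly n) (z : ℂ) : Mat n := P.coeff.sum fun k X => z ^ k • X

/-- `∑ₖ R^|k| ‖Pₖ‖` with the entrywise `ℓ¹` norm on matrices. -/
def weight {n : ℕ} (R : ℕ) (P : LoopPoly n) : ℝ :=
  P.coeff.sum fun k X => (R : ℝ) ^ k.natAbs * ∑ i, ∑ j, ‖X i j‖

/-! ## Affine Cartan matrices and affine algebras realized by matrices -/

/-- Generalized Cartan matrices of affine type: indecomposable, with a strictly positive integral
vector in the kernel. -/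
structure IsAffineCartan {l : ℕ} (A : Matrix (Fin (l + 1)) (Fin (l + 1)) ℤ) : Prop where
  diag : ∀ i, A i i = 2
  offDiag : ∀ i j, i ≠ j → A i j ≤ 0
  zero_symm : ∀ i j, A i j = 0 → A j i = 0
  indecomposable : ∀ S : Set (Fin (l + 1)), S.Nonempty → S ≠ Set.univ →
    ∃ i ∈ S, ∃ j ∉ S, A i j ≠ 0
  affine : ∃ k : Fin (l + 1) → ℤ, (∀ i, 0 < k i) ∧ ∀ i, ∑ j, A i j * k j = 0

/-- A realization by `n × n` matrices of the simple Lie algebra `𝒢` attached to the affine Cartan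
matrix `A`, with its generators `E_i, F_i, H_i`, `0 ≤ i ≤ l`. The relations force all these
matrices to be trace-less: they are commutators. -/
structure MatrixRealization {l : ℕ} (A : Matrix (Fin (l + 1)) (Fin (l + 1)) ℤ) (n : ℕ) where
  E : Fin (l + 1) → Mat n
  F : Fin (l + 1) → Mat n
  H : Fin (l + 1) → Mat n
  lie_H_H : ∀ i j, ⁅H i, H j⁆ = 0
  lie_E_F : ∀ i j, ⁅E i, F j⁆ = if i = j then H i else 0
  lie_H_E : ∀ i j, ⁅H i, E j⁆ = (A i j : ℂ) • E j
  lie_H_F : ∀ i j, ⁅H i, F j⁆ = -((A i j : ℂ) • F j)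
  /-- The Lie algebra `𝒢` generated by the `E_i, F_i` (hence `H_i`) is simple. -/
  simple : LieAlgebra.IsSimple ℂ
    (LieSubalgebra.lieSpan ℂ (Mat n) (Set.range E ∪ Set.range F))

/-- The homogeneous gradation `s⁰ = (1, 0, …, 0)`. -/
def homGrad (l : ℕ) : Fin (l + 1) → ℤ := fun i => if i = 0 then 1 else 0

/-- The principal gradation `s¹ = (1, 1, …, 1)`. -/
def princGrad (l : ℕ) : Fin (l + 1) → ℤ := fun _ => 1

namespace MatrixRealization

variable {l n : ℕ} {A : Matrix (Fin (l + 1)) (Fin (l + 1)) ℤ} (G : MatrixRealization A n)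

/-- The Weyl generator `e_i = E_i(s⁰_i)` in the homogeneous realization. -/
def e (i : Fin (l + 1)) : LoopPoly n := mono (homGrad l i) (G.E i)

/-- The Weyl generator `f_i = F_i(-s⁰_i)` in the homogeneous realization. -/
def f (i : Fin (l + 1)) : LoopPoly n := mono (-homGrad l i) (G.F i)

/-- The coroot `H_i(0)`, modulo the centre. -/
def h (i : Fin (l + 1)) : LoopPoly n := mono 0 (G.H i)

/-- `G.HasDegree s d x` says that `x ∈ 𝔤_{d[s]}` (modulo the centre): the gradation
`𝔤 = ⨁_d 𝔤_{d[s]}` of the affine algebra `𝔤`, generated by the `e_i, f_i, h_i`, with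
`deg e_i = s_i`, `deg f_i = -s_i`, `deg h_i = 0`. -/
inductive HasDegree (s : Fin (l + 1) → ℤ) : ℤ → LoopPoly n → Prop
  | e (i : Fin (l + 1)) : HasDegree s (s i) (G.e i)
  | f (i : Fin (l + 1)) : HasDegree s (-s i) (G.f i)
  | h (i : Fin (l + 1)) : HasDegree s 0 (G.h i)
  | zero (d : ℤ) : HasDegree s d 0
  | add {d : ℤ} {x y : LoopPoly n} : HasDegree s d x → HasDegree s d y → HasDegree s d (x + y)
  | smul {d : ℤ} (a : ℂ) {x : LoopPoly n} : HasDegree s d x → HasDegree s d (a • x)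
  | lie {d d' : ℤ} {x y : LoopPoly n} :
      HasDegree s d x → HasDegree s d' y → HasDegree s (d + d') ⁅x, y⁆

/-- The cyclic element `Λ = e_0 + ⋯ + e_l`. -/
def cyclic : LoopPoly n := ∑ i, G.e i

/-- `(Λ_j)_{j ∈ E_{>0}}` is a homogeneous basis of the positive part of the principal Heisenberg
subalgebra, the centralizer of the cyclic element modulo the centre. The set `ι` indexes the
positive exponents with their multiplicities, `deg j` is the exponent itself. The last field is
the Heisenberg relation `[Λ_j, Λ_k] = j δ_{j,-k} c` for `j, k > 0`. -/
structure IsPositiveHeisenberg {ι : Type*} (deg : ι → ℕ) (Λ : ι → LoopPoly n) : Prop where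
  deg_pos : ∀ j, 0 < deg j
  hasDegree : ∀ j, G.HasDegree (princGrad l) (deg j) (Λ j)
  lie_cyclic : ∀ j, ⁅G.cyclic, Λ j⁆ = 0
  linearIndependent : LinearIndependent ℂ Λ
  span : ∀ (d : ℕ) (x : LoopPoly n), 0 < d → G.HasDegree (princGrad l) d x →
    ⁅G.cyclic, x⁆ = 0 → x ∈ Submodule.span ℂ (Set.range Λ)
  lie_eq_zero : ∀ j k, ⁅Λ j, Λ k⁆ = 0

end MatrixRealization

/-! ## The Hilbert space `H = L²(S¹, ℂⁿ)` and the Grassmannian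

The unit circle is parametrized by `UnitAddCircle = ℝ/ℤ`, with `z = e^{2πix} = fourier 1 x`. -/

/-- The normalized Lebesgue measure of the circle. -/
abbrev circ : Measure UnitAddCircle := haarAddCircle

/-- The coordinate `z` on `S¹`. -/
def zed (x : UnitAddCircle) : ℂ := fourier 1 x

/-- The Hilbert space `L²(S¹, ℂⁿ)`. -/
abbrev Hil (n : ℕ) : Type := Lp (EuclideanSpace ℂ (Fin n)) 2 circ

lemma integrable_fourier_smul {n : ℕ} (k : ℤ) (v : Hil n) : Integrable
    (fun x => fourier (-k) x • (v : UnitAddCircle → EuclideanSpace ℂ (Fin n)) x) circ := by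
  have hv : Integrable (v : UnitAddCircle → EuclideanSpace ℂ (Fin n)) circ :=
    (Lp.memLp v).integrable (by norm_num)
  have h1 : AEStronglyMeasurable (fun x : UnitAddCircle => fourier (-k) x) circ :=
    (fourier (-k)).continuous.aestronglyMeasurable
  have h2 : ∀ᵐ x ∂circ, ‖(fourier (-k) x : ℂ)‖ ≤ 1 :=
    Eventually.of_forall fun x => by rw [fourier_apply, Circle.norm_coe]
  exact Integrable.bdd_smul (φ := fun x : UnitAddCircle => (fourier (-k) x : ℂ)) hv 1 h1 h2

lemma continuous_fourierCoeff {n : ℕ} (k : ℤ) :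
    Continuous fun v : Hil n => fourierCoeff (v : UnitAddCircle → EuclideanSpace ℂ (Fin n)) k := by
  refine (LipschitzWith.of_dist_le_mul (K := 1) fun v w => ?_).continuous
  have h1 : fourierCoeff (v : UnitAddCircle → EuclideanSpace ℂ (Fin n)) k -
      fourierCoeff (w : UnitAddCircle → EuclideanSpace ℂ (Fin n)) k =
      ∫ x, fourier (-k) x • ((v - w : Hil n) : UnitAddCircle → EuclideanSpace ℂ (Fin n)) x
        ∂circ := by
    rw [fourierCoeff, fourierCoeff,
      ← integral_sub (integrable_fourier_smul k v) (integrable_fourier_smul k w)]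
    refine integral_congr_ae ?_
    filter_upwards [Lp.coeFn_sub v w] with x hx
    rw [hx, Pi.sub_apply, smul_sub]
  rw [dist_eq_norm, dist_eq_norm, h1, NNReal.coe_one, one_mul]
  set u : Hil n := v - w
  calc ‖∫ x, fourier (-k) x • (u : UnitAddCircle → EuclideanSpace ℂ (Fin n)) x ∂circ‖
      ≤ ∫ x, ‖(u : UnitAddCircle → EuclideanSpace ℂ (Fin n)) x‖ ∂circ := by
        refine (norm_integral_le_integral_norm _).trans (le_of_eq ?_)
        refine integral_congr_ae (Eventually.of_forall fun x => ?_)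
        simp only [norm_smul, fourier_apply, Circle.norm_coe, one_mul]
    _ = (eLpNorm (u : UnitAddCircle → EuclideanSpace ℂ (Fin n)) 1 circ).toReal := by
        rw [integral_norm_eq_lintegral_enorm (Lp.aestronglyMeasurable u),
          eLpNorm_one_eq_lintegral_enorm]
    _ ≤ ‖u‖ := by
        rw [Lp.norm_def]
        exact ENNReal.toReal_mono (Lp.eLpNorm_ne_top u)
          (eLpNorm_le_eLpNorm_of_exponent_le (by norm_num) (Lp.aestronglyMeasurable u))

lemma fourierCoeff_add' {n : ℕ} (k : ℤ) (v w : Hil n) :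
    fourierCoeff ((v + w : Hil n) : UnitAddCircle → EuclideanSpace ℂ (Fin n)) k =
      fourierCoeff (v : UnitAddCircle → EuclideanSpace ℂ (Fin n)) k +
      fourierCoeff (w : UnitAddCircle → EuclideanSpace ℂ (Fin n)) k := by
  rw [fourierCoeff, fourierCoeff, fourierCoeff,
    ← integral_add (integrable_fourier_smul k v) (integrable_fourier_smul k w)]
  refine integral_congr_ae ?_
  filter_upwards [Lp.coeFn_add v w] with x hx
  rw [hx, Pi.add_apply, smul_add]

lemma fourierCoeff_smul' {n : ℕ} (k : ℤ) (a : ℂ) (v : Hil n) :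
    fourierCoeff ((a • v : Hil n) : UnitAddCircle → EuclideanSpace ℂ (Fin n)) k =
      a • fourierCoeff (v : UnitAddCircle → EuclideanSpace ℂ (Fin n)) k := by
  rw [fourierCoeff, fourierCoeff, ← integral_smul]
  refine integral_congr_ae ?_
  filter_upwards [Lp.coeFn_smul a v] with x hx
  rw [hx, Pi.smul_apply, smul_comm]

/-- The `k`-th Fourier coefficient as a linear map. -/
def fourierLin (n : ℕ) (k : ℤ) : Hil n →ₗ[ℂ] EuclideanSpace ℂ (Fin n) where
  toFun v := fourierCoeff (v : UnitAddCircle → EuclideanSpace ℂ (Fin n)) k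
  map_add' := fourierCoeff_add' k
  map_smul' := fourierCoeff_smul' k

/-- `H₊`: the Fourier coefficients of negative index vanish. -/
def hardyPlus (n : ℕ) : Submodule ℂ (Hil n) :=
  ⨅ k : {k : ℤ // k < 0}, LinearMap.ker (fourierLin n k)

/-- `H₋`: the Fourier coefficients of nonnegative index vanish. -/
def hardyMinus (n : ℕ) : Submodule ℂ (Hil n) :=
  ⨅ k : {k : ℤ // 0 ≤ k}, LinearMap.ker (fourierLin n k)

lemma isClosed_ker_fourierLin (n : ℕ) (k : ℤ) :
    IsClosed (LinearMap.ker (fourierLin n k) : Set (Hil n)) :=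
  isClosed_eq (continuous_fourierCoeff k) continuous_const

instance (n : ℕ) : CompleteSpace (hardyPlus n) := by
  have h : IsClosed (hardyPlus n : Set (Hil n)) := by
    rw [hardyPlus, Submodule.coe_iInf]
    exact isClosed_iInter fun k => isClosed_ker_fourierLin n k
  exact h.isComplete.completeSpace_coe

instance (n : ℕ) : CompleteSpace (hardyMinus n) := by
  have h : IsClosed (hardyMinus n : Set (Hil n)) := by
    rw [hardyMinus, Submodule.coe_iInf]
    exact isClosed_iInter fun k => isClosed_ker_fourierLin n k
  exact h.isComplete.completeSpace_coe

/-- The projection `p₊ : H → H₊` (along `H₋`, the orthogonal complement of `H₊`). -/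
def pPlus (n : ℕ) : Hil n →L[ℂ] hardyPlus n := (hardyPlus n).orthogonalProjectionOnto

/-- The projection `p₋ : H → H₋` (along `H₊`, the orthogonal complement of `H₋`). -/
def pMinus (n : ℕ) : Hil n →L[ℂ] hardyMinus n := (hardyMinus n).orthogonalProjectionOnto

/-- The action of a matrix on a vector. -/
def act {n : ℕ} (M : Mat n) (v : EuclideanSpace ℂ (Fin n)) : EuclideanSpace ℂ (Fin n) :=
  WithLp.toLp 2 (M.mulVec v.ofLp)

/-- The subspace `γ W = {γ v ∣ v ∈ W}` of `L²(S¹, ℂⁿ)` (for essentially bounded `γ` every product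
`γ v` is in `L²`). -/
def loopImage {n : ℕ} (γ : UnitAddCircle → Mat n) (W : Submodule ℂ (Hil n)) :
    Submodule ℂ (Hil n) where
  carrier := {v | ∃ u ∈ W, v =ᵐ[circ] fun x => act (γ x) (u x)}
  add_mem' := by
    rintro v v' ⟨u, hu, h⟩ ⟨u', hu', h'⟩
    refine ⟨u + u', W.add_mem hu hu', ?_⟩
    filter_upwards [h, h', Lp.coeFn_add v v', Lp.coeFn_add u u'] with x h1 h2 h3 h4
    rw [h3, h4, Pi.add_apply, Pi.add_apply, h1, h2]
    simp [act, Matrix.mulVec_add]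
  zero_mem' := by
    refine ⟨0, W.zero_mem, ?_⟩
    filter_upwards [Lp.coeFn_zero (EuclideanSpace ℂ (Fin n)) 2 circ] with x h
    rw [h]
    simp [act]
  smul_mem' := by
    rintro a v ⟨u, hu, h⟩
    refine ⟨a • u, W.smul_mem a hu, ?_⟩
    filter_upwards [h, Lp.coeFn_smul a v, Lp.coeFn_smul a u] with x h1 h2 h3
    rw [h2, h3, Pi.smul_apply, Pi.smul_apply, h1]
    simp [act, Matrix.mulVec_smul]

/-- The restriction `p₊|_W : W → H₊`. -/
def pPlusOn {n : ℕ} (W : Submodule ℂ (Hil n)) : W →L[ℂ] hardyPlus n := (pPlus n).comp W.subtypeL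

/-- The restriction `p₋|_W : W → H₋`. -/
def pMinusOn {n : ℕ} (W : Submodule ℂ (Hil n)) : W →L[ℂ] hardyMinus n :=
  (pMinus n).comp W.subtypeL

/-- `W` is a point of the Sato–Segal–Wilson Grassmannian `Gr⁽ⁿ⁾`. -/
structure IsGrassmannian {n : ℕ} (W : Submodule ℂ (Hil n)) : Prop where
  closed : IsClosed (W : Set (Hil n))
  finite_ker : FiniteDimensional ℂ (LinearMap.ker (pPlusOn W : W →ₗ[ℂ] hardyPlus n))
  finite_coker : FiniteDimensional ℂ
    (hardyPlus n ⧸ LinearMap.range (pPlusOn W : W →ₗ[ℂ] hardyPlus n))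
  compact : IsCompactOperator (pMinusOn W)
  z_mul : loopImage (fun x => zed x • (1 : Mat n)) W ≤ W

/-- `W` is transversal to `H₋`. -/
def IsTransversal {n : ℕ} (W : Submodule ℂ (Hil n)) : Prop := Function.Bijective (pPlusOn W)

/-- `W` is a point of the big cell `Gr⁰` of the Grassmannian. -/
def IsBigCell {n : ℕ} (W : Submodule ℂ (Hil n)) : Prop := IsGrassmannian W ∧ IsTransversal W

/-! ## Loop groups -/

/-- The `k`-th Fourier coefficient of a matrix loop. -/
def loopCoeff {n : ℕ} (γ : UnitAddCircle → Mat n) (k : ℤ) : Mat n :=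
  Matrix.of fun i j => fourierCoeff (fun x => γ x i j) k

/-- `γ` is measurable with `‖γ‖_∞ < ∞` and `‖γ‖_{2,1/2} = (∑ₖ |k| ‖γₖ‖²)^{1/2} < ∞`. -/
def FiniteNorms {n : ℕ} (γ : UnitAddCircle → Mat n) : Prop :=
  (∀ i j, MemLp (fun x => γ x i j) ⊤ circ) ∧
    Summable fun k : ℤ => |(k : ℝ)| * ∑ i, ∑ j, ‖loopCoeff γ k i j‖ ^ 2

/-- `γ` is an element of the loop group `L_{1/2} GL_n`: it is almost everywhere invertible, and
`γ` and `γ⁻¹` have finite norms. -/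
def InLoopGroup {n : ℕ} (γ : UnitAddCircle → Mat n) : Prop :=
  (∀ᵐ x ∂circ, IsUnit (γ x)) ∧ FiniteNorms γ ∧ FiniteNorms fun x => (γ x)⁻¹

/-- The coefficient of `z⁻ᵐ` in the exponential `∑ₖ Xᵏ / k!` of a series `X = ∑_{m ≥ 1} X_m z⁻ᵐ`
(the terms with `k > m` do not contribute); power series here are series in `z⁻¹`. -/
def expCoeff {n : ℕ} (X : PowerSeries (Mat n)) (m : ℕ) : Mat n :=
  ∑ k ∈ Finset.range (m + 1), ((k.factorial : ℂ)⁻¹) • PowerSeries.coeff m (X ^ k)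

/-- The group `G₋ = {e^X ∈ L_{1/2} GL_n ∣ X ∈ 𝔤_{<0[s⁰]}}`: the Fourier series of `γ` is the
exponential of a series `X = ∑_{m ≥ 1} X_m z⁻ᵐ` with `X_m z⁻ᵐ ∈ 𝔤_{-m[s⁰]}` (`𝔤_{<0[s⁰]}` is
completed, infinite series in `z⁻¹` are allowed). -/
def MatrixRealization.InGMinus {l n : ℕ} {A : Matrix (Fin (l + 1)) (Fin (l + 1)) ℤ}
    (G : MatrixRealization A n) (γ : UnitAddCircle → Mat n) : Prop :=
  InLoopGroup γ ∧ (∀ k : ℤ, 0 < k → loopCoeff γ k = 0) ∧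
    ∃ X : PowerSeries (Mat n), PowerSeries.coeff 0 X = 0 ∧
      (∀ m : ℕ, 0 < m →
        G.HasDegree (homGrad l) (-(m : ℤ)) (mono (-(m : ℤ)) (PowerSeries.coeff m X))) ∧
      ∀ m : ℕ, loopCoeff γ (-(m : ℤ)) = expCoeff X m

/-! ## Times and the group `G₊ᵃ` -/

section Times

variable {ι : Type*} {n : ℕ}

lemma weight_nonneg (R : ℕ) (P : LoopPoly n) : 0 ≤ weight R P :=
  Finset.sum_nonneg fun k _ => mul_nonneg (by positivity)
    (Finset.sum_nonneg fun _ _ => Finset.sum_nonneg fun _ _ => norm_nonneg _)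

/-- The families `t = (t_j)` of real times for which `∑ t_j Λ_j` converges, absolutely with respect
to every `∑ₖ R^|k| ‖Pₖ‖`, so that it is holomorphic on the whole `z`-plane (if the `Λ_j` are
polynomials in `z`). -/
def timesSubmodule (Λ : ι → LoopPoly n) : Submodule ℝ (ι → ℝ) where
  carrier := {t | ∀ R : ℕ, Summable fun j => |t j| * weight R (Λ j)}
  add_mem' := by
    intro a b ha hb R
    refine Summable.of_nonneg_of_le (fun j => mul_nonneg (abs_nonneg _) (weight_nonneg _ _))
      (fun j => ?_) ((ha R).add (hb R))
    rw [← add_mul]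
    exact mul_le_mul_of_nonneg_right (abs_add_le _ _) (weight_nonneg _ _)
  zero_mem' := by
    intro R
    simp
  smul_mem' := by
    intro c a ha R
    simpa [abs_mul, mul_assoc] using (ha R).mul_left |c|

/-- The space of times, with the locally convex topology given by the seminorms
`∑_j |t_j| ∑ₖ R^|k| ‖(Λ_j)ₖ‖`, `R = 0, 1, 2, …`. -/
def Times (Λ : ι → LoopPoly n) : Type _ := timesSubmodule Λ

instance (Λ : ι → LoopPoly n) : AddCommGroup (Times Λ) :=
  inferInstanceAs (AddCommGroup (timesSubmodule Λ))

instance (Λ : ι → LoopPoly n) : Module ℝ (Times Λ) :=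
  inferInstanceAs (Module ℝ (timesSubmodule Λ))

/-- The time `t_j`. -/
def Times.coord {Λ : ι → LoopPoly n} (t : Times Λ) (j : ι) : ℝ := Subtype.val t j

lemma Times.summable {Λ : ι → LoopPoly n} (t : Times Λ) (R : ℕ) :
    Summable fun j => |t.coord j| * weight R (Λ j) := Subtype.property t R

/-- The defining seminorms of the space of times. -/
def timesSeminorm (Λ : ι → LoopPoly n) : SeminormFamily ℝ (Times Λ) ℕ := fun R =>
  Seminorm.of (fun t => ∑' j, |t.coord j| * weight R (Λ j))
    (fun a b => by
      rw [← (a.summable R).tsum_add (b.summable R)]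
      refine ((a + b).summable R).tsum_le_tsum (fun j => ?_) ((a.summable R).add (b.summable R))
      rw [← add_mul]
      exact mul_le_mul_of_nonneg_right (abs_add_le _ _) (weight_nonneg _ _))
    (fun c a => by
      rw [← tsum_mul_left]
      refine tsum_congr fun j => ?_
      rw [← mul_assoc, Real.norm_eq_abs, ← abs_mul]
      rfl)

instance (Λ : ι → LoopPoly n) : TopologicalSpace (Times Λ) :=
  (timesSeminorm Λ).moduleFilterBasis.topology

open Classical in
/-- The family of times with `t_j = s` and all other times `0`. -/
def Times.single {Λ : ι → LoopPoly n} (j : ι) (s : ℝ) : Times Λ :=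
  (⟨Pi.single j s, fun R => summable_of_ne_finset_zero (s := {j}) fun i hi => by
    have hij : i ≠ j := by simpa using hi
    simp [Pi.single_eq_of_ne hij]⟩ : timesSubmodule Λ)

/-- The element `g(t; z) = exp (∑_j t_j Λ_j)` of `G₊ᵃ`. -/
def gPlus {Λ : ι → LoopPoly n} (t : Times Λ) (x : UnitAddCircle) : Mat n :=
  NormedSpace.exp (∑' j, (t.coord j : ℂ) • evalAt (Λ j) (zed x))

/-- `Θ(t; z)`, `t ∈ D`, is a solution with values in `G₋` of the hierarchy
`∂Θ/∂t_j = (Θ Λ_j Θ⁻¹)_{<0} Θ`. The equation is written for the Fourier coefficients: as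
`(Θ Λ_j Θ⁻¹)_{<0}` and `Θ` have no Fourier coefficients of positive index, the `m`-th coefficient
of their product is the finite sum `∑_{m ≤ a < 0} (Θ Λ_j Θ⁻¹)_a Θ_{m - a}`.
The dependence on `t` is continuous in the weak sense that the Fourier coefficients are continuous
and the norm `‖Θ‖_∞` is locally bounded. -/
structure MatrixRealization.IsDressingSolution {l : ℕ}
    {A : Matrix (Fin (l + 1)) (Fin (l + 1)) ℤ} (G : MatrixRealization A n)
    (Λ : ι → LoopPoly n) (D : Set (Times Λ)) (Θ : Times Λ → UnitAddCircle → Mat n) : Prop where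
  inGMinus : ∀ t ∈ D, G.InGMinus (Θ t)
  continuousOn : ∀ (m : ℤ) (a b : Fin n), ContinuousOn (fun t => loopCoeff (Θ t) m a b) D
  locally_bounded : ∀ t ∈ D, ∃ C : ℝ, ∀ᶠ t' in 𝓝[D] t, ∀ a b, ∀ᵐ x ∂circ, ‖Θ t' x a b‖ ≤ C
  equation : ∀ t ∈ D, ∀ (j : ι) (m : ℤ) (a b : Fin n),
    HasDerivAt (fun s : ℝ => loopCoeff (Θ (t + Times.single j s)) m a b)
      ((∑ k ∈ Finset.Ico m 0,
        loopCoeff (fun x => Θ t x * evalAt (Λ j) (zed x) * (Θ t x)⁻¹) k *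
          loopCoeff (Θ t) (m - k)) a b) 0

end Times

/-! ## Baker functions -/

/-- The column of index `α` of a matrix function. -/
def column {n : ℕ} (M : UnitAddCircle → Mat n) (α : Fin n) :
    UnitAddCircle → EuclideanSpace ℂ (Fin n) := fun x => WithLp.toLp 2 fun i => M x i α

/-- The constant function `e_α` as an element of `L²(S¹, ℂⁿ)`. -/
def constVec (n : ℕ) (α : Fin n) : Hil n :=
  (memLp_const (EuclideanSpace.single α (1 : ℂ))).toLp _

/-- The matrix function `w(t; z)`, `t ∈ D`, is a Baker function of `W` with respect to the group
elements `g(t; z)`: (1) the columns of `w` are in `W` whenever `g⁻¹W` is transversal;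
(2) `p₊(g⁻¹w) = Id`, column by column. -/
def IsBakerFunction {n : ℕ} {τ : Type*} (D : Set τ) (g w : τ → UnitAddCircle → Mat n)
    (W : Submodule ℂ (Hil n)) : Prop :=
  (∀ t ∈ D, IsTransversal (loopImage (fun x => (g t x)⁻¹) W) →
    ∀ α, ∃ v ∈ W, v =ᵐ[circ] column (w t) α) ∧
  (∀ t ∈ D, ∀ α, ∃ v : Hil n, v =ᵐ[circ] column (fun x => (g t x)⁻¹ * w t x) α ∧
    (pPlus n v : Hil n) = constVec n α)

end DSBaker

end

noncomputable section

namespace DSBaker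

attribute [local instance 100] LieRing.ofAssociativeRing

/-! ## Fourier coefficients of scalar functions -/

section Fourier

variable {f g : UnitAddCircle → ℂ}

/-! The heart of the matter is the loop `ψ(t) = Θ(t) g(t)⁻¹ Θ(0)⁻¹` (`dressedLoop`). Put `Q = Θ Λ_j
Θ⁻¹`. The hierarchy gives `∂Θ = Q_{<0} Θ`, while `∂g⁻¹ = -Λ_j g⁻¹` and `Q Θ = Θ Λ_j`, so that `∂ψ =
(Q_{<0} - Q) ψ = -Q_{≥0} ψ` (`hasDerivAt_dressedLoop`). Multiplication by `Q_{≥0}` never lowers a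
Fourier index, so the negative coefficients of `ψ` obey a closed homogeneous linear system. They
vanish at `t = 0`, where `ψ = 1`, hence on all of `D` (`loopCoeff_dressedLoop_eq_zero`).

The elements of the affine algebra are traceless, so `Θ`, `g` and `ψ` have determinant one and their
inverses are adjugates, polynomial in the entries: Fourier modes on one side of zero stay on that
side under inversion (`inv_mem_matLoops`). Therefore `ψ H₊ = H₊`, and `g⁻¹ W = Θ(t)⁻¹ ψ H₊ = Θ(t)⁻¹
H₊` (`loopImage_gInv`). This space is transversal because `Θ` and `Θ⁻¹` both preserve `H₋`
(`isTransversal_loopImage`). The columns of `g⁻¹ w = Θ⁻¹` lie in it and equal `e_α` plus negative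
modes, which is the Baker property; injectivity of `p₊` on `g⁻¹ W` gives uniqueness. For the
Grassmannian conditions on `W`, the only analytic point is compactness of `p₋`: finiteness of the
`1/2`-norm makes the Hankel operator of `γ` Hilbert–Schmidt (`isCompactOperator_pMinusOn`).

The remaining work is regularity. `Θ` is differentiable only coefficient by coefficient, and only
along single times. Local boundedness supplies `ℓ²` bounds for its difference quotients, so it is
differentiable in the weak sense of `L²`; `g⁻¹` is differentiable uniformly in `z`, and a weak limit
may be multiplied by a uniform one (`hasDerivAt_fourierCoeff_mul_mul`). Infinitely many times are
handled by changing finitely many of them, one after another, and passing to the limit;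
connectedness of `D` makes the conclusion global.

On the algebraic side, a triangular decomposition shows that elements of positive principal degree
are built from brackets of the `e_i` alone and so are polynomial in `z` (`ChevalleyRel.lie_triang`).
-/

lemma fourierCoeff_add_of_integrable (hf : Integrable f circ) (hg : Integrable g circ) (k : ℤ) :
    fourierCoeff (fun x => f x + g x) k = fourierCoeff f k + fourierCoeff g k := by
  simp only [fourierCoeff, smul_add]
  exact integral_add (hf.fourier_smul (-k)) (hg.fourier_smul (-k))

lemma fourierCoeff_sub_of_integrable (hf : Integrable f circ) (hg : Integrable g circ) (k : ℤ) :
    fourierCoeff (fun x => f x - g x) k = fourierCoeff f k - fourierCoeff g k := by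
  simp only [fourierCoeff, smul_sub]
  exact integral_sub (hf.fourier_smul (-k)) (hg.fourier_smul (-k))

lemma fourierCoeff_sum_of_integrable {ι : Type*} (s : Finset ι) {F : ι → UnitAddCircle → ℂ}
    (hF : ∀ i ∈ s, Integrable (F i) circ) (k : ℤ) :
    fourierCoeff (fun x => ∑ i ∈ s, F i x) k = ∑ i ∈ s, fourierCoeff (F i) k := by
  simp only [fourierCoeff, Finset.smul_sum]
  exact integral_finsetSum s fun i hi => (hF i hi).fourier_smul (-k)

lemma norm_fourierCoeff_le_of_bound {C : ℝ} (h : ∀ᵐ x ∂circ, ‖f x‖ ≤ C) (k : ℤ) :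
    ‖fourierCoeff f k‖ ≤ C := by
  have h1 : ∀ᵐ x ∂circ, ‖fourier (-k) x • f x‖ ≤ C := by
    filter_upwards [h] with x hx
    simpa only [norm_smul, fourier_apply, Circle.norm_coe, one_mul] using hx
  have h2 := norm_integral_le_of_norm_le_const h1
  rwa [probReal_univ, mul_one] at h2

lemma fourierCoeff_congr {f g : UnitAddCircle → ℂ} (h : f =ᵐ[circ] g) (k : ℤ) :
    fourierCoeff f k = fourierCoeff g k := by
  rw [fourierCoeff_congr_ae h]

/-- Multiplication by `zʲ` shifts the Fourier coefficients. -/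
lemma fourierCoeff_fourier_mul (f : UnitAddCircle → ℂ) (j k : ℤ) :
    fourierCoeff (fun x => fourier j x * f x) k = fourierCoeff f (k - j) := by
  simp only [fourierCoeff, smul_eq_mul]
  congr 1
  ext x
  rw [← mul_assoc, ← fourier_add]
  congr 3
  ring

lemma fourierCoeff_one (k : ℤ) :
    fourierCoeff (fun _ : UnitAddCircle => (1 : ℂ)) k = if k = 0 then 1 else 0 := by
  have := congrFun (fourierCoeff_fourier (T := 1) 0) k
  have h1 : (fourier 0 : UnitAddCircle → ℂ) = fun _ => 1 := by ext x; exact fourier_zero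
  rw [h1] at this
  rw [this, Pi.single_apply]

/-- The Fourier coefficients of a product of two square-integrable functions. -/
lemma hasSum_fourierCoeff_mul (hf : MemLp f 2 circ) (hg : MemLp g 2 circ) (m : ℤ) :
    HasSum (fun k => fourierCoeff f (m - k) * fourierCoeff g k)
      (fourierCoeff (fun x => f x * g x) m) := by
  -- Parseval for the pair `conj f · zᵐ`, `g`: the inner product is the `m`-th coefficient of `f g`,
  -- and its components in the Fourier basis are `f_{m-k}` and `g_k`.
  have hF : MemLp (fun x => (starRingEnd ℂ) (f x) * fourier m x) 2 circ := by
    refine MemLp.congr_norm hf ?_ (Eventually.of_forall fun x => ?_)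
    · exact hf.1.star.mul (fourier m).continuous.aestronglyMeasurable
    · simp [fourier_apply, Circle.norm_coe]
  have h := fourierBasis.hasSum_inner_mul_inner (hF.toLp _) (hg.toLp _)
  convert! h using 1
  · ext k
    congr 1
    · rw [L2.inner_def, fourierCoeff]
      refine integral_congr_ae ?_
      filter_upwards [hF.coeFn_toLp, coeFn_fourierLp (T := 1) 2 k] with x h1 h2
      rw [coe_fourierBasis, h1, h2]
      simp only [RCLike.inner_apply, map_mul, Complex.conj_conj, smul_eq_mul, ← fourier_neg]
      rw [neg_sub, sub_eq_add_neg, fourier_add]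
      ring
    · rw [← fourierBasis.repr_apply_apply, fourierBasis_repr]
      exact fourierCoeff_congr hg.coeFn_toLp.symm k
  · rw [L2.inner_def, fourierCoeff]
    refine integral_congr_ae ?_
    filter_upwards [hF.coeFn_toLp, hg.coeFn_toLp] with x h1 h2
    rw [h1, h2]
    simp only [RCLike.inner_apply, map_mul, Complex.conj_conj, smul_eq_mul, ← fourier_neg]
    ring

/-- A square-integrable function is determined by its Fourier coefficients. -/
lemma ae_eq_zero_of_fourierCoeff (hf : MemLp f 2 circ) (h : ∀ k, fourierCoeff f k = 0) :
    f =ᵐ[circ] 0 := by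
  have h1 : hf.toLp f = 0 := by
    apply fourierBasis.repr.injective
    ext k
    rw [fourierBasis_repr, fourierCoeff_congr hf.coeFn_toLp, h k]
    simp
  exact hf.coeFn_toLp.symm.trans ((Lp.ext_iff.1 h1).trans (Lp.coeFn_zero ℂ 2 circ))

lemma ae_eq_of_fourierCoeff (hf : MemLp f 2 circ) (hg : MemLp g 2 circ)
    (h : ∀ k, fourierCoeff f k = fourierCoeff g k) : f =ᵐ[circ] g := by
  have := ae_eq_zero_of_fourierCoeff (hf.sub hg) fun k => by
    have := fourierCoeff_sub_of_integrable (hf.integrable (by norm_num))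
      (hg.integrable (by norm_num)) k
    rw [h k, sub_self] at this
    exact this
  filter_upwards [this] with x hx
  exact sub_eq_zero.1 hx

end Fourier

/-! ## Bounded functions with prescribed Fourier modes -/

/-- The algebra of bounded measurable functions on the circle all of whose Fourier modes belong
to the additive monoid `S`. -/
def hInf (S : AddSubmonoid ℤ) : Subalgebra ℂ (UnitAddCircle → ℂ) where
  carrier := {f | MemLp f ⊤ circ ∧ ∀ k ∉ S, fourierCoeff f k = 0}
  mul_mem' := by
    rintro f g ⟨hf, hf'⟩ ⟨hg, hg'⟩
    refine ⟨hg.mul hf, fun m hm => ?_⟩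
    have h := hasSum_fourierCoeff_mul (hf.mono_exponent le_top) (hg.mono_exponent le_top) m
    refine h.unique ?_
    convert! hasSum_zero using 2 with k
    -- The indices `m - k` and `k` add up to `m ∉ S`, so they cannot both lie in `S`.
    by_cases hk : k ∈ S
    · have : m - k ∉ S := fun h => hm (by simpa using S.add_mem h hk)
      rw [hf' _ this, zero_mul]
    · rw [hg' _ hk, mul_zero]
  add_mem' := by
    rintro f g ⟨hf, hf'⟩ ⟨hg, hg'⟩
    refine ⟨hf.add hg, fun m hm => ?_⟩
    have := fourierCoeff_add_of_integrable (hf.integrable le_top) (hg.integrable le_top) m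
    rw [hf' m hm, hg' m hm, add_zero] at this
    exact this
  algebraMap_mem' := by
    intro c
    refine ⟨memLp_const c, fun m hm => ?_⟩
    have h1 : (algebraMap ℂ (UnitAddCircle → ℂ)) c = fun x => c * (fun _ => (1 : ℂ)) x := by
      ext x; simp
    have hm0 : m ≠ 0 := fun h => hm (h ▸ S.zero_mem)
    rw [h1, fourierCoeff.const_mul, fourierCoeff_one, if_neg hm0, mul_zero]

/-- The nonnegative integers. -/
abbrev nonnegModes : AddSubmonoid ℤ := AddSubmonoid.nonneg ℤ

/-- The nonpositive integers. -/
def nonposModes : AddSubmonoid ℤ where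
  carrier := {k | k ≤ 0}
  add_mem' := by intro a b ha hb; exact add_nonpos (Set.mem_ofPred.1 ha) (Set.mem_ofPred.1 hb)
  zero_mem' := le_refl (0 : ℤ)

lemma mem_nonposModes {k : ℤ} : k ∈ nonposModes ↔ k ≤ 0 := Iff.rfl

lemma mem_hInf {S : AddSubmonoid ℤ} {f : UnitAddCircle → ℂ} :
    f ∈ hInf S ↔ MemLp f ⊤ circ ∧ ∀ k ∉ S, fourierCoeff f k = 0 := Iff.rfl

lemma mem_hInf_nonneg {f : UnitAddCircle → ℂ} :
    f ∈ hInf nonnegModes ↔ MemLp f ⊤ circ ∧ ∀ k < 0, fourierCoeff f k = 0 := by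
  simp [mem_hInf]

lemma mem_hInf_nonpos {f : UnitAddCircle → ℂ} :
    f ∈ hInf nonposModes ↔ MemLp f ⊤ circ ∧ ∀ k, 0 < k → fourierCoeff f k = 0 := by
  simp [mem_hInf, mem_nonposModes]

lemma mem_hInf_top {f : UnitAddCircle → ℂ} : f ∈ hInf ⊤ ↔ MemLp f ⊤ circ := by
  simp [mem_hInf]

lemma hInf_mono {S T : AddSubmonoid ℤ} (h : S ≤ T) : hInf S ≤ hInf T :=
  fun _ hf => ⟨hf.1, fun k hk => hf.2 k fun hk' => hk (h hk')⟩

lemma hInf_congr {S : AddSubmonoid ℤ} {f g : UnitAddCircle → ℂ} (h : f =ᵐ[circ] g)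
    (hf : f ∈ hInf S) : g ∈ hInf S :=
  ⟨hf.1.ae_eq h, fun k hk => by rw [← fourierCoeff_congr h, hf.2 k hk]⟩

lemma hInf.memLp_two {S : AddSubmonoid ℤ} {f : UnitAddCircle → ℂ} (hf : f ∈ hInf S) :
    MemLp f 2 circ := hf.1.mono_exponent le_top

lemma hInf.integrable {S : AddSubmonoid ℤ} {f : UnitAddCircle → ℂ} (hf : f ∈ hInf S) :
    Integrable f circ := hf.1.integrable le_top

lemma fourier_mem_hInf {S : AddSubmonoid ℤ} {k : ℤ} (hk : k ∈ S) :
    (fun x => fourier k x : UnitAddCircle → ℂ) ∈ hInf S := by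
  refine ⟨MemLp.of_bound (fourier k).continuous.aestronglyMeasurable 1
    (Eventually.of_forall fun x => by simp [fourier_apply, Circle.norm_coe]), fun m hm => ?_⟩
  have h : (fun x => fourier k x : UnitAddCircle → ℂ) = fun x => fourier k x * (fun _ => 1) x := by
    simp
  have hmk : m - k ≠ 0 := fun h => hm (by rwa [sub_eq_zero.1 h])
  rw [h, fourierCoeff_fourier_mul, fourierCoeff_one, if_neg hmk]

lemma norm_fourierCoeff_sub_le {f g : UnitAddCircle → ℂ} (hf : Integrable f circ)
    (hg : Integrable g circ) {ε : ℝ} (h : ∀ x, ‖f x - g x‖ ≤ ε) (k : ℤ) :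
    ‖fourierCoeff f k - fourierCoeff g k‖ ≤ ε := by
  rw [← fourierCoeff_sub_of_integrable hf hg]
  exact norm_fourierCoeff_le_of_bound (Eventually.of_forall h) k

/-- `hInf S` is closed under uniform limits. -/
lemma mem_hInf_of_tendstoUniformly {α : Type*} {l : Filter α} [l.NeBot] {S : AddSubmonoid ℤ}
    {F : α → UnitAddCircle → ℂ} {f : UnitAddCircle → ℂ} (hF : ∀ a, F a ∈ hInf S)
    (h : TendstoUniformly F f l) : f ∈ hInf S := by
  rw [Metric.tendstoUniformly_iff] at h
  -- A sequence is extracted from the arbitrary filter, since measurability of a limit needs a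
  -- countable family.
  have h1 : ∀ N : ℕ, ∃ a, ∀ x, ‖f x - F a x‖ ≤ 1 / ((N : ℝ) + 1) := fun N => by
    obtain ⟨a, ha⟩ := (h _ (Nat.one_div_pos_of_nat (n := N) (α := ℝ))).exists
    exact ⟨a, fun x => by rw [← dist_eq_norm]; exact (ha x).le⟩
  choose a ha using h1
  have hmeas : AEStronglyMeasurable f circ := by
    refine aestronglyMeasurable_of_tendsto_ae atTop (f := fun N => F (a N))
      (fun N => (hF (a N)).1.1) (Eventually.of_forall fun x => ?_)
    rw [tendsto_iff_norm_sub_tendsto_zero]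
    refine squeeze_zero (fun _ => norm_nonneg _) (fun N => ?_) tendsto_one_div_add_atTop_nhds_zero_nat
    rw [norm_sub_rev]
    exact ha N x
  have hbd : MemLp f ⊤ circ := by
    have h2 : MemLp (fun x => f x - F (a 0) x) ⊤ circ :=
      MemLp.of_bound (hmeas.sub (hF (a 0)).1.1) (1 / ((0 : ℕ) + 1 : ℝ)) (Eventually.of_forall (ha 0))
    convert! h2.add (hF (a 0)).1 using 1
    ext x
    simp
  refine ⟨hbd, fun k hk => ?_⟩
  have h3 : ∀ N : ℕ, ‖fourierCoeff f k‖ ≤ 1 / ((N : ℝ) + 1) := fun N => by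
    have := norm_fourierCoeff_sub_le (hbd.integrable le_top) (hInf.integrable (hF (a N))) (ha N) k
    rwa [(hF (a N)).2 k hk, sub_zero] at this
  have := ge_of_tendsto' tendsto_one_div_add_atTop_nhds_zero_nat h3
  exact norm_le_zero_iff.1 this

lemma tendsto_fourierCoeff_of_tendstoUniformly {α : Type*} {l : Filter α}
    {F : α → UnitAddCircle → ℂ} {f : UnitAddCircle → ℂ} (hF : ∀ a, Integrable (F a) circ)
    (hf : Integrable f circ) (h : TendstoUniformly F f l) (k : ℤ) :
    Tendsto (fun a => fourierCoeff (F a) k) l (𝓝 (fourierCoeff f k)) := by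
  rw [Metric.tendstoUniformly_iff] at h
  rw [Metric.tendsto_nhds]
  intro ε hε
  filter_upwards [h (ε / 2) (half_pos hε)] with a ha
  rw [dist_comm, dist_eq_norm]
  refine (norm_fourierCoeff_sub_le hf (hF a) (fun x => ?_) k).trans_lt (half_lt_self hε)
  rw [← dist_eq_norm]
  exact (ha x).le

/-! ## Matrix loops -/

/-- The algebra of bounded matrix loops all of whose Fourier modes belong to `S`. -/
def matLoops (n : ℕ) (S : AddSubmonoid ℤ) : Subalgebra ℂ (UnitAddCircle → Mat n) where
  carrier := {γ | ∀ a b, (fun x => γ x a b) ∈ hInf S}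
  mul_mem' := by
    intro γ δ hγ hδ a b
    have : (fun x => (γ * δ) x a b) = ∑ c, (fun x => γ x a c) * fun x => δ x c b := by
      ext x
      simp [Matrix.mul_apply]
    rw [this]
    exact Subalgebra.sum_mem _ fun c _ => Subalgebra.mul_mem _ (hγ a c) (hδ c b)
  add_mem' := by
    intro γ δ hγ hδ a b
    exact Subalgebra.add_mem _ (hγ a b) (hδ a b)
  algebraMap_mem' := by
    intro c a b
    have : (fun x => (algebraMap ℂ (UnitAddCircle → Mat n) c) x a b) =
        algebraMap ℂ (UnitAddCircle → ℂ) (if a = b then c else 0) := by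
      ext x
      simp [Matrix.algebraMap_matrix_apply]
    rw [this]
    exact Subalgebra.algebraMap_mem _ _

section MatLoops

variable {n : ℕ} {S : AddSubmonoid ℤ} {γ δ : UnitAddCircle → Mat n}

lemma mul_mem_matLoops (hγ : γ ∈ matLoops n S) (hδ : δ ∈ matLoops n S) :
    (fun x => γ x * δ x) ∈ matLoops n S := Subalgebra.mul_mem _ hγ hδ

lemma matLoops_congr (h : γ =ᵐ[circ] δ) (hγ : γ ∈ matLoops n S) : δ ∈ matLoops n S :=
  fun a b => hInf_congr (by filter_upwards [h] with x hx; rw [hx]) (hγ a b)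

lemma matLoops_mono {T : AddSubmonoid ℤ} (h : S ≤ T) (hγ : γ ∈ matLoops n S) :
    γ ∈ matLoops n T := fun a b => hInf_mono h (hγ a b)

lemma smul_mem_matLoops {f : UnitAddCircle → ℂ} (hf : f ∈ hInf S) (hγ : γ ∈ matLoops n S) :
    (fun x => f x • γ x) ∈ matLoops n S :=
  fun a b => Subalgebra.mul_mem _ hf (hγ a b)

lemma const_mem_matLoops (M : Mat n) : (fun _ => M) ∈ matLoops n S :=
  fun a b => Subalgebra.algebraMap_mem (hInf S) (M a b)

lemma loopCoeff_congr (h : γ =ᵐ[circ] δ) (k : ℤ) : loopCoeff γ k = loopCoeff δ k := by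
  ext a b
  exact fourierCoeff_congr (by filter_upwards [h] with x hx; rw [hx]) k

/-- A loop in `matLoops n S` as a matrix over the ring `hInf S`. -/
def entryMatrix (hγ : γ ∈ matLoops n S) : Matrix (Fin n) (Fin n) (hInf S) :=
  Matrix.of fun a b => ⟨fun x => γ x a b, hγ a b⟩

/-- Evaluation at a point of the circle. -/
def evalHom (S : AddSubmonoid ℤ) (x : UnitAddCircle) : hInf S →+* ℂ :=
  (Pi.evalRingHom (fun _ : UnitAddCircle => ℂ) x).comp (hInf S).val.toRingHom

lemma mapMatrix_evalHom (hγ : γ ∈ matLoops n S) (x : UnitAddCircle) :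
    (evalHom S x).mapMatrix (entryMatrix hγ) = γ x := rfl

/-- Evaluation at a point is a ring homomorphism, so determinants (and adjugates) formed in the
commutative ring `hInf S` are the pointwise ones. Both therefore inherit the condition on the modes.
-/
lemma det_entryMatrix (hγ : γ ∈ matLoops n S) :
    (((entryMatrix hγ).det : hInf S) : UnitAddCircle → ℂ) = fun x => (γ x).det := by
  ext x
  change evalHom S x (entryMatrix hγ).det = _
  rw [RingHom.map_det, mapMatrix_evalHom]

lemma det_mem_hInf (hγ : γ ∈ matLoops n S) : (fun x => (γ x).det) ∈ hInf S := by
  rw [← det_entryMatrix hγ]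
  exact Subtype.property _

lemma adjugate_mem_matLoops (hγ : γ ∈ matLoops n S) :
    (fun x => (γ x).adjugate) ∈ matLoops n S := by
  intro a b
  have h : (fun x => (γ x).adjugate a b) =
      (((entryMatrix hγ).adjugate a b : hInf S) : UnitAddCircle → ℂ) := by
    ext x
    change _ = (evalHom S x).mapMatrix (entryMatrix hγ).adjugate a b
    rw [RingHom.map_adjugate, mapMatrix_evalHom]
  rw [h]
  exact Subtype.property _

lemma inv_ae_eq_adjugate (hdet : ∀ᵐ x ∂circ, (γ x).det = 1) :
    (fun x => (γ x).adjugate) =ᵐ[circ] fun x => (γ x)⁻¹ := by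
  filter_upwards [hdet] with x hx
  rw [Matrix.inv_def, hx, Ring.inverse_one, one_smul]

/-- With determinant one the inverse is the adjugate, whose entries are polynomials in those of `γ`.
Boundedness and one-sidedness of the modes thus pass to the inverse with no analysis at all. -/
lemma inv_mem_matLoops (hγ : γ ∈ matLoops n S) (hdet : ∀ᵐ x ∂circ, (γ x).det = 1) :
    (fun x => (γ x)⁻¹) ∈ matLoops n S :=
  matLoops_congr (inv_ae_eq_adjugate hdet) (adjugate_mem_matLoops hγ)

end MatLoops

/-! ## Uniformly convergent series and exponentials of loops -/

/-- The Weierstrass M-test: convergence is uniform, and Fourier coefficients are continuous for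
uniform convergence. -/
lemma tsum_mem_hInf {ι : Type*} {S : AddSubmonoid ℤ} {f : ι → UnitAddCircle → ℂ} {u : ι → ℝ}
    (hu : Summable u) (hf : ∀ i, f i ∈ hInf S) (h : ∀ i x, ‖f i x‖ ≤ u i) :
    (fun x => ∑' i, f i x) ∈ hInf S ∧
      ∀ k, HasSum (fun i => fourierCoeff (f i) k) (fourierCoeff (fun x => ∑' i, f i x) k) := by
  have hunif := tendstoUniformly_tsum hu h
  have hmem : ∀ s : Finset ι, (fun x => ∑ i ∈ s, f i x) ∈ hInf S := fun s => by
    have := Subalgebra.sum_mem (hInf S) fun i (_ : i ∈ s) => hf i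
    convert! this using 1
    ext x
    simp
  have h1 := mem_hInf_of_tendstoUniformly hmem hunif
  refine ⟨h1, fun k => ?_⟩
  have h2 := tendsto_fourierCoeff_of_tendstoUniformly (fun s => hInf.integrable (hmem s))
    (hInf.integrable h1) hunif k
  refine h2.congr fun s => ?_
  exact fourierCoeff_sum_of_integrable s (fun i _ => hInf.integrable (hf i)) k

section Exp

variable {n : ℕ}

lemma hasSum_exp_matrix (A : Mat n) :
    HasSum (fun k : ℕ => ((k.factorial : ℂ)⁻¹) • A ^ k) (NormedSpace.exp A) := by
  -- A norm on matrices is only chosen locally; the statement depends on the product topology alone.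
  have h := open scoped Matrix.Norms.Operator in NormedSpace.exp_series_hasSum_exp' (𝕂 := ℂ) A
  convert! h

lemma hasSum_exp_apply (A : Mat n) (a b : Fin n) :
    HasSum (fun k : ℕ => ((k.factorial : ℂ)⁻¹) * (A ^ k) a b) (NormedSpace.exp A a b) :=
  Pi.hasSum.1 (Pi.hasSum.1 (hasSum_exp_matrix A) a) b

lemma norm_mul_apply_le {A B : Mat n} {C C' : ℝ} (hA : ∀ a b, ‖A a b‖ ≤ C)
    (hB : ∀ a b, ‖B a b‖ ≤ C') (a b : Fin n) : ‖(A * B) a b‖ ≤ n * C * C' := by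
  rw [Matrix.mul_apply]
  refine (norm_sum_le _ _).trans ?_
  have hC : 0 ≤ C := (norm_nonneg _).trans (hA a a)
  calc ∑ c, ‖A a c * B c b‖ ≤ ∑ _c : Fin n, C * C' := Finset.sum_le_sum fun c _ => by
        rw [norm_mul]
        exact mul_le_mul (hA a c) (hB c b) (norm_nonneg _) hC
    _ = n * C * C' := by simp [mul_assoc]

lemma norm_pow_apply_le {A : Mat n} {C : ℝ} (hA : ∀ a b, ‖A a b‖ ≤ C) (k : ℕ) (a b : Fin n) :
    ‖(A ^ k) a b‖ ≤ (n * C) ^ k := by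
  induction k generalizing a b with
  | zero =>
    rw [pow_zero, pow_zero, Matrix.one_apply]
    split_ifs <;> simp
  | succ k ih =>
    rw [pow_succ', pow_succ']
    exact norm_mul_apply_le hA ih a b

lemma norm_exp_term_le {A : Mat n} {C : ℝ} (hA : ∀ a b, ‖A a b‖ ≤ C) (k : ℕ) (a b : Fin n) :
    ‖((k.factorial : ℂ)⁻¹) * (A ^ k) a b‖ ≤ (n * C) ^ k / k.factorial := by
  rw [norm_mul, norm_inv, Complex.norm_natCast, div_eq_inv_mul]
  exact mul_le_mul_of_nonneg_left (norm_pow_apply_le hA k a b) (by positivity)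

lemma norm_exp_apply_le {A : Mat n} {C : ℝ} (hA : ∀ a b, ‖A a b‖ ≤ C) (a b : Fin n) :
    ‖NormedSpace.exp A a b‖ ≤ Real.exp (n * C) := by
  rw [← (hasSum_exp_apply A a b).tsum_eq, Real.exp_eq_exp_ℝ, NormedSpace.exp_eq_tsum_div]
  exact tsum_of_norm_bounded (NormedSpace.expSeries_div_summable (n * C : ℝ)).hasSum
    (norm_exp_term_le hA · a b)

/-- The remainder of order two of the matrix exponential. -/
lemma norm_exp_sub_one_sub_apply_le {A : Mat n} {C : ℝ} (hA : ∀ a b, ‖A a b‖ ≤ C)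
    (a b : Fin n) :
    ‖(NormedSpace.exp A - 1 - A) a b‖ ≤ (n * C) ^ 2 * Real.exp (n * C) := by
  have hC : 0 ≤ C := (norm_nonneg _).trans (hA a a)
  have h := (hasSum_nat_add_iff' 2).2 (hasSum_exp_apply A a b)
  have h1 : NormedSpace.exp A a b - ∑ i ∈ Finset.range 2, ((i.factorial : ℂ)⁻¹) * (A ^ i) a b =
      (NormedSpace.exp A - 1 - A) a b := by
    simp [Finset.sum_range_succ, sub_sub]
  rw [h1] at h
  rw [← h.tsum_eq, Real.exp_eq_exp_ℝ, NormedSpace.exp_eq_tsum_div]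
  refine tsum_of_norm_bounded
    ((NormedSpace.expSeries_div_summable (n * C : ℝ)).hasSum.mul_left ((n * C : ℝ) ^ 2))
    fun k => ?_
  refine (norm_exp_term_le hA (k + 2) a b).trans ?_
  rw [pow_add, mul_comm, mul_div_assoc]
  gcongr
  omega

/-- The bound is uniform on the circle, so the exponential series converges uniformly inside the
algebra and its Fourier coefficients may be taken term by term. -/
lemma exp_mem_matLoops {S : AddSubmonoid ℤ} {L : UnitAddCircle → Mat n} {C : ℝ}
    (hL : L ∈ matLoops n S) (hC : ∀ x a b, ‖L x a b‖ ≤ C) :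
    (fun x => NormedSpace.exp (L x)) ∈ matLoops n S ∧ ∀ m a b,
      HasSum (fun k : ℕ => ((k.factorial : ℂ)⁻¹) * loopCoeff (L ^ k) m a b)
        (loopCoeff (fun x => NormedSpace.exp (L x)) m a b) := by
  have key : ∀ a b, (fun x => ∑' k : ℕ, ((k.factorial : ℂ)⁻¹) * (L x ^ k) a b) ∈ hInf S ∧
      ∀ m, HasSum (fun k : ℕ => fourierCoeff (fun x => ((k.factorial : ℂ)⁻¹) * (L x ^ k) a b) m)
        (fourierCoeff (fun x => ∑' k : ℕ, ((k.factorial : ℂ)⁻¹) * (L x ^ k) a b) m) :=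
    fun a b => by
      refine tsum_mem_hInf (u := fun k : ℕ => (n * C : ℝ) ^ k / k.factorial)
        (NormedSpace.expSeries_div_summable (n * C : ℝ)) (fun k => ?_)
        (fun k x => norm_exp_term_le (hC x) k a b)
      exact Subalgebra.smul_mem _ (Subalgebra.pow_mem _ hL k a b) ((k.factorial : ℂ)⁻¹)
  have h1 : ∀ a b, (fun x => ∑' k : ℕ, ((k.factorial : ℂ)⁻¹) * (L x ^ k) a b) =
      fun x => NormedSpace.exp (L x) a b := fun a b => by
    ext x
    exact (hasSum_exp_apply (L x) a b).tsum_eq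
  refine ⟨fun a b => h1 a b ▸ (key a b).1, fun m a b => ?_⟩
  have h2 := (key a b).2 m
  rw [h1 a b] at h2
  convert! h2 using 2 with k
  rw [fourierCoeff.const_mul]
  rfl

lemma hasDerivAt_exp_smul_zero (A : Mat n) :
    HasDerivAt (fun s : ℂ => NormedSpace.exp (s • A)) A 0 := by
  have h := open scoped Matrix.Norms.Operator in hasDerivAt_exp_smul_const (𝕂 := ℂ) A (0 : ℂ)
  convert! h using 1
  simp

/-- The exponential of a traceless matrix has determinant one. -/
lemma det_exp_of_trace_eq_zero {A : Mat n} (hA : A.trace = 0) : (NormedSpace.exp A).det = 1 := by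
  -- `f` turns sums into products and `f'(0) = tr A = 0`; hence `f'` vanishes everywhere and `f 1 =
  -- f 0`.
  set f : ℂ → ℂ := fun s => (NormedSpace.exp (s • A)).det with hf
  have hadd : ∀ s t, f (s + t) = f s * f t := fun s t => by
    simp only [hf]
    rw [add_smul, Matrix.exp_add_of_commute _ _ (((Commute.refl A).smul_left s).smul_right t),
      Matrix.det_mul]
  have hentry : ∀ a b, HasDerivAt (fun s : ℂ => NormedSpace.exp (s • A) a b) (A a b) 0 :=
    fun a b => hasDerivAt_pi.1 (hasDerivAt_pi.1 (hasDerivAt_exp_smul_zero A) a) b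
  have h0 : HasDerivAt f 0 0 := by
    have h1 : HasDerivAt f (∑ σ : Equiv.Perm (Fin n), ((Equiv.Perm.sign σ : ℤ) : ℂ) *
        ∑ i, (∏ j ∈ Finset.univ.erase i, NormedSpace.exp ((0 : ℂ) • A) (σ j) j) • A (σ i) i) 0 := by
      simp only [hf, Matrix.det_apply']
      exact HasDerivAt.fun_sum fun σ _ =>
        (HasDerivAt.fun_finsetProd fun i _ => hentry (σ i) i).const_mul _
    convert! h1 using 1
    rw [Finset.sum_eq_single 1]
    · simp only [Equiv.Perm.sign_one, zero_smul, NormedSpace.exp_zero, Equiv.Perm.one_apply,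
        Matrix.one_apply_eq, Finset.prod_const_one, one_smul, Units.val_one, Int.cast_one, one_mul]
      exact hA.symm
    · intro σ _ hσ
      rw [mul_eq_zero]
      right
      -- A nontrivial permutation moves both `k` and `σ k`. Whichever factor is differentiated, an
      -- off-diagonal entry of the identity matrix remains in the product.
      obtain ⟨k, hk⟩ : ∃ k, σ k ≠ k := by
        by_contra! h
        exact hσ (Equiv.ext h)
      refine Finset.sum_eq_zero fun i _ => ?_
      rw [smul_eq_mul, mul_eq_zero]
      left
      simp only [zero_smul, NormedSpace.exp_zero]
      by_cases hi : k = i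
      · refine Finset.prod_eq_zero (i := σ k) (by simp [← hi, hk]) ?_
        exact Matrix.one_apply_ne fun h => hk (σ.injective h)
      · exact Finset.prod_eq_zero (i := k) (by simp [hi]) (Matrix.one_apply_ne hk)
    · simp
  have hderiv : ∀ s, HasDerivAt f 0 s := fun s => by
    have h1 : HasDerivAt (fun t => f s * f (t - s)) (f s * 0) s := by
      have h2 : HasDerivAt f 0 (s - s) := by rwa [sub_self]
      have := (h2.comp_sub_const s s).const_mul (f s)
      exact this
    rw [mul_zero] at h1
    convert! h1 using 1
    ext t
    rw [← hadd, add_sub_cancel]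
  have h1 := is_const_of_deriv_eq_zero (fun s => (hderiv s).differentiableAt)
    (fun s => (hderiv s).deriv) 1 0
  simpa [hf] using h1

end Exp

/-! ## Loops with nonpositive modes as power series in `z⁻¹` -/

section Series

variable {n : ℕ} {γ δ : UnitAddCircle → Mat n}

/-- Only finitely many pairs of nonpositive indices add up to `-m`, so the convolution is the Cauchy
product of power series in `z⁻¹`. This makes `serHom` multiplicative. -/
lemma fourierCoeff_mul_of_nonpos {f g : UnitAddCircle → ℂ} (hf : f ∈ hInf nonposModes)
    (hg : g ∈ hInf nonposModes) (m : ℕ) :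
    fourierCoeff (fun x => f x * g x) (-(m : ℤ)) =
      ∑ p ∈ Finset.HasAntidiagonal.antidiagonal m, fourierCoeff f (-(p.1 : ℤ)) * fourierCoeff g (-(p.2 : ℤ)) := by
  have h := hasSum_fourierCoeff_mul (hInf.memLp_two hf) (hInf.memLp_two hg) (-(m : ℤ))
  rw [mem_hInf_nonpos] at hf hg
  have h1 := hasSum_sum_of_ne_finset_zero
    (s := (Finset.HasAntidiagonal.antidiagonal m).image fun p => -(p.2 : ℤ))
    (f := fun k => fourierCoeff f (-(m : ℤ) - k) * fourierCoeff g k) (L := .unconditional ℤ) (by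
      intro k hk
      rcases lt_or_ge 0 k with h0 | h0
      · rw [hg.2 k h0, mul_zero]
      · rcases lt_or_ge 0 (-(m : ℤ) - k) with h1 | h1
        · rw [hf.2 _ h1, zero_mul]
        · refine absurd (Finset.mem_image.2 ⟨(m - k.natAbs, k.natAbs), ?_, ?_⟩) hk
          · rw [Finset.HasAntidiagonal.mem_antidiagonal]
            omega
          · simp only
            omega)
  rw [h.unique h1, Finset.sum_image]
  · refine Finset.sum_congr rfl fun p hp => ?_
    rw [Finset.HasAntidiagonal.mem_antidiagonal] at hp
    congr 2
    omega
  · intro p hp q hq hpq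
    simp only [Finset.mem_coe, Finset.HasAntidiagonal.mem_antidiagonal] at hp hq hpq
    ext <;> omega

/-- The power series in `z⁻¹` of a bounded function with nonpositive modes. -/
def serHom : hInf nonposModes →+* PowerSeries ℂ where
  toFun f := PowerSeries.mk fun m => fourierCoeff (f : UnitAddCircle → ℂ) (-(m : ℤ))
  map_one' := by
    ext m
    have := fourierCoeff_one (-(m : ℤ))
    rw [PowerSeries.coeff_mk, PowerSeries.coeff_one]
    simpa using! this
  map_mul' f g := by
    ext m
    rw [PowerSeries.coeff_mk, PowerSeries.coeff_mul]
    simp only [PowerSeries.coeff_mk]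
    exact fourierCoeff_mul_of_nonpos f.2 g.2 m
  map_zero' := by
    ext m
    rw [PowerSeries.coeff_mk]
    simp [fourierCoeff]
  map_add' f g := by
    ext m
    rw [PowerSeries.coeff_mk, map_add]
    simp only [PowerSeries.coeff_mk]
    exact fourierCoeff_add_of_integrable (hInf.integrable f.2) (hInf.integrable g.2) _

lemma coeff_serHom (f : hInf nonposModes) (m : ℕ) :
    PowerSeries.coeff m (serHom f) = fourierCoeff (f : UnitAddCircle → ℂ) (-(m : ℤ)) := by
  change PowerSeries.coeff m (PowerSeries.mk fun m => fourierCoeff f.1 (-(m : ℤ))) = _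
  rw [PowerSeries.coeff_mk]

/-- The coefficient of `z⁻ᴺ` of the determinant only depends on the modes of index at least
`-N`. -/
lemma fourierCoeff_det_congr (hγ : γ ∈ matLoops n nonposModes) (hδ : δ ∈ matLoops n nonposModes)
    (N : ℕ) (h : ∀ m ≤ N, loopCoeff γ (-(m : ℤ)) = loopCoeff δ (-(m : ℤ))) :
    fourierCoeff (fun x => (γ x).det) (-(N : ℤ)) =
      fourierCoeff (fun x => (δ x).det) (-(N : ℤ)) := by
  -- Modulo `z^{-(N+1)}` the two matrices coincide, and the determinant commutes with ring
  -- homomorphisms.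
  set I : Ideal (PowerSeries ℂ) := Ideal.span {PowerSeries.X ^ (N + 1)}
  have h1 : ((Ideal.Quotient.mk I).comp serHom).mapMatrix (entryMatrix hγ) =
      ((Ideal.Quotient.mk I).comp serHom).mapMatrix (entryMatrix hδ) := by
    ext a b
    simp only [RingHom.mapMatrix_apply, Matrix.map_apply, RingHom.comp_apply]
    rw [Ideal.Quotient.eq, Ideal.mem_span_singleton, PowerSeries.X_pow_dvd_iff]
    intro m hm
    rw [map_sub, coeff_serHom, coeff_serHom, sub_eq_zero]
    exact congrFun (congrFun (h m (by omega)) a) b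
  have h2 := congrArg Matrix.det h1
  rw [← RingHom.map_det, ← RingHom.map_det, RingHom.comp_apply, RingHom.comp_apply,
    Ideal.Quotient.eq, Ideal.mem_span_singleton, PowerSeries.X_pow_dvd_iff] at h2
  have h3 := h2 N (by omega)
  rwa [map_sub, coeff_serHom, coeff_serHom, sub_eq_zero, det_entryMatrix, det_entryMatrix] at h3

lemma loopCoeff_mul_apply {S T : AddSubmonoid ℤ} (hγ : γ ∈ matLoops n S)
    (hδ : δ ∈ matLoops n T) (k : ℤ) (a b : Fin n) :
    loopCoeff (fun x => γ x * δ x) k a b =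
      ∑ c, fourierCoeff (fun x => γ x a c * δ x c b) k := by
  have h := fourierCoeff_sum_of_integrable Finset.univ (F := fun c x => γ x a c * δ x c b)
    (fun c _ => hInf.integrable (Subalgebra.mul_mem (hInf ⊤) (hInf_mono le_top (hγ a c))
      (hInf_mono le_top (hδ c b)))) k
  rw [← h]
  simp only [loopCoeff, Matrix.of_apply]
  rfl

lemma loopCoeff_mul_of_nonpos (hγ : γ ∈ matLoops n nonposModes)
    (hδ : δ ∈ matLoops n nonposModes) (m : ℕ) :
    loopCoeff (fun x => γ x * δ x) (-(m : ℤ)) =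
      ∑ p ∈ Finset.HasAntidiagonal.antidiagonal m, loopCoeff γ (-(p.1 : ℤ)) * loopCoeff δ (-(p.2 : ℤ)) := by
  ext a b
  rw [loopCoeff_mul_apply hγ hδ, Matrix.sum_apply]
  simp only [Matrix.mul_apply, loopCoeff, Matrix.of_apply]
  rw [Finset.sum_comm]
  exact Finset.sum_congr rfl fun c _ => fourierCoeff_mul_of_nonpos (hγ a c) (hδ c b) m

lemma loopCoeff_one (k : ℤ) :
    loopCoeff (fun _ => (1 : Mat n)) k = if k = 0 then 1 else 0 := by
  ext a b
  have h : (fun _ : UnitAddCircle => (1 : Mat n) a b) =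
      fun x => (1 : Mat n) a b * (fun _ => (1 : ℂ)) x := by simp
  rw [loopCoeff, Matrix.of_apply, h, fourierCoeff.const_mul, fourierCoeff_one]
  split_ifs <;> simp

lemma coeff_pow_of_lt {R : Type*} [Ring R] {X : PowerSeries R} (hX : PowerSeries.coeff 0 X = 0)
    {m k : ℕ} (h : m < k) : PowerSeries.coeff m (X ^ k) = 0 := by
  induction k generalizing m with
  | zero => omega
  | succ k ih =>
    rw [pow_succ', PowerSeries.coeff_mul]
    refine Finset.sum_eq_zero fun p hp => ?_
    rw [Finset.HasAntidiagonal.mem_antidiagonal] at hp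
    rcases Nat.eq_zero_or_pos p.1 with h0 | h0
    · rw [h0, hX, zero_mul]
    · rw [ih (by omega), mul_zero]

/-- The truncation at order `N` of a power series in `z⁻¹`, as a matrix loop. -/
def truncLoop (X : PowerSeries (Mat n)) (N : ℕ) (x : UnitAddCircle) : Mat n :=
  ∑ m ∈ Finset.range (N + 1), (fourier (-(m : ℤ)) x : ℂ) • PowerSeries.coeff m X

lemma truncLoop_mem (X : PowerSeries (Mat n)) (N : ℕ) :
    truncLoop X N ∈ matLoops n nonposModes := by
  have h : ∀ m ∈ Finset.range (N + 1),
      (fun x : UnitAddCircle => (fourier (-(m : ℤ)) x : ℂ) • PowerSeries.coeff m X) ∈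
        matLoops n nonposModes := fun m _ =>
    smul_mem_matLoops (fourier_mem_hInf (mem_nonposModes.2 (by omega))) (const_mem_matLoops _)
  convert! Subalgebra.sum_mem _ h using 1
  ext x
  simp [truncLoop]

lemma exists_norm_truncLoop_le (X : PowerSeries (Mat n)) (N : ℕ) :
    ∃ C, ∀ x a b, ‖truncLoop X N x a b‖ ≤ C := by
  refine ⟨∑ m ∈ Finset.range (N + 1), ∑ a, ∑ b, ‖PowerSeries.coeff m X a b‖, fun x a b => ?_⟩
  rw [truncLoop, Matrix.sum_apply]
  refine (norm_sum_le _ _).trans (Finset.sum_le_sum fun m _ => ?_)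
  rw [Matrix.smul_apply, norm_smul, fourier_apply, Circle.norm_coe, one_mul]
  exact (Finset.single_le_sum (f := fun b => ‖PowerSeries.coeff m X a b‖)
    (fun _ _ => norm_nonneg _) (Finset.mem_univ b)).trans
    (Finset.single_le_sum (f := fun a => ∑ b, ‖PowerSeries.coeff m X a b‖)
      (fun _ _ => Finset.sum_nonneg fun _ _ => norm_nonneg _) (Finset.mem_univ a))

lemma loopCoeff_truncLoop (X : PowerSeries (Mat n)) {N m : ℕ} (hm : m ≤ N) :
    loopCoeff (truncLoop X N) (-(m : ℤ)) = PowerSeries.coeff m X := by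
  ext a b
  have h : (fun x => truncLoop X N x a b) = fun x => ∑ j ∈ Finset.range (N + 1),
      (fun x => (fourier (-(j : ℤ)) x : ℂ) *
        (fun _ : UnitAddCircle => PowerSeries.coeff j X a b) x) x := by
    ext x
    simp [truncLoop, Matrix.sum_apply]
  rw [loopCoeff, Matrix.of_apply, h, fourierCoeff_sum_of_integrable, Finset.sum_eq_single m]
  · have h1 : (fun _ : UnitAddCircle => PowerSeries.coeff m X a b) =
        fun x => PowerSeries.coeff m X a b * (fun _ => (1 : ℂ)) x := by simp
    rw [fourierCoeff_fourier_mul, h1, fourierCoeff.const_mul, fourierCoeff_one]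
    simp
  · intro j _ hj
    have h1 : (fun _ : UnitAddCircle => PowerSeries.coeff j X a b) =
        fun x => PowerSeries.coeff j X a b * (fun _ => (1 : ℂ)) x := by simp
    have h2 : -(m : ℤ) - -(j : ℤ) ≠ 0 := by omega
    rw [fourierCoeff_fourier_mul, h1, fourierCoeff.const_mul, fourierCoeff_one, if_neg h2,
      mul_zero]
  · intro h
    exact absurd (Finset.mem_range.2 (by omega)) h
  · intro j _
    exact hInf.integrable (Subalgebra.mul_mem _
      (fourier_mem_hInf (S := ⊤) (AddSubmonoid.mem_top _)) (Subalgebra.algebraMap_mem _ _))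

lemma loopCoeff_truncLoop_pow (X : PowerSeries (Mat n)) {N m : ℕ} (k : ℕ) (hm : m ≤ N) :
    loopCoeff (truncLoop X N ^ k) (-(m : ℤ)) = PowerSeries.coeff m (X ^ k) := by
  induction k generalizing m with
  | zero =>
    rw [pow_zero, pow_zero, PowerSeries.coeff_one]
    refine (loopCoeff_one _).trans ?_
    simp
  | succ k ih =>
    rw [pow_succ', pow_succ', PowerSeries.coeff_mul]
    refine (loopCoeff_mul_of_nonpos (truncLoop_mem X N)
      (Subalgebra.pow_mem _ (truncLoop_mem X N) k) m).trans ?_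
    refine Finset.sum_congr rfl fun p hp => ?_
    rw [Finset.HasAntidiagonal.mem_antidiagonal] at hp
    rw [loopCoeff_truncLoop X (by omega), ih (by omega)]

lemma exp_truncLoop_mem (X : PowerSeries (Mat n)) (N : ℕ) :
    (fun x => NormedSpace.exp (truncLoop X N x)) ∈ matLoops n nonposModes := by
  obtain ⟨C, hC⟩ := exists_norm_truncLoop_le X N
  exact (exp_mem_matLoops (truncLoop_mem X N) hC).1

/-- The formal series `X` need not converge on the circle, but a truncation can be exponentiated
there. Its coefficients of order at most `N` are those of the formal exponential: order `m` sees
only `X_1, …, X_m`, and powers above the `m`-th do not contribute. -/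
lemma loopCoeff_exp_truncLoop {X : PowerSeries (Mat n)} (hX : PowerSeries.coeff 0 X = 0)
    {N m : ℕ} (hm : m ≤ N) :
    loopCoeff (fun x => NormedSpace.exp (truncLoop X N x)) (-(m : ℤ)) = expCoeff X m := by
  obtain ⟨C, hC⟩ := exists_norm_truncLoop_le X N
  ext a b
  have h := (exp_mem_matLoops (truncLoop_mem X N) hC).2 (-(m : ℤ)) a b
  simp only [loopCoeff_truncLoop_pow X _ hm] at h
  have h1 := hasSum_sum_of_ne_finset_zero (s := Finset.range (m + 1)) (L := .unconditional ℕ)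
    (f := fun k : ℕ => ((k.factorial : ℂ)⁻¹) * (PowerSeries.coeff m (X ^ k) : Mat n) a b) (by
      intro k hk
      rw [Finset.mem_range] at hk
      rw [coeff_pow_of_lt hX (by omega), Matrix.zero_apply, mul_zero])
  rw [h.unique h1, expCoeff, Matrix.sum_apply]
  simp

lemma truncLoop_neg (X : PowerSeries (Mat n)) (N : ℕ) (x : UnitAddCircle) :
    truncLoop (-X) N x = -truncLoop X N x := by
  simp [truncLoop]

/-- `e^X` has determinant one if `X` is traceless. -/
lemma det_ae_eq_one_of_expCoeff (hγ : γ ∈ matLoops n nonposModes) {X : PowerSeries (Mat n)}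
    (hX : PowerSeries.coeff 0 X = 0) (htr : ∀ m, (PowerSeries.coeff m X).trace = 0)
    (h : ∀ m : ℕ, loopCoeff γ (-(m : ℤ)) = expCoeff X m) : ∀ᵐ x ∂circ, (γ x).det = 1 := by
  have hdet := det_mem_hInf hγ
  have h1 : (fun _ => (1 : ℂ)) ∈ hInf nonposModes := Subalgebra.one_mem _
  refine ae_eq_of_fourierCoeff (hInf.memLp_two hdet) (hInf.memLp_two h1) fun k => ?_
  rcases lt_or_ge 0 k with hk | hk
  · rw [(mem_hInf_nonpos.1 hdet).2 k hk, (mem_hInf_nonpos.1 h1).2 k hk]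
  · obtain ⟨N, rfl⟩ : ∃ N : ℕ, k = -(N : ℤ) := ⟨k.natAbs, by omega⟩
    -- The truncation order is adapted to the coefficient under study: `γ` and `e^{X_{≤N}}` have the
    -- same coefficient of `z⁻ᴺ` in their determinants, and the second determinant is identically
    -- one.
    rw [fourierCoeff_det_congr hγ (exp_truncLoop_mem X N) N fun m hm => by
      rw [h, loopCoeff_exp_truncLoop hX hm]]
    congr 1
    ext x
    apply det_exp_of_trace_eq_zero
    simp [truncLoop, Matrix.trace_sum, htr]

/-- The identity `e^{-X} e^X = 1` of formal series, read off at order `m` from the genuine loops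
`e^{∓X_{≤m}}`, which are inverse to each other. -/
lemma sum_expCoeff_neg_mul {X : PowerSeries (Mat n)} (hX : PowerSeries.coeff 0 X = 0) :
    PowerSeries.mk (expCoeff (-X)) * PowerSeries.mk (expCoeff X) = 1 := by
  ext1 m
  have hX' : PowerSeries.coeff 0 (-X) = 0 := by rw [map_neg, hX, neg_zero]
  rw [PowerSeries.coeff_mul]
  have h := loopCoeff_mul_of_nonpos (exp_truncLoop_mem (-X) m) (exp_truncLoop_mem X m) m
  have h1 : (fun x => NormedSpace.exp (truncLoop (-X) m x) * NormedSpace.exp (truncLoop X m x)) =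
      fun _ => (1 : Mat n) := by
    ext1 x
    rw [truncLoop_neg, ← Matrix.exp_add_of_commute _ _ ((Commute.refl (truncLoop X m x)).neg_left), neg_add_cancel,
      NormedSpace.exp_zero]
  rw [h1, loopCoeff_one] at h
  rw [PowerSeries.coeff_one]
  simp only [PowerSeries.coeff_mk]
  rw [Finset.sum_congr rfl fun p hp => ?_, ← h]
  · simp
  · rw [Finset.HasAntidiagonal.mem_antidiagonal] at hp
    rw [loopCoeff_exp_truncLoop hX' (by omega), loopCoeff_exp_truncLoop hX (by omega)]

/-- The series of `δ` is a right inverse and `e^{-X}` a left inverse of the same series, so they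
agree. -/
lemma loopCoeff_eq_expCoeff_neg (hγ : γ ∈ matLoops n nonposModes)
    (hδ : δ ∈ matLoops n nonposModes) {X : PowerSeries (Mat n)}
    (hX : PowerSeries.coeff 0 X = 0)
    (h : ∀ m : ℕ, loopCoeff γ (-(m : ℤ)) = expCoeff X m)
    (hmul : ∀ᵐ x ∂circ, γ x * δ x = 1) (m : ℕ) :
    loopCoeff δ (-(m : ℤ)) = expCoeff (-X) m := by
  have h1 : PowerSeries.mk (expCoeff X) * PowerSeries.mk (fun m => loopCoeff δ (-(m : ℤ))) = 1 := by
    ext1 m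
    rw [PowerSeries.coeff_mul, PowerSeries.coeff_one]
    simp only [PowerSeries.coeff_mk]
    have h2 := loopCoeff_mul_of_nonpos hγ hδ m
    rw [loopCoeff_congr (δ := fun _ => 1) hmul, loopCoeff_one] at h2
    simp only [h] at h2
    rw [← h2]
    simp
  have h2 := left_inv_eq_right_inv (sum_expCoeff_neg_mul hX) h1
  have h3 := congrArg (PowerSeries.coeff m) h2
  simp only [PowerSeries.coeff_mk] at h3
  exact h3.symm

end Series

/-! ## Triangular decomposition -/

section Triangular

variable {L ι : Type*} [LieRing L] [LieAlgebra ℂ L]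

/-- The span of the iterated brackets `[e_{i₀}, [e_{i₁}, …, e_{i_d}]]` of length `d + 1`. -/
def iterLie (e : ι → L) : ℕ → Submodule ℂ L
  | 0 => Submodule.span ℂ (Set.range e)
  | d + 1 => Submodule.span ℂ {y | ∃ i, ∃ x ∈ iterLie e d, y = ⁅e i, x⁆}

variable {e f h : ι → L}

/-- The description of `M` as a span enters as an equation, so that `rfl` can supply it for each
level of `iterLie`. -/
lemma mem_of_mem_span_of_lie {s : Set L} {M N : Submodule ℂ L} (u : L) (hM : M = Submodule.span ℂ s)
    (hs : ∀ x ∈ s, ⁅u, x⁆ ∈ N) {x : L} (hx : x ∈ M) : ⁅u, x⁆ ∈ N := by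
  subst hM
  induction hx using Submodule.span_induction with
  | mem x hx => exact hs x hx
  | zero => rw [lie_zero]; exact N.zero_mem
  | add x y _ _ hx hy => rw [lie_add]; exact N.add_mem hx hy
  | smul a x _ hx => rw [lie_smul]; exact N.smul_mem a hx

lemma mem_of_mem_span_of_lie_left {s : Set L} {M N : Submodule ℂ L} (u : L)
    (hM : M = Submodule.span ℂ s) (hs : ∀ x ∈ s, ⁅x, u⁆ ∈ N) {x : L} (hx : x ∈ M) :
    ⁅x, u⁆ ∈ N := by
  rw [← lie_skew]
  refine N.neg_mem (mem_of_mem_span_of_lie u hM (fun y hy => ?_) hx)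
  rw [← lie_skew]
  exact N.neg_mem (hs y hy)

lemma lie_iterLie (i : ι) {d : ℕ} {x : L} (hx : x ∈ iterLie e d) : ⁅e i, x⁆ ∈ iterLie e (d + 1) :=
  Submodule.subset_span ⟨i, x, hx, rfl⟩

lemma lie_cartan_mem_iterLie {c : ι → ι → ℂ} (he : ∀ i j, ⁅h i, e j⁆ = c i j • e j) (i : ι) {d : ℕ}
    {x : L} (hx : x ∈ iterLie e d) : ⁅h i, x⁆ ∈ iterLie e d := by
  induction d generalizing x with
  | zero =>
    refine mem_of_mem_span_of_lie (h i) rfl ?_ hx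
    rintro _ ⟨j, rfl⟩
    rw [he]
    exact Submodule.smul_mem _ _ (Submodule.subset_span ⟨j, rfl⟩)
  | succ d ih =>
    refine mem_of_mem_span_of_lie (h i) rfl ?_ hx
    rintro _ ⟨j, y, hy, rfl⟩
    rw [leibniz_lie, he, smul_lie]
    exact Submodule.add_mem _ (Submodule.smul_mem _ _ (lie_iterLie j hy)) (lie_iterLie j (ih hy))

lemma lie_span_cartan_mem {M N : Submodule ℂ L} (hM : ∀ i, ∀ x ∈ M, ⁅h i, x⁆ ∈ N)
    {y x : L} (hy : y ∈ Submodule.span ℂ (Set.range h)) (hx : x ∈ M) : ⁅y, x⁆ ∈ N := by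
  refine mem_of_mem_span_of_lie_left x rfl ?_ hy
  rintro _ ⟨i, rfl⟩
  exact hM i x hx

lemma lie_span_cartan_mem_iterLie_zero {c : ι → ι → ℂ} (he : ∀ i j, ⁅h i, e j⁆ = c i j • e j)
    (i : ι) {y : L} (hy : y ∈ Submodule.span ℂ (Set.range h)) : ⁅e i, y⁆ ∈ iterLie e 0 := by
  refine mem_of_mem_span_of_lie (e i) rfl ?_ hy
  rintro _ ⟨j, rfl⟩
  rw [← lie_skew, he]
  exact Submodule.neg_mem _ (Submodule.smul_mem _ _ (Submodule.subset_span ⟨i, rfl⟩))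

lemma lower_iterLie_zero (hfe : ∀ i j, ⁅f i, e j⁆ ∈ Submodule.span ℂ (Set.range h)) (i : ι) {x : L}
    (hx : x ∈ iterLie e 0) : ⁅f i, x⁆ ∈ Submodule.span ℂ (Set.range h) := by
  refine mem_of_mem_span_of_lie (f i) rfl ?_ hx
  rintro _ ⟨j, rfl⟩
  exact hfe i j

/-- By the Leibniz rule, `f_i` either meets the leading `e_j`, leaving a Cartan element that
preserves the level, or passes to the shorter bracket, where induction applies. The hypotheses are
symmetric enough to be used with `e` and `f` exchanged. -/
lemma lower_iterLie {c : ι → ι → ℂ} (he : ∀ i j, ⁅h i, e j⁆ = c i j • e j)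
    (hfe : ∀ i j, ⁅f i, e j⁆ ∈ Submodule.span ℂ (Set.range h)) (i : ι) {d : ℕ} {x : L}
    (hx : x ∈ iterLie e (d + 1)) : ⁅f i, x⁆ ∈ iterLie e d := by
  induction d generalizing x with
  | zero =>
    refine mem_of_mem_span_of_lie (f i) rfl ?_ hx
    rintro _ ⟨j, y, hy, rfl⟩
    rw [leibniz_lie]
    refine Submodule.add_mem _ ?_ ?_
    · exact lie_span_cartan_mem (fun k z hz => lie_cartan_mem_iterLie he k hz) (hfe i j) hy
    · exact lie_span_cartan_mem_iterLie_zero he j (lower_iterLie_zero hfe i hy)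
  | succ d ih =>
    refine mem_of_mem_span_of_lie (f i) rfl ?_ hx
    rintro _ ⟨j, y, hy, rfl⟩
    rw [leibniz_lie]
    refine Submodule.add_mem _ ?_ (lie_iterLie j (ih hy))
    exact lie_span_cartan_mem (fun k z hz => lie_cartan_mem_iterLie he k hz) (hfe i j) hy

/-- The graded pieces of the triangular decomposition. -/
def triang (e f h : ι → L) : ℤ → Submodule ℂ L
  | Int.ofNat 0 => Submodule.span ℂ (Set.range h)
  | Int.ofNat (d + 1) => iterLie e d
  | Int.negSucc d => iterLie f d

/-- Commutation relations of Chevalley generators. -/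
structure ChevalleyRel (c : ι → ι → ℂ) (e f h : ι → L) : Prop where
  h_e : ∀ i j, ⁅h i, e j⁆ = c i j • e j
  h_f : ∀ i j, ⁅h i, f j⁆ = -c i j • f j
  h_h : ∀ i j, ⁅h i, h j⁆ = 0
  f_e : ∀ i j, ⁅f i, e j⁆ ∈ Submodule.span ℂ (Set.range h)

namespace ChevalleyRel

variable {c : ι → ι → ℂ} (R : ChevalleyRel c e f h)
include R

lemma e_f (i j : ι) : ⁅e i, f j⁆ ∈ Submodule.span ℂ (Set.range h) := by
  rw [← lie_skew]
  exact Submodule.neg_mem _ (R.f_e j i)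

lemma lie_e_triang (i : ι) (d : ℤ) {x : L} (hx : x ∈ triang e f h d) :
    ⁅e i, x⁆ ∈ triang e f h (d + 1) := by
  match d with
  | Int.ofNat 0 => exact lie_span_cartan_mem_iterLie_zero R.h_e i hx
  | Int.ofNat (d + 1) => exact lie_iterLie i hx
  | Int.negSucc 0 => exact lower_iterLie_zero R.e_f i hx
  | Int.negSucc (d + 1) => exact lower_iterLie R.h_f R.e_f i hx

lemma lie_f_triang (i : ι) (d : ℤ) {x : L} (hx : x ∈ triang e f h d) :
    ⁅f i, x⁆ ∈ triang e f h (d - 1) := by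
  match d with
  | Int.ofNat 0 => exact lie_span_cartan_mem_iterLie_zero R.h_f i hx
  | Int.ofNat 1 => exact lower_iterLie_zero R.f_e i hx
  | Int.ofNat (d + 2) =>
    have h1 : Int.ofNat (d + 2) - 1 = Int.ofNat (d + 1) := by
      simp only [Int.ofNat_eq_natCast]; push_cast; ring
    rw [h1]
    exact lower_iterLie R.h_e R.f_e i hx
  | Int.negSucc d => exact lie_iterLie i hx

lemma lie_h_triang (i : ι) (d : ℤ) {x : L} (hx : x ∈ triang e f h d) :
    ⁅h i, x⁆ ∈ triang e f h d := by
  match d with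
  | Int.ofNat 0 =>
    refine mem_of_mem_span_of_lie (h i) rfl ?_ hx
    rintro _ ⟨j, rfl⟩
    rw [R.h_h]
    exact Submodule.zero_mem _
  | Int.ofNat (d + 1) => exact lie_cartan_mem_iterLie R.h_e i hx
  | Int.negSucc d => exact lie_cartan_mem_iterLie R.h_f i hx

omit R in
-- By the Jacobi identity, bracketing with `[g_i, x]` is a commutator of two operators whose degrees
-- add up. The family `g` is `e` with `s = 1` or `f` with `s = -1`; level `k` consists of brackets
-- of `k + 1` generators, hence the factor `k + 1`.
lemma lie_iterLie_triang {g : ι → L} {s : ℤ}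
    (hg : ∀ i d, ∀ x ∈ triang e f h d, ⁅g i, x⁆ ∈ triang e f h (d + s)) {k : ℕ} {x : L}
    (hx : x ∈ iterLie g k) {d : ℤ} {y : L} (hy : y ∈ triang e f h d) :
    ⁅x, y⁆ ∈ triang e f h (d + (k + 1) * s) := by
  induction k generalizing x y d with
  | zero =>
    refine mem_of_mem_span_of_lie_left y rfl ?_ hx
    rintro _ ⟨i, rfl⟩
    simpa using hg i d y hy
  | succ k ih =>
    refine mem_of_mem_span_of_lie_left y rfl ?_ hx
    rintro _ ⟨i, x, hx, rfl⟩
    rw [lie_lie]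
    refine Submodule.sub_mem _ ?_ ?_
    · have := hg i _ _ (ih hx hy)
      convert! this using 2
      push_cast
      ring
    · have := ih hx (hg i d y hy)
      convert! this using 2
      push_cast
      ring

/-- The pieces are closed under the bracket additively in the degree, so they contain every
homogeneous element generated by `e`, `f`, `h`. In positive degree this excludes any need for the
`f_i`, in particular for `f_0 = z⁻¹ F_0`. -/
lemma lie_triang {d d' : ℤ} {x y : L} (hx : x ∈ triang e f h d) (hy : y ∈ triang e f h d') :
    ⁅x, y⁆ ∈ triang e f h (d + d') := by
  match d with
  | Int.ofNat 0 =>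
    have h1 : Int.ofNat 0 + d' = d' := by simp
    rw [h1]
    exact lie_span_cartan_mem (fun i z hz => R.lie_h_triang i d' hz) hx hy
  | Int.ofNat (d + 1) =>
    have := lie_iterLie_triang (fun i d x hx => R.lie_e_triang i d hx) hx hy
    convert! this using 2
    simp only [Int.ofNat_eq_natCast]
    push_cast
    ring
  | Int.negSucc d =>
    have := lie_iterLie_triang (s := -1) (fun i d x hx => R.lie_f_triang i d hx) hx hy
    convert! this using 2
    rw [Int.negSucc_eq]
    ring

end ChevalleyRel

end Triangular

/-! ## Values of matrix Laurent polynomials -/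

section EvalAt

variable {n : ℕ}

lemma evalAt_zero (z : ℂ) : evalAt (0 : LoopPoly n) z = 0 := rfl

lemma evalAt_add (P Q : LoopPoly n) (z : ℂ) : evalAt (P + Q) z = evalAt P z + evalAt Q z :=
  Finsupp.sum_add_index' (fun _ => smul_zero _) fun _ _ _ => smul_add _ _ _

lemma evalAt_mono (k : ℤ) (X : Mat n) (z : ℂ) : evalAt (mono k X) z = z ^ k • X := by
  rw [mono, ← LaurentPolynomial.single_eq_C_mul_T]
  exact Finsupp.sum_single_index (smul_zero _)

lemma smul_mono (a : ℂ) (k : ℤ) (X : Mat n) : a • mono k X = mono k (a • X) := by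
  rw [mono, mono, ← LaurentPolynomial.single_eq_C_mul_T, ← LaurentPolynomial.single_eq_C_mul_T]
  exact AddMonoidAlgebra.smul_single _ _ _

lemma mono_mul_mono (k m : ℤ) (X Y : Mat n) : mono k X * mono m Y = mono (k + m) (X * Y) := by
  simp only [mono, ← LaurentPolynomial.single_eq_C_mul_T]
  exact AddMonoidAlgebra.single_mul_single ..

lemma mono_sub (k : ℤ) (X Y : Mat n) : mono k (X - Y) = mono k X - mono k Y := by
  simp [mono, sub_mul]

lemma mono_zero (k : ℤ) : mono k (0 : Mat n) = 0 := by simp [mono]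

lemma mono_neg (k : ℤ) (X : Mat n) : mono k (-X) = -mono k X := by
  rw [← zero_sub, mono_sub, mono_zero, zero_sub]

lemma lie_mono_mono (k m : ℤ) (X Y : Mat n) : ⁅mono k X, mono m Y⁆ = mono (k + m) ⁅X, Y⁆ := by
  rw [Ring.lie_def, Ring.lie_def, mono_mul_mono, mono_mul_mono, mono_sub, add_comm m k]

lemma evalAt_smul (a : ℂ) (P : LoopPoly n) (z : ℂ) : evalAt (a • P) z = a • evalAt P z := by
  induction P using LaurentPolynomial.induction_on' with
  | add P Q hP hQ => rw [smul_add, evalAt_add, hP, hQ, evalAt_add, smul_add]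
  | C_mul_T k X =>
    change evalAt (a • mono k X) z = a • evalAt (mono k X) z
    rw [smul_mono, evalAt_mono, evalAt_mono, smul_comm]

lemma evalAt_mul (P Q : LoopPoly n) {z : ℂ} (hz : z ≠ 0) :
    evalAt (P * Q) z = evalAt P z * evalAt Q z := by
  induction P using LaurentPolynomial.induction_on' with
  | add P P' hP hP' => rw [add_mul, evalAt_add, hP, hP', evalAt_add, add_mul]
  | C_mul_T k X =>
    induction Q using LaurentPolynomial.induction_on' with
    | add Q Q' hQ hQ' => rw [mul_add, evalAt_add, hQ, hQ', evalAt_add, mul_add]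
    | C_mul_T m Y =>
      change evalAt (mono k X * mono m Y) z = evalAt (mono k X) z * evalAt (mono m Y) z
      rw [mono_mul_mono, evalAt_mono, evalAt_mono, evalAt_mono, zpow_add₀ hz, smul_mul_smul_comm]

lemma evalAt_sub (P Q : LoopPoly n) (z : ℂ) : evalAt (P - Q) z = evalAt P z - evalAt Q z := by
  rw [eq_sub_iff_add_eq, ← evalAt_add, sub_add_cancel]

lemma evalAt_lie (P Q : LoopPoly n) {z : ℂ} (hz : z ≠ 0) :
    evalAt ⁅P, Q⁆ z = evalAt P z * evalAt Q z - evalAt Q z * evalAt P z := by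
  rw [Ring.lie_def, evalAt_sub, evalAt_mul _ _ hz, evalAt_mul _ _ hz]

lemma norm_zed (x : UnitAddCircle) : ‖zed x‖ = 1 := by
  rw [zed, fourier_apply, Circle.norm_coe]

lemma zed_ne_zero (x : UnitAddCircle) : zed x ≠ 0 := fun h => by
  simpa [h] using norm_zed x

lemma zed_zpow (k : ℤ) (x : UnitAddCircle) : zed x ^ k = fourier k x := by
  rw [zed, fourier_apply, fourier_apply, one_zsmul, toCircle_zsmul, Circle.coe_zpow]

lemma norm_evalAt_le (P : LoopPoly n) (x : UnitAddCircle) (a b : Fin n) :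
    ‖evalAt P (zed x) a b‖ ≤ weight 1 P := by
  rw [evalAt, weight, Finsupp.sum, Finsupp.sum, Matrix.sum_apply]
  refine (norm_sum_le _ _).trans (Finset.sum_le_sum fun k _ => ?_)
  rw [Matrix.smul_apply, norm_smul, norm_zpow, norm_zed, one_zpow, one_mul, Nat.cast_one, one_pow,
    one_mul]
  exact (Finset.single_le_sum (f := fun b => ‖P.coeff k a b‖)
    (fun _ _ => norm_nonneg _) (Finset.mem_univ b)).trans
    (Finset.single_le_sum (f := fun a => ∑ b, ‖P.coeff k a b‖)
      (fun _ _ => Finset.sum_nonneg fun _ _ => norm_nonneg _) (Finset.mem_univ a))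

lemma mono_mem_matLoops {S : AddSubmonoid ℤ} {k : ℤ} (hk : k ∈ S) (X : Mat n) :
    (fun x => evalAt (mono k X) (zed x)) ∈ matLoops n S := by
  simp only [evalAt_mono, zed_zpow]
  exact smul_mem_matLoops (fourier_mem_hInf hk) (const_mem_matLoops X)

/-- The modes of a Laurent polynomial are bounded from above. -/
lemma exists_modes_le (P : LoopPoly n) :
    ∃ N : ℕ, (fun x => (fourier (-(N : ℤ)) x : ℂ) • evalAt P (zed x)) ∈
      matLoops n nonposModes := by
  induction P using LaurentPolynomial.induction_on' with
  | add P Q hP hQ =>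
    obtain ⟨N, hN⟩ := hP
    obtain ⟨M, hM⟩ := hQ
    refine ⟨N + M, ?_⟩
    have h1 := smul_mem_matLoops
      (fourier_mem_hInf (S := nonposModes) (k := -(M : ℤ)) (mem_nonposModes.2 (by omega))) hN
    have h2 := smul_mem_matLoops
      (fourier_mem_hInf (S := nonposModes) (k := -(N : ℤ)) (mem_nonposModes.2 (by omega))) hM
    convert! Subalgebra.add_mem _ h1 h2 using 1
    ext1 x
    rw [Pi.add_apply, evalAt_add, smul_add, smul_smul, smul_smul, ← fourier_add, ← fourier_add]
    congr 4 <;> (push_cast; ring)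
  | C_mul_T k X =>
    refine ⟨k.natAbs, ?_⟩
    change (fun x => (fourier (-(k.natAbs : ℤ)) x : ℂ) • evalAt (mono k X) (zed x)) ∈ _
    simp only [evalAt_mono, zed_zpow, smul_smul, ← fourier_add]
    exact smul_mem_matLoops (fourier_mem_hInf (mem_nonposModes.2 (by omega)))
      (const_mem_matLoops X)

end EvalAt

lemma FiniteNorms.congr {n : ℕ} {γ δ : UnitAddCircle → Mat n} (hγ : FiniteNorms γ)
    (h : γ =ᵐ[circ] δ) : FiniteNorms δ := by
  refine ⟨fun i j => (hγ.1 i j).ae_eq (by filter_upwards [h] with x hx; rw [hx]), ?_⟩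
  have h1 := hγ.2
  simp only [loopCoeff_congr h] at h1
  exact h1

/-! ## Consequences of the gradations -/

namespace MatrixRealization

variable {l n : ℕ} {A : Matrix (Fin (l + 1)) (Fin (l + 1)) ℤ} (G : MatrixRealization A n)

/-- `2 E_i = [H_i, E_i]` is a commutator. -/
lemma trace_E (hA : IsAffineCartan A) (i : Fin (l + 1)) : (G.E i).trace = 0 := by
  have h := congrArg Matrix.trace (G.lie_H_E i i)
  rw [Ring.lie_def, Matrix.trace_sub, Matrix.trace_mul_comm, sub_self, Matrix.trace_smul,
    hA.diag] at h
  simpa using h.symm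

lemma trace_F (hA : IsAffineCartan A) (i : Fin (l + 1)) : (G.F i).trace = 0 := by
  have h := congrArg Matrix.trace (G.lie_H_F i i)
  rw [Ring.lie_def, Matrix.trace_sub, Matrix.trace_mul_comm, sub_self, Matrix.trace_neg,
    Matrix.trace_smul, hA.diag] at h
  simpa using h.symm

lemma trace_H (i : Fin (l + 1)) : (G.H i).trace = 0 := by
  have h := congrArg Matrix.trace (G.lie_E_F i i)
  rw [Ring.lie_def, Matrix.trace_sub, Matrix.trace_mul_comm, sub_self, if_pos rfl] at h
  exact h.symm

/-- The elements of the affine algebra are traceless. -/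
lemma HasDegree.trace_evalAt {G : MatrixRealization A n} (hA : IsAffineCartan A)
    {s : Fin (l + 1) → ℤ} {d : ℤ} {x : LoopPoly n}
    (hx : G.HasDegree s d x) {z : ℂ} (hz : z ≠ 0) : (evalAt x z).trace = 0 := by
  induction hx with
  | e i => rw [MatrixRealization.e, evalAt_mono, Matrix.trace_smul, G.trace_E hA, smul_zero]
  | f i => rw [MatrixRealization.f, evalAt_mono, Matrix.trace_smul, G.trace_F hA, smul_zero]
  | h i => rw [MatrixRealization.h, evalAt_mono, Matrix.trace_smul, G.trace_H, smul_zero]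
  | zero d => rw [evalAt_zero, Matrix.trace_zero]
  | add _ _ hx hy => rw [evalAt_add, Matrix.trace_add, hx, hy, add_zero]
  | smul a _ hx => rw [evalAt_smul, Matrix.trace_smul, hx, smul_zero]
  | lie _ _ _ _ => rw [evalAt_lie _ _ hz, Matrix.trace_sub, Matrix.trace_mul_comm, sub_self]

lemma chevalleyRel : ChevalleyRel (fun i j => (A i j : ℂ)) G.e G.f G.h where
  h_e i j := by
    rw [h, e, lie_mono_mono, zero_add, G.lie_H_E, smul_mono]
  h_f i j := by
    rw [h, f, lie_mono_mono, zero_add, G.lie_H_F, neg_smul, smul_mono, mono_neg]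
  h_h i j := by
    rw [h, h, lie_mono_mono, G.lie_H_H, mono_zero]
  f_e i j := by
    rw [← lie_skew, e, f, lie_mono_mono, G.lie_E_F]
    refine Submodule.neg_mem _ ?_
    split_ifs with hij
    · subst hij
      rw [add_neg_cancel]
      exact Submodule.subset_span ⟨j, rfl⟩
    · rw [mono_zero]
      exact Submodule.zero_mem _

lemma HasDegree.mem_triang {G : MatrixRealization A n} {d : ℤ} {x : LoopPoly n}
    (hx : G.HasDegree (princGrad l) d x) : x ∈ triang G.e G.f G.h d := by
  induction hx with
  | e i => exact Submodule.subset_span ⟨i, rfl⟩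
  | f i => exact Submodule.subset_span ⟨i, rfl⟩
  | h i => exact Submodule.subset_span ⟨i, rfl⟩
  | zero d => exact Submodule.zero_mem _
  | add _ _ hx hy => exact Submodule.add_mem _ hx hy
  | smul a _ hx => exact Submodule.smul_mem _ a hx
  | lie _ _ hx hy => exact G.chevalleyRel.lie_triang hx hy

lemma e_mem_matLoops (i : Fin (l + 1)) :
    (fun x => evalAt (G.e i) (zed x)) ∈ matLoops n nonnegModes := by
  refine mono_mem_matLoops ?_ _
  rw [AddSubmonoid.mem_nonneg, homGrad]
  split_ifs <;> norm_num

lemma iterLie_mem_matLoops {d : ℕ} {P : LoopPoly n} (hP : P ∈ iterLie G.e d) :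
    (fun x => evalAt P (zed x)) ∈ matLoops n nonnegModes := by
  have hspan : ∀ s : Set (LoopPoly n),
      (∀ P ∈ s, (fun x => evalAt P (zed x)) ∈ matLoops n nonnegModes) →
      ∀ P ∈ Submodule.span ℂ s, (fun x => evalAt P (zed x)) ∈ matLoops n nonnegModes := by
    intro s hs P hP
    induction hP using Submodule.span_induction with
    | mem P hP => exact hs P hP
    | zero => exact Subalgebra.zero_mem _
    | add P Q _ _ hP hQ =>
      simp only [evalAt_add]
      exact Subalgebra.add_mem _ hP hQ
    | smul a P _ hP =>
      simp only [evalAt_smul]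
      exact Subalgebra.smul_mem _ hP a
  induction d generalizing P with
  | zero =>
    refine hspan _ ?_ P hP
    rintro _ ⟨i, rfl⟩
    exact G.e_mem_matLoops i
  | succ d ih =>
    refine hspan _ ?_ P hP
    rintro _ ⟨i, Q, hQ, rfl⟩
    simp only [evalAt_lie _ _ (zed_ne_zero _)]
    exact Subalgebra.sub_mem _ (Subalgebra.mul_mem _ (G.e_mem_matLoops i) (ih hQ))
      (Subalgebra.mul_mem _ (ih hQ) (G.e_mem_matLoops i))

/-- Elements of positive principal degree involve nonnegative powers of `z` only. -/
lemma HasDegree.mem_matLoops_nonneg {G : MatrixRealization A n} {d : ℕ} (hd : 0 < d)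
    {x : LoopPoly n} (hx : G.HasDegree (princGrad l) d x) :
    (fun y => evalAt x (zed y)) ∈ matLoops n nonnegModes := by
  -- Degree `k + 1` corresponds to level `k` of `iterLie`, and each `e_i` carries `z` to the power
  -- `0` or `1`.
  obtain ⟨k, rfl⟩ : ∃ k, d = k + 1 := ⟨d - 1, by omega⟩
  exact G.iterLie_mem_matLoops hx.mem_triang

/-! ## The group `G₋` -/

variable {G} {γ : UnitAddCircle → Mat n}

lemma InGMinus.mem_matLoops (h : G.InGMinus γ) : γ ∈ matLoops n nonposModes := by
  intro a b
  rw [mem_hInf_nonpos]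
  exact ⟨h.1.2.1.1 a b, fun k hk => congrFun (congrFun (h.2.1 k hk) a) b⟩

lemma trace_coeff (hA : IsAffineCartan A) {X : PowerSeries (Mat n)}
    (h0 : PowerSeries.coeff 0 X = 0)
    (hX : ∀ m : ℕ, 0 < m →
        G.HasDegree (homGrad l) (-(m : ℤ)) (mono (-(m : ℤ)) (PowerSeries.coeff m X))) (m : ℕ) :
    (PowerSeries.coeff m X).trace = 0 := by
  rcases Nat.eq_zero_or_pos m with rfl | hm
  · rw [h0, Matrix.trace_zero]
  · simpa [evalAt_mono] using (hX m hm).trace_evalAt hA (one_ne_zero)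

lemma InGMinus.det_eq_one (hA : IsAffineCartan A) (h : G.InGMinus γ) :
    ∀ᵐ x ∂circ, (γ x).det = 1 := by
  obtain ⟨X, h0, hX, hc⟩ := h.2.2
  exact det_ae_eq_one_of_expCoeff h.mem_matLoops h0 (trace_coeff hA h0 hX) hc

lemma InGMinus.inv_mem_matLoops (hA : IsAffineCartan A) (h : G.InGMinus γ) :
    (fun x => (γ x)⁻¹) ∈ matLoops n nonposModes :=
  DSBaker.inv_mem_matLoops h.mem_matLoops (h.det_eq_one hA)

lemma InGMinus.loopCoeff_zero (h : G.InGMinus γ) : loopCoeff γ 0 = 1 := by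
  obtain ⟨X, h0, hX, hc⟩ := h.2.2
  simpa [expCoeff] using hc 0

/-- The exponent of the inverse is `-X`. Its modes are nonpositive because it is an adjugate, and
its norms are finite by the definition of the loop group. -/
lemma InGMinus.inv (hA : IsAffineCartan A) (h : G.InGMinus γ) :
    G.InGMinus fun x => (γ x)⁻¹ := by
  have hinv := h.inv_mem_matLoops hA
  have hdet := h.det_eq_one hA
  refine ⟨⟨?_, h.1.2.2, ?_⟩, fun k hk => ?_, ?_⟩
  · filter_upwards [h.1.1] with x hx
    exact (Matrix.isUnit_nonsing_inv_iff).2 hx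
  · refine FiniteNorms.congr h.1.2.1 ?_
    filter_upwards [hdet] with x hx
    exact (Matrix.nonsing_inv_nonsing_inv _ (by rw [hx]; exact isUnit_one)).symm
  · ext a b
    exact (mem_hInf_nonpos.1 (hinv a b)).2 k hk
  · obtain ⟨X, h0, hX, hc⟩ := h.2.2
    refine ⟨-X, by rw [map_neg, h0, neg_zero], fun m hm => ?_, fun m => ?_⟩
    · have h1 := (hX m hm).smul (-1)
      rw [smul_mono, neg_one_smul] at h1
      rwa [map_neg]
    · refine loopCoeff_eq_expCoeff_neg h.mem_matLoops hinv h0 hc ?_ m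
      filter_upwards [hdet] with x hx
      exact Matrix.mul_nonsing_inv _ (by rw [hx]; exact isUnit_one)

end MatrixRealization

/-! ## Coordinates on `L²(S¹, ℂⁿ)` -/

section Coordinates

variable {n : ℕ}

/-- The component of index `i` of a vector function. -/
def comp (i : Fin n) : Hil n →L[ℂ] Lp ℂ 2 circ :=
  (EuclideanSpace.proj (𝕜 := ℂ) i : EuclideanSpace ℂ (Fin n) →L[ℂ] ℂ).compLpL 2 circ

/-- The inclusion of scalar functions as the component of index `i`. -/
def inj (i : Fin n) : Lp ℂ 2 circ →L[ℂ] Hil n :=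
  (ContinuousLinearMap.toSpanSingleton ℂ (EuclideanSpace.single i (1 : ℂ))).compLpL 2 circ

lemma coeFn_comp (i : Fin n) (v : Hil n) : comp i v =ᵐ[circ] fun x => v x i :=
  ContinuousLinearMap.coeFn_compLpL _ v

lemma coeFn_inj (i : Fin n) (f : Lp ℂ 2 circ) :
    inj i f =ᵐ[circ] fun x => f x • EuclideanSpace.single i (1 : ℂ) :=
  ContinuousLinearMap.coeFn_compLpL _ f

lemma comp_inj (i j : Fin n) (f : Lp ℂ 2 circ) : comp j (inj i f) = if j = i then f else 0 := by
  apply Lp.ext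
  split_ifs with h
  · filter_upwards [coeFn_comp j (inj i f), coeFn_inj i f] with x h1 h2
    rw [h1, h2]
    simp [h]
  · filter_upwards [coeFn_comp j (inj i f), coeFn_inj i f, Lp.coeFn_zero ℂ 2 circ] with x h1 h2 h3
    rw [h1, h2, h3]
    simp [h]

lemma sum_inj_comp (v : Hil n) : ∑ i, inj i (comp i v) = v := by
  apply Lp.ext
  have h : ∀ᵐ x ∂circ, ∀ i, (inj i (comp i v)) x = v x i • EuclideanSpace.single i (1 : ℂ) := by
    rw [ae_all_iff]
    intro i
    filter_upwards [coeFn_inj i (comp i v), coeFn_comp i v] with x h1 h2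
    rw [h1, h2]
  filter_upwards [h, Lp.coeFn_finsetSum Finset.univ fun i => inj i (comp i v)] with x h1 h2
  rw [h2, Finset.sum_apply]
  simp only [h1]
  ext j
  simp [Finset.sum_apply, Pi.single_apply]

lemma inner_eq_sum_comp (u v : Hil n) :
    inner ℂ u v = ∑ i, inner ℂ (comp i u) (comp i v) := by
  simp only [L2.inner_def]
  rw [← integral_finsetSum _ fun i _ => L2.integrable_inner (comp i u) (comp i v)]
  refine integral_congr_ae ?_
  have hu : ∀ᵐ x ∂circ, ∀ i, comp i u x = u x i := ae_all_iff.2 fun i => coeFn_comp i u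
  have hv : ∀ᵐ x ∂circ, ∀ i, comp i v x = v x i := ae_all_iff.2 fun i => coeFn_comp i v
  filter_upwards [hu, hv] with x h1 h2
  simp only [PiLp.inner_apply, h1, h2]

lemma memLp_apply (v : Hil n) (i : Fin n) : MemLp (fun x => v x i) 2 circ :=
  (Lp.memLp (comp i v)).ae_eq (coeFn_comp i v)

lemma fourierLin_apply (v : Hil n) (k : ℤ) (i : Fin n) :
    fourierLin n k v i = fourierCoeff (fun x => v x i) k := by
  have h := (EuclideanSpace.proj (𝕜 := ℂ) i : EuclideanSpace ℂ (Fin n) →L[ℂ] ℂ).integral_comp_comm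
    (integrable_fourier_smul k v)
  exact h.symm

lemma repr_comp (v : Hil n) (k : ℤ) (i : Fin n) :
    fourierBasis.repr (comp i v) k = fourierCoeff (fun x => v x i) k := by
  rw [fourierBasis_repr, fourierCoeff_congr (coeFn_comp i v)]

lemma mem_hardyPlus {v : Hil n} :
    v ∈ hardyPlus n ↔ ∀ i, ∀ k < 0, fourierCoeff (fun x => v x i) k = 0 := by
  simp only [hardyPlus, Submodule.mem_iInf, LinearMap.mem_ker, Subtype.forall]
  constructor
  · intro h i k hk
    rw [← fourierLin_apply, h k hk]
    rfl
  · intro h k hk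
    ext i
    rw [fourierLin_apply, h i k hk]
    rfl

lemma mem_hardyMinus {v : Hil n} :
    v ∈ hardyMinus n ↔ ∀ i k, 0 ≤ k → fourierCoeff (fun x => v x i) k = 0 := by
  simp only [hardyMinus, Submodule.mem_iInf, LinearMap.mem_ker, Subtype.forall]
  constructor
  · intro h i k hk
    rw [← fourierLin_apply, h k hk]
    rfl
  · intro h k hk
    ext i
    rw [fourierLin_apply, h i k hk]
    rfl

/-- One inclusion tests against the vectors `zᵏ e_i`; the other is Parseval in every component. It
identifies the orthogonal projections `p±` with the projections along `H∓`. -/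
lemma hardyPlus_orthogonal (n : ℕ) : (hardyPlus n)ᗮ = hardyMinus n := by
  ext v
  rw [Submodule.mem_orthogonal]
  constructor
  · intro h
    rw [mem_hardyMinus]
    intro i k hk
    have h1 : inj i (fourierBasis k) ∈ hardyPlus n := by
      rw [mem_hardyPlus]
      intro j m hm
      rw [← repr_comp, comp_inj]
      split_ifs
      · rw [fourierBasis.repr_self, lp.single_apply, Pi.single_apply, if_neg (by omega)]
      · simp
    have h2 := h _ h1
    rw [inner_eq_sum_comp, Finset.sum_eq_single i, comp_inj, if_pos rfl,
      ← fourierBasis.repr_apply_apply, repr_comp] at h2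
    · exact h2
    · intro j _ hj
      rw [comp_inj, if_neg hj, inner_zero_left]
    · simp
  · intro hv u hu
    rw [mem_hardyMinus] at hv
    rw [mem_hardyPlus] at hu
    rw [inner_eq_sum_comp]
    refine Finset.sum_eq_zero fun i _ => ?_
    rw [← (fourierBasis.hasSum_inner_mul_inner (comp i u) (comp i v)).tsum_eq]
    convert! tsum_zero with k
    rcases lt_or_ge k 0 with hk | hk
    · rw [← inner_conj_symm, ← fourierBasis.repr_apply_apply, repr_comp, hu i k hk, map_zero,
        zero_mul]
    · rw [← fourierBasis.repr_apply_apply, repr_comp, hv i k hk, mul_zero]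

lemma hardyMinus_orthogonal (n : ℕ) : (hardyMinus n)ᗮ = hardyPlus n := by
  rw [← hardyPlus_orthogonal, Submodule.orthogonal_orthogonal]

lemma pPlus_eq {u h : Hil n} (hh : h ∈ hardyPlus n) (hu : u - h ∈ hardyMinus n) :
    (pPlus n u : Hil n) = h :=
  Submodule.eq_starProjection_of_mem_orthogonal hh (by rwa [hardyPlus_orthogonal])

lemma sub_pPlus_mem (u : Hil n) : u - pPlus n u ∈ hardyMinus n := by
  rw [← hardyPlus_orthogonal]
  exact Submodule.sub_starProjection_mem_orthogonal u

lemma sub_pMinus_mem (u : Hil n) : u - pMinus n u ∈ hardyPlus n := by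
  rw [← hardyMinus_orthogonal]
  exact Submodule.sub_starProjection_mem_orthogonal u

lemma eq_zero_of_mem_hardy {u : Hil n} (h1 : u ∈ hardyPlus n) (h2 : u ∈ hardyMinus n) : u = 0 := by
  rw [← hardyPlus_orthogonal] at h2
  exact inner_self_eq_zero.1 (((hardyPlus n).mem_orthogonal u).1 h2 u h1)

end Coordinates

/-! ## Multiplication operators -/

section MulOp

variable {n : ℕ}

lemma exists_ae_bound {f : UnitAddCircle → ℂ} (hf : MemLp f ⊤ circ) :
    ∃ C : ℝ, ∀ᵐ x ∂circ, ‖f x‖ ≤ C := by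
  have h := hf.2
  rw [eLpNorm_exponent_top, eLpNormEssSup_lt_top_iff_isBoundedUnder] at h
  obtain ⟨C, hC⟩ := h
  exact ⟨C, by simpa using! hC⟩

lemma exists_ae_bound_loop {S : AddSubmonoid ℤ} {γ : UnitAddCircle → Mat n}
    (hγ : γ ∈ matLoops n S) : ∃ C : ℝ, 0 ≤ C ∧ ∀ᵐ x ∂circ, ∀ a b, ‖γ x a b‖ ≤ C := by
  choose C hC using fun a b => exists_ae_bound (hγ a b).1
  refine ⟨∑ a, ∑ b, |C a b|, by positivity, ?_⟩
  simp only [ae_all_iff]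
  intro a b
  filter_upwards [hC a b] with x hx
  refine (hx.trans (le_abs_self _)).trans ?_
  exact (Finset.single_le_sum (f := fun b => |C a b|) (fun _ _ => abs_nonneg _)
    (Finset.mem_univ b)).trans
    (Finset.single_le_sum (f := fun a => ∑ b, |C a b|)
      (fun _ _ => Finset.sum_nonneg fun _ _ => abs_nonneg _) (Finset.mem_univ a))

lemma act_apply (M : Mat n) (v : EuclideanSpace ℂ (Fin n)) (i : Fin n) :
    act M v i = ∑ c, M i c * v c := rfl

lemma act_mul (M N : Mat n) (v : EuclideanSpace ℂ (Fin n)) : act (M * N) v = act M (act N v) := by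
  simp [act, Matrix.mulVec_mulVec]

lemma act_one (v : EuclideanSpace ℂ (Fin n)) : act 1 v = v := by
  simp [act]

lemma norm_act_le {M : Mat n} {C : ℝ} (hC : 0 ≤ C) (hM : ∀ a b, ‖M a b‖ ≤ C)
    (v : EuclideanSpace ℂ (Fin n)) : ‖act M v‖ ≤ n * (n * C) * ‖v‖ := by
  have h1 : ∀ i, ‖act M v i‖ ≤ n * C * ‖v‖ := fun i => by
    rw [act_apply]
    refine (norm_sum_le _ _).trans ?_
    calc ∑ c, ‖M i c * v c‖ ≤ ∑ _c : Fin n, C * ‖v‖ := Finset.sum_le_sum fun c _ => by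
          rw [norm_mul]
          exact mul_le_mul (hM i c) (PiLp.norm_apply_le v c) (norm_nonneg _) hC
      _ = n * C * ‖v‖ := by simp [mul_assoc]
  have h2 : act M v = ∑ i, EuclideanSpace.single i (act M v i) := by
    ext j
    simp
  rw [h2]
  refine (norm_sum_le _ _).trans ?_
  calc ∑ i, ‖EuclideanSpace.single i (act M v i)‖ ≤ ∑ _i : Fin n, n * C * ‖v‖ :=
        Finset.sum_le_sum fun i _ => by
          simpa using h1 i
    _ = n * (n * C) * ‖v‖ := by simp [mul_assoc]

lemma memLp_act (γ : matLoops n ⊤) (v : Hil n) :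
    MemLp (fun x => act (γ.1 x) (v x)) 2 circ := by
  refine MemLp.of_eval_piLp fun i => ?_
  simp only [act_apply]
  exact memLp_finsetSum _ fun c _ => (memLp_apply v c).mul (γ.2 i c).1

/-- Multiplication by a bounded matrix loop. -/
def mulOp (γ : matLoops n ⊤) : Hil n →L[ℂ] Hil n :=
  LinearMap.mkContinuousOfExistsBound
    { toFun := fun v => (memLp_act γ v).toLp _
      map_add' := fun u v => by
        apply Lp.ext
        filter_upwards [(memLp_act γ (u + v)).coeFn_toLp, (memLp_act γ u).coeFn_toLp,
          (memLp_act γ v).coeFn_toLp, Lp.coeFn_add u v,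
          Lp.coeFn_add ((memLp_act γ u).toLp _) ((memLp_act γ v).toLp _)] with x h1 h2 h3 h4 h5
        rw [h1, h5, Pi.add_apply, h2, h3, h4]
        simp [act, Matrix.mulVec_add]
      map_smul' := fun a v => by
        apply Lp.ext
        filter_upwards [(memLp_act γ (a • v)).coeFn_toLp, (memLp_act γ v).coeFn_toLp,
          Lp.coeFn_smul a v, Lp.coeFn_smul a ((memLp_act γ v).toLp _)] with x h1 h2 h3 h4
        rw [h1, RingHom.id_apply, h4, Pi.smul_apply, h2, h3]
        simp [act, Matrix.mulVec_smul] }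
    (by
      obtain ⟨C, hC0, hC⟩ := exists_ae_bound_loop γ.2
      refine ⟨n * (n * C), fun v => Lp.norm_le_mul_norm_of_ae_le_mul ?_⟩
      filter_upwards [hC, (memLp_act γ v).coeFn_toLp] with x h1 h2
      exact (congrArg norm h2).trans_le (norm_act_le hC0 h1 _))

lemma coeFn_mulOp (γ : matLoops n ⊤) (v : Hil n) :
    mulOp γ v =ᵐ[circ] fun x => act (γ.1 x) (v x) := (memLp_act γ v).coeFn_toLp

lemma mulOp_congr {γ δ : matLoops n ⊤} (h : γ.1 =ᵐ[circ] δ.1) : mulOp γ = mulOp δ := by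
  ext1 v
  apply Lp.ext
  filter_upwards [coeFn_mulOp γ v, coeFn_mulOp δ v, h] with x h1 h2 h3
  rw [h1, h2, h3]

lemma mulOp_mul (γ δ : matLoops n ⊤) (v : Hil n) : mulOp (γ * δ) v = mulOp γ (mulOp δ v) := by
  apply Lp.ext
  filter_upwards [coeFn_mulOp (γ * δ) v, coeFn_mulOp γ (mulOp δ v), coeFn_mulOp δ v]
    with x h1 h2 h3
  rw [h1, h2, h3, ← act_mul]
  rfl

lemma mulOp_one (v : Hil n) : mulOp 1 v = v := by
  apply Lp.ext
  filter_upwards [coeFn_mulOp 1 v] with x h1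
  rw [h1]
  exact act_one _

lemma mulOp_mulOp_of_mul_eq_one {γ δ : matLoops n ⊤} (h : ∀ᵐ x ∂circ, γ.1 x * δ.1 x = 1)
    (v : Hil n) : mulOp γ (mulOp δ v) = v := by
  have h' : (γ * δ).1 =ᵐ[circ] (1 : matLoops n ⊤).1 := h
  rw [← mulOp_mul, mulOp_congr h', mulOp_one]

lemma mem_loopImage (γ : matLoops n ⊤) {W : Submodule ℂ (Hil n)} {v : Hil n} :
    v ∈ loopImage γ.1 W ↔ ∃ u ∈ W, v = mulOp γ u := by
  constructor
  · rintro ⟨u, hu, h⟩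
    exact ⟨u, hu, Lp.ext (h.trans (coeFn_mulOp γ u).symm)⟩
  · rintro ⟨u, hu, rfl⟩
    exact ⟨u, hu, coeFn_mulOp γ u⟩

lemma fourierCoeff_mulOp (γ : matLoops n ⊤) (v : Hil n) (i : Fin n) (k : ℤ) :
    fourierCoeff (fun x => mulOp γ v x i) k =
      ∑ c, fourierCoeff (fun x => γ.1 x i c * v x c) k := by
  rw [← fourierCoeff_sum_of_integrable]
  · refine fourierCoeff_congr ?_ k
    filter_upwards [coeFn_mulOp γ v] with x hx
    rw [hx, act_apply]
  · intro c _
    exact ((memLp_apply v c).mul (γ.2 i c).1 (r := 2)).integrable (by norm_num)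

lemma hasSum_fourierCoeff_mul_apply (γ : matLoops n ⊤) (v : Hil n) (i c : Fin n) (m : ℤ) :
    HasSum (fun k => fourierCoeff (fun x => γ.1 x i c) (m - k) * fourierCoeff (fun x => v x c) k)
      (fourierCoeff (fun x => γ.1 x i c * v x c) m) :=
  hasSum_fourierCoeff_mul (hInf.memLp_two (γ.2 i c)) (memLp_apply v c) m

/-- A loop with nonpositive modes cannot raise Fourier indices: if `m ≥ 0` and `k < 0` then `m - k >
0`. -/
lemma mulOp_mem_hardyMinus {γ : matLoops n ⊤} (hγ : γ.1 ∈ matLoops n nonposModes) {v : Hil n}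
    (hv : v ∈ hardyMinus n) : mulOp γ v ∈ hardyMinus n := by
  rw [mem_hardyMinus] at hv ⊢
  intro i m hm
  rw [fourierCoeff_mulOp]
  refine Finset.sum_eq_zero fun c _ => (hasSum_fourierCoeff_mul_apply γ v i c m).unique ?_
  convert! hasSum_zero using 2 with k
  rcases lt_or_ge k 0 with hk | hk
  · rw [(mem_hInf_nonpos.1 (hγ i c)).2 _ (by omega), zero_mul]
  · rw [hv c k hk, mul_zero]

lemma mulOp_mem_hardyPlus {γ : matLoops n ⊤} (hγ : γ.1 ∈ matLoops n nonnegModes) {v : Hil n}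
    (hv : v ∈ hardyPlus n) : mulOp γ v ∈ hardyPlus n := by
  rw [mem_hardyPlus] at hv ⊢
  intro i m hm
  rw [fourierCoeff_mulOp]
  refine Finset.sum_eq_zero fun c _ => (hasSum_fourierCoeff_mul_apply γ v i c m).unique ?_
  convert! hasSum_zero using 2 with k
  rcases lt_or_ge k 0 with hk | hk
  · rw [hv c k hk, mul_zero]
  · rw [(mem_hInf_nonneg.1 (hγ i c)).2 _ (by omega), zero_mul]

/-- `γ H₊` is transversal to `H₋` if `γ` and `γ⁻¹` have nonpositive modes. -/
lemma isTransversal_loopImage {γ δ : matLoops n ⊤} (hγ : γ.1 ∈ matLoops n nonposModes)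
    (hδ : δ.1 ∈ matLoops n nonposModes) (h1 : ∀ᵐ x ∂circ, γ.1 x * δ.1 x = 1)
    (h2 : ∀ᵐ x ∂circ, δ.1 x * γ.1 x = 1) : IsTransversal (loopImage γ.1 (hardyPlus n)) := by
  constructor
  -- If `p₊ γ u = 0` then `γ u ∈ H₋`, hence `u = δ γ u` lies in `H₋` as well as in `H₊`.
  · rw [injective_iff_map_eq_zero]
    rintro ⟨v, hv⟩ h
    obtain ⟨u, hu, rfl⟩ := (mem_loopImage γ).1 hv
    have h3 : mulOp γ u ∈ hardyMinus n := by
      have h4 := sub_pPlus_mem (mulOp γ u)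
      have h5 : pPlus n (mulOp γ u) = 0 := h
      rwa [h5, Submodule.coe_zero, sub_zero] at h4
    have h6 := mulOp_mem_hardyMinus hδ h3
    rw [mulOp_mulOp_of_mul_eq_one h2] at h6
    have h7 := eq_zero_of_mem_hardy hu h6
    ext1
    simp [h7]
  · intro h
    -- With `u = p₊ δ h`, the difference `δ h - u` is in `H₋`, and `γ` carries it to `h - γ u ∈ H₋`;
    -- so `γ u` projects to `h`.
    set u : hardyPlus n := pPlus n (mulOp δ h)
    refine ⟨⟨mulOp γ u, (mem_loopImage γ).2 ⟨u, u.2, rfl⟩⟩, Subtype.ext ?_⟩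
    refine pPlus_eq h.2 ?_
    have h3 := (hardyMinus n).neg_mem (mulOp_mem_hardyMinus hγ (sub_pPlus_mem (mulOp δ h)))
    rw [map_sub, mulOp_mulOp_of_mul_eq_one h1, neg_sub] at h3
    exact h3

lemma isClosed_hardyPlus (n : ℕ) : IsClosed (hardyPlus n : Set (Hil n)) := by
  rw [← hardyMinus_orthogonal]
  exact Submodule.isClosed_orthogonal _

/-- `γ H₊` is the preimage of the closed space `H₊` under multiplication by the inverse loop `δ`. -/
lemma isClosed_loopImage {γ δ : matLoops n ⊤} (h1 : ∀ᵐ x ∂circ, γ.1 x * δ.1 x = 1)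
    (h2 : ∀ᵐ x ∂circ, δ.1 x * γ.1 x = 1) :
    IsClosed (loopImage γ.1 (hardyPlus n) : Set (Hil n)) := by
  convert! (isClosed_hardyPlus n).preimage (mulOp δ).continuous using 1
  ext v
  rw [SetLike.mem_coe, mem_loopImage, Set.mem_preimage, SetLike.mem_coe]
  constructor
  · rintro ⟨u, hu, rfl⟩
    rwa [mulOp_mulOp_of_mul_eq_one h2]
  · intro h
    exact ⟨_, h, (mulOp_mulOp_of_mul_eq_one h1 v).symm⟩

/-- The scalar loop `z`. -/
def zedLoop (n : ℕ) : matLoops n ⊤ :=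
  ⟨fun x => zed x • (1 : Mat n),
    smul_mem_matLoops (fourier_mem_hInf (AddSubmonoid.mem_top _)) (const_mem_matLoops 1)⟩

lemma zedLoop_mem (n : ℕ) : (zedLoop n).1 ∈ matLoops n nonnegModes :=
  smul_mem_matLoops (fourier_mem_hInf (by simp)) (const_mem_matLoops 1)

lemma zedLoop_mul_comm (γ : matLoops n ⊤) : zedLoop n * γ = γ * zedLoop n := by
  apply Subtype.ext
  funext x
  change (zed x • (1 : Mat n)) * γ.1 x = γ.1 x * (zed x • (1 : Mat n))
  rw [smul_mul_assoc, one_mul, mul_smul_comm, mul_one]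

lemma loopImage_loopImage_le_of_commute {ζ γ : matLoops n ⊤} (hζ : ζ.1 ∈ matLoops n nonnegModes)
    (hc : ζ * γ = γ * ζ) :
    loopImage ζ.1 (loopImage γ.1 (hardyPlus n)) ≤ loopImage γ.1 (hardyPlus n) := by
  intro v hv
  obtain ⟨v', hv', hvv⟩ := (mem_loopImage ζ).1 hv
  obtain ⟨u, hu, huv⟩ := (mem_loopImage γ).1 hv'
  refine (mem_loopImage γ).2 ⟨mulOp ζ u, mulOp_mem_hardyPlus hζ hu, ?_⟩
  rw [hvv, huv, ← mulOp_mul, hc, mulOp_mul]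

end MulOp

/-! ## Hilbert–Schmidt estimates and compactness -/

section Compact

/-- A Hilbert–Schmidt criterion stated through coordinates, so that the source may be any normed
space: `T` is a norm limit of its finite-rank truncations. -/
lemma isCompactOperator_of_hilbertBasis {ι V H : Type*} [NormedAddCommGroup V] [NormedSpace ℂ V]
    [NormedAddCommGroup H] [InnerProductSpace ℂ H] [CompleteSpace H] (b : HilbertBasis ι ℂ H)
    (T : V →L[ℂ] H) {c : ι → ℝ} (hc : Summable c) (hc0 : ∀ i, 0 ≤ c i)
    (h : ∀ i v, ‖b.repr (T v) i‖ ^ 2 ≤ c i * ‖v‖ ^ 2) : IsCompactOperator T := by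
  classical
  set F : Finset ι → V →L[ℂ] H := fun s => ∑ i ∈ s,
    (ContinuousLinearMap.toSpanSingleton ℂ (b i)).comp ((innerSL ℂ (b i)).comp T) with hF
  have hFv : ∀ s v, F s v = ∑ i ∈ s, b.repr (T v) i • b i := fun s v => by
    simp [hF, HilbertBasis.repr_apply_apply]
  -- By Parseval the squared error consists of the coordinates outside `s`, dominated by the tail of
  -- `∑ c`.
  have hbound : ∀ s, ‖F s - T‖ ≤ √(∑' i : {i // i ∉ s}, c i) := fun s => by
    refine ContinuousLinearMap.opNorm_le_bound _ (Real.sqrt_nonneg _) fun v => ?_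
    rw [← Real.sqrt_sq (norm_nonneg v),
      ← Real.sqrt_mul (tsum_nonneg fun i : {i // i ∉ s} => hc0 i)]
    refine Real.le_sqrt_of_sq_le ?_
    set y := (F s - T) v with hy
    have hrepr : ∀ i, b.repr y i = if i ∈ s then 0 else -b.repr (T v) i := fun i => by
      rw [hy, sub_apply, map_sub, lp.coeFn_sub, Pi.sub_apply, hFv, map_sum,
        lp.coeFn_sum, Finset.sum_apply]
      simp only [map_smul, HilbertBasis.repr_self, lp.coeFn_smul, Pi.smul_apply, lp.single_apply,
        Pi.single_apply, smul_eq_mul, mul_one, mul_ite, mul_zero]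
      rw [Finset.sum_ite_eq s i]
      split_ifs <;> simp
    have hsum : HasSum (fun i => ‖b.repr y i‖ ^ 2) (‖y‖ ^ 2) := by
      have h1 := lp.hasSum_norm (p := 2) (by simp) (b.repr y)
      simpa using h1
    have h2 : Summable fun i : {i // i ∉ s} => c i := hc.subtype _
    rw [← hsum.tsum_eq]
    have h3 : HasSum (fun i => if i ∈ s then 0 else c i) (∑' i : {i // i ∉ s}, c i) := by
      have h4 := (hasSum_subtype_iff_indicator (s := {i | i ∉ s})).1 h2.hasSum
      convert! h4 using 2 with i
      by_cases hi : i ∈ s <;> simp [hi]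
    refine hasSum_le (fun i => ?_) hsum.summable.hasSum (h3.mul_right (‖v‖ ^ 2))
    rw [hrepr]
    split_ifs
    · simp
    · rw [norm_neg]
      exact h i v
  have htend : Tendsto F atTop (𝓝 T) := by
    rw [tendsto_iff_norm_sub_tendsto_zero]
    refine squeeze_zero (fun _ => norm_nonneg _) hbound ?_
    have := (Real.continuous_sqrt.tendsto 0).comp (tendsto_tsum_compl_atTop_zero c)
    rwa [Real.sqrt_zero] at this
  refine isCompactOperator_of_tendsto htend (Eventually.of_forall fun s => ?_)
  refine Submodule.sum_mem (compactOperator (RingHom.id ℂ) V H) fun i _ => ?_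
  exact (isCompactOperator_of_locallyCompactSpace_rng
    (ContinuousLinearMap.toSpanSingleton ℂ (b i))).comp_clm ((innerSL ℂ (b i)).comp T)

end Compact

/-! ## Points of the big cell -/

section BigCell

variable {n : ℕ}

/-- Exactly `N` pairs satisfy `p + 1 + q = N`. This is where the weight `|k|` of the `1/2`-norm
comes from: it counts how often a coefficient occurs in a Hankel matrix. -/
lemma summable_antidiagonal {a : ℕ → ℝ} (ha : ∀ N, 0 ≤ a N)
    (h : Summable fun N : ℕ => (N : ℝ) * a N) :
    Summable fun p : ℕ × ℕ => a (p.1 + 1 + p.2) := by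
  rw [← Finset.HasAntidiagonal.sigmaAntidiagonalEquivProd.summable_iff]
  refine (summable_sigma_of_nonneg fun x => ?_).2 ⟨fun N => Summable.of_finite, ?_⟩
  · exact ha _
  refine ((summable_nat_add_iff 1).2 h).congr fun N => ?_
  have h1 : ∀ y : Finset.HasAntidiagonal.antidiagonal N,
      ((fun p : ℕ × ℕ => a (p.1 + 1 + p.2)) ∘
        Finset.HasAntidiagonal.sigmaAntidiagonalEquivProd) ⟨N, y⟩ = a (N + 1) := by
    rintro ⟨⟨i, j⟩, hy⟩
    rw [Finset.HasAntidiagonal.mem_antidiagonal] at hy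
    simp only at hy
    simp only [Function.comp_apply, Finset.HasAntidiagonal.sigmaAntidiagonalEquivProd_apply]
    congr 1
    omega
  rw [tsum_congr h1, tsum_fintype, Finset.sum_const, Finset.card_univ, Fintype.card_coe,
    Finset.Nat.card_antidiagonal, nsmul_eq_mul]

lemma sum_norm_sq_fourierCoeff_le (v : Lp ℂ 2 circ) (s : Finset ℤ) :
    ∑ k ∈ s, ‖fourierCoeff v k‖ ^ 2 ≤ ‖v‖ ^ 2 := by
  have h1 := lp.hasSum_norm (p := 2) (by simp) (fourierBasis.repr v)
  have h2 : HasSum (fun k => ‖fourierCoeff v k‖ ^ 2) (‖v‖ ^ 2) := by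
    simpa [fourierBasis_repr] using h1
  exact sum_le_hasSum s (fun _ _ => by positivity) h2

/-- The Hilbert–Schmidt estimate for the Hankel operator with symbol `f`. -/
lemma norm_sq_fourierCoeff_mul_le {f : UnitAddCircle → ℂ} (hf : f ∈ hInf ⊤) (v : Lp ℂ 2 circ)
    (hv : ∀ k < 0, fourierCoeff v k = 0) (m : ℤ)
    (hs : Summable fun k : ℕ => ‖fourierCoeff f (m - k)‖ ^ 2) :
    ‖fourierCoeff (fun x => f x * v x) m‖ ^ 2 ≤
      (∑' k : ℕ, ‖fourierCoeff f (m - k)‖ ^ 2) * ‖v‖ ^ 2 := by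
  have h := hasSum_fourierCoeff_mul (hInf.memLp_two hf) (Lp.memLp v) m
  have h1 : HasSum (fun k : ℕ => fourierCoeff f (m - k) * fourierCoeff v k)
      (fourierCoeff (fun x => f x * v x) m) := by
    refine (Function.Injective.hasSum_iff (g := fun k : ℕ => (k : ℤ)) Nat.cast_injective
      fun k hk => ?_).2 h
    rw [hv k, mul_zero]
    by_contra! h0
    exact hk ⟨k.toNat, by simp [h0]⟩
  refine le_of_tendsto' ((h1.norm).pow 2) fun s => ?_
  have h2 : ∑ k ∈ s, ‖fourierCoeff v k‖ ^ 2 ≤ ‖v‖ ^ 2 := by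
    have := sum_norm_sq_fourierCoeff_le v (s.map Nat.castEmbedding)
    rwa [Finset.sum_map] at this
  calc ‖∑ k ∈ s, fourierCoeff f (m - k) * fourierCoeff v k‖ ^ 2
      ≤ (∑ k ∈ s, ‖fourierCoeff f (m - k)‖ * ‖fourierCoeff v k‖) ^ 2 := by
        gcongr
        refine (norm_sum_le _ _).trans (le_of_eq ?_)
        simp only [norm_mul]
    _ ≤ (∑ k ∈ s, ‖fourierCoeff f (m - k)‖ ^ 2) * ∑ k ∈ s, ‖fourierCoeff v k‖ ^ 2 :=
        Finset.sum_mul_sq_le_sq_mul_sq _ _ _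
    _ ≤ _ := mul_le_mul (hs.sum_le_tsum s fun _ _ => by positivity) h2
        (Finset.sum_nonneg fun _ _ => by positivity) (tsum_nonneg fun _ => by positivity)

/-- The index `-p - 1 - q` is that of the Hankel matrix entry from `z^q` in `H₊` to `z^{-p-1}` in
`H₋`. -/
lemma FiniteNorms.summable_entry {γ : UnitAddCircle → Mat n} (hγ : FiniteNorms γ) (i j : Fin n) :
    Summable fun p : ℕ × ℕ =>
      ‖fourierCoeff (fun x => γ x i j) (-(p.1 : ℤ) - 1 - (p.2 : ℤ))‖ ^ 2 := by
  have h1 := hγ.2.comp_injective (i := fun N : ℕ => -(N : ℤ)) fun a b h => by simpa using h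
  have h2 : Summable fun N : ℕ => (N : ℝ) * ‖fourierCoeff (fun x => γ x i j) (-(N : ℤ))‖ ^ 2 := by
    refine Summable.of_nonneg_of_le (fun _ => by positivity) (fun N => ?_) h1
    simp only [Function.comp_apply, Int.cast_neg, Int.cast_natCast, abs_neg, Nat.abs_cast]
    refine mul_le_mul_of_nonneg_left ?_ (by positivity)
    exact (Finset.single_le_sum (f := fun j => ‖loopCoeff γ (-(N : ℤ)) i j‖ ^ 2)
      (fun _ _ => by positivity) (Finset.mem_univ j)).trans
      (Finset.single_le_sum (f := fun i => ∑ j, ‖loopCoeff γ (-(N : ℤ)) i j‖ ^ 2)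
        (fun _ _ => Finset.sum_nonneg fun _ _ => by positivity) (Finset.mem_univ i))
  refine (summable_antidiagonal (fun _ => by positivity) h2).congr fun p => ?_
  congr 3
  push_cast
  ring

lemma norm_comp_le (i : Fin n) (v : Hil n) : ‖comp i v‖ ≤ ‖v‖ := by
  refine Lp.norm_le_norm_of_ae_le ?_
  filter_upwards [coeFn_comp i v] with x hx
  rw [hx]
  exact PiLp.norm_apply_le _ _

/-- `p₋` is compact on `γ H₊` if `γ` has finite norms. -/
lemma isCompactOperator_pMinusOn {γ δ : matLoops n ⊤} (hγ : FiniteNorms γ.1)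
    (h2 : ∀ᵐ x ∂circ, δ.1 x * γ.1 x = 1) :
    IsCompactOperator (pMinusOn (loopImage γ.1 (hardyPlus n))) := by
  set W := loopImage γ.1 (hardyPlus n) with hW
  -- The coordinate bounds for `w = γ u`: the factor `n` is Cauchy–Schwarz over the entries of a
  -- row, the inner sums are squared Hankel rows, and `‖mulOp δ‖` bounds `u = δ w` in terms of `w`.
  set c : Fin n → ℤ → ℝ := fun i m => if m < 0 then
    (n * ∑ j, ∑' k : ℕ, ‖fourierCoeff (fun x => γ.1 x i j) (m - k)‖ ^ 2) * ‖mulOp δ‖ ^ 2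
    else 0 with hc
  have hc0 : ∀ i m, 0 ≤ c i m := fun i m => by
    simp only [hc]
    split_ifs
    · have : 0 ≤ ∑ j, ∑' k : ℕ, ‖fourierCoeff (fun x => γ.1 x i j) (m - k)‖ ^ 2 :=
        Finset.sum_nonneg fun _ _ => tsum_nonneg fun _ => by positivity
      positivity
    · exact le_rfl
  have hfib : ∀ i j, ∀ m < 0,
      Summable fun k : ℕ => ‖fourierCoeff (fun x => γ.1 x i j) (m - k)‖ ^ 2 := fun i j m hm => by
    have := ((summable_prod_of_nonneg fun _ => by positivity).1 (hγ.summable_entry i j)).1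
      (-m - 1).toNat
    convert! this using 5
    simp only
    omega
  have hcs : ∀ i, Summable (c i) := fun i => by
    refine (Function.Injective.summable_iff (g := fun N : ℕ => -(N : ℤ) - 1)
      (fun a b h => by simpa using h) fun m hm => ?_).1 ?_
    · refine if_neg fun h => hm ⟨(-m - 1).toNat, ?_⟩
      simp only
      omega
    · have h1 : ∀ N : ℕ, -(N : ℤ) - 1 < 0 := fun N => by omega
      simp only [hc, Function.comp_def, h1, if_true]
      refine Summable.mul_right _ (Summable.mul_left _ (summable_sum fun j _ => ?_))
      exact ((summable_prod_of_nonneg fun _ => by positivity).1 (hγ.summable_entry i j)).2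
  have hT : ∀ i, IsCompactOperator
      ((comp i).comp ((hardyMinus n).subtypeL.comp (pMinusOn W))) := fun i => by
    refine isCompactOperator_of_hilbertBasis fourierBasis _ (hcs i) (hc0 i) fun m w => ?_
    change ‖fourierBasis.repr (comp i (pMinus n w)) m‖ ^ 2 ≤ _
    rw [repr_comp]
    rcases lt_or_ge m 0 with hm | hm
    · obtain ⟨u, hu, hwu⟩ := (mem_loopImage γ).1 w.2
      have hu' : u = mulOp δ w := by rw [hwu, mulOp_mulOp_of_mul_eq_one h2]
      have h3 : fourierCoeff (fun x => (pMinus n (w : Hil n) : Hil n) x i) m =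
          fourierCoeff (fun x => (w : Hil n) x i) m := by
        have h4 := mem_hardyPlus.1 (sub_pMinus_mem (w : Hil n)) i m hm
        rw [← repr_comp, map_sub, map_sub, lp.coeFn_sub, Pi.sub_apply, repr_comp, repr_comp,
          sub_eq_zero] at h4
        exact h4.symm
      rw [h3, hwu, fourierCoeff_mulOp]
      have h5 : ∀ j, ‖fourierCoeff (fun x => γ.1 x i j * u x j) m‖ ^ 2 ≤
          (∑' k : ℕ, ‖fourierCoeff (fun x => γ.1 x i j) (m - k)‖ ^ 2) * ‖u‖ ^ 2 := fun j => by
        have h6 := norm_sq_fourierCoeff_mul_le (γ.2 i j) (comp j u) (fun k hk => by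
          rw [fourierCoeff_congr (coeFn_comp j u), mem_hardyPlus.1 hu j k hk]) m (hfib i j m hm)
        have h7 : fourierCoeff (fun x => γ.1 x i j * comp j u x) m =
            fourierCoeff (fun x => γ.1 x i j * u x j) m :=
          fourierCoeff_congr (by filter_upwards [coeFn_comp j u] with x hx; rw [hx]) m
        rw [h7] at h6
        refine h6.trans (mul_le_mul_of_nonneg_left ?_ (tsum_nonneg fun _ => by positivity))
        exact pow_le_pow_left₀ (norm_nonneg _) (norm_comp_le j u) 2
      have h8 : ‖u‖ ≤ ‖mulOp δ‖ * ‖w‖ := by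
        rw [hu']
        exact (mulOp δ).le_opNorm _
      have h9 : 0 ≤ ∑ j, ∑' k : ℕ, ‖fourierCoeff (fun x => γ.1 x i j) (m - k)‖ ^ 2 :=
        Finset.sum_nonneg fun _ _ => tsum_nonneg fun _ => by positivity
      calc ‖∑ j, fourierCoeff (fun x => γ.1 x i j * u x j) m‖ ^ 2
          ≤ (∑ j, ‖fourierCoeff (fun x => γ.1 x i j * u x j) m‖) ^ 2 := by
            gcongr
            exact norm_sum_le _ _
        _ ≤ n * ∑ j, ‖fourierCoeff (fun x => γ.1 x i j * u x j) m‖ ^ 2 := by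
            have := sq_sum_le_card_mul_sum_sq (s := Finset.univ)
              (f := fun j => ‖fourierCoeff (fun x => γ.1 x i j * u x j) m‖)
            simpa using this
        _ ≤ n * ∑ j, (∑' k : ℕ, ‖fourierCoeff (fun x => γ.1 x i j) (m - k)‖ ^ 2) * ‖u‖ ^ 2 := by
            gcongr with j
            exact h5 j
        _ = (n * ∑ j, ∑' k : ℕ, ‖fourierCoeff (fun x => γ.1 x i j) (m - k)‖ ^ 2) * ‖u‖ ^ 2 := by
            rw [← Finset.sum_mul, mul_assoc]
        _ ≤ (n * ∑ j, ∑' k : ℕ, ‖fourierCoeff (fun x => γ.1 x i j) (m - k)‖ ^ 2) *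
              (‖mulOp δ‖ * ‖w‖) ^ 2 := by gcongr
        _ = c i m * ‖w‖ ^ 2 := by
            simp only [hc, if_pos hm]
            ring
    · rw [mem_hardyMinus.1 (pMinus n (w : Hil n)).2 i m hm]
      have := hc0 i m
      simp only [norm_zero, ne_eq, OfNat.ofNat_ne_zero, not_false_eq_true, zero_pow]
      positivity
  -- The criterion was applied to scalar components; they are reassembled here, `p₋` being the
  -- identity on `H₋`.
  have hdec : pMinusOn W = ∑ i, ((pMinus n).comp (inj i)).comp
      ((comp i).comp ((hardyMinus n).subtypeL.comp (pMinusOn W))) := by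
    ext1 w
    have h3 : pMinus n (pMinusOn W w : Hil n) = pMinusOn W w :=
      Submodule.orthogonalProjectionOnto_mem_subspace_eq_self _
    rw [_root_.sum_apply]
    change _ = ∑ i, pMinus n (inj i (comp i (pMinusOn W w)))
    rw [← map_sum, sum_inj_comp, h3]
  rw [hdec]
  exact Submodule.sum_mem (compactOperator (RingHom.id ℂ) W (hardyMinus n)) fun i _ =>
    (hT i).clm_comp ((pMinus n).comp (inj i))

lemma isBigCell_loopImage {γ δ : matLoops n ⊤} (hγ : γ.1 ∈ matLoops n nonposModes)
    (hδ : δ.1 ∈ matLoops n nonposModes) (hfin : FiniteNorms γ.1)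
    (h1 : ∀ᵐ x ∂circ, γ.1 x * δ.1 x = 1) (h2 : ∀ᵐ x ∂circ, δ.1 x * γ.1 x = 1) :
    IsBigCell (loopImage γ.1 (hardyPlus n)) := by
  have htr := isTransversal_loopImage hγ hδ h1 h2
  have hz : loopImage (fun x => zed x • (1 : Mat n)) (loopImage γ.1 (hardyPlus n)) ≤
      loopImage γ.1 (hardyPlus n) := by
    have h3 : (fun x => zed x • (1 : Mat n)) = (zedLoop n).1 := rfl
    rw [h3]
    exact loopImage_loopImage_le_of_commute (zedLoop_mem n) (zedLoop_mul_comm γ)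
  refine ⟨⟨isClosed_loopImage h1 h2, ?_, ?_, isCompactOperator_pMinusOn hfin h2, hz⟩, htr⟩
  · rw [LinearMap.ker_eq_bot.2 htr.1]
    infer_instance
  · rw [LinearMap.range_eq_top.2 htr.2]
    infer_instance

end BigCell

/-! ## The space of times -/

section Times

variable {ι : Type*} {n : ℕ} {Λ : ι → LoopPoly n}

lemma withSeminorms_times (Λ : ι → LoopPoly n) : WithSeminorms (timesSeminorm Λ) := ⟨rfl⟩

instance (Λ : ι → LoopPoly n) : IsTopologicalAddGroup (Times Λ) :=
  (withSeminorms_times Λ).topologicalAddGroup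

instance (Λ : ι → LoopPoly n) : ContinuousSMul ℝ (Times Λ) :=
  (withSeminorms_times Λ).continuousSMul

lemma timesSeminorm_apply (R : ℕ) (t : Times Λ) :
    timesSeminorm Λ R t = ∑' j, |t.coord j| * weight R (Λ j) := rfl

lemma Times.ext {t u : Times Λ} (h : ∀ j, t.coord j = u.coord j) : t = u :=
  Subtype.ext (funext h)

lemma Times.coord_add (t u : Times Λ) (j : ι) : (t + u).coord j = t.coord j + u.coord j := rfl

lemma Times.coord_sub (t u : Times Λ) (j : ι) : (t - u).coord j = t.coord j - u.coord j := rfl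

lemma Times.coord_zero (j : ι) : (0 : Times Λ).coord j = 0 := rfl

open Classical in
lemma Times.coord_single (j k : ι) (s : ℝ) :
    (Times.single j s : Times Λ).coord k = if k = j then s else 0 :=
  Pi.single_apply j s k

lemma Times.single_add (j : ι) (r s : ℝ) :
    (Times.single j (r + s) : Times Λ) = Times.single j r + Times.single j s := by
  classical
  refine Times.ext fun k => ?_
  rw [Times.coord_add, Times.coord_single, Times.coord_single, Times.coord_single]
  split_ifs <;> simp

lemma Times.single_zero (j : ι) : (Times.single j 0 : Times Λ) = 0 := by
  classical
  refine Times.ext fun k => ?_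
  rw [Times.coord_single, Times.coord_zero, ite_self]

lemma Times.continuous_single (j : ι) : Continuous fun s : ℝ => (Times.single j s : Times Λ) := by
  classical
  have h : ∀ s : ℝ, (Times.single j s : Times Λ) = s • Times.single j 1 := fun s => by
    refine Times.ext fun k => ?_
    change _ = s * (Times.single j 1 : Times Λ).coord k
    rw [Times.coord_single, Times.coord_single]
    split_ifs <;> simp
  rw [funext h]
  exact continuous_id.smul continuous_const

lemma timesSeminorm_mono (R : ℕ) {t u : Times Λ} (h : ∀ j, |t.coord j| ≤ |u.coord j|) :
    timesSeminorm Λ R t ≤ timesSeminorm Λ R u :=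
  (t.summable R).tsum_le_tsum
    (fun j => mul_le_mul_of_nonneg_right (h j) (weight_nonneg _ _)) (u.summable R)

/-- The seminorm balls are solid, so truncating a displacement does not leave the ball. -/
lemma sup_timesSeminorm_lt_of_abs_le (S : Finset ℕ) {t u : Times Λ} {r : ℝ}
    (h : ∀ j, |t.coord j| ≤ |u.coord j|) (hu : S.sup (timesSeminorm Λ) u < r) :
    S.sup (timesSeminorm Λ) t < r := by
  have hr : 0 < r := (apply_nonneg _ _).trans_lt hu
  refine Seminorm.finset_sup_apply_lt hr fun R hR => ?_
  exact (timesSeminorm_mono R h).trans_lt ((Seminorm.le_finset_sup_apply hR).trans_lt hu)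

open Classical in
/-- The truncation of a family of times to a finite set of indices. -/
def Times.trunc (F : Finset ι) (t : Times Λ) : Times Λ :=
  (⟨fun j => if j ∈ F then t.coord j else 0, fun R =>
    summable_of_ne_finset_zero (s := F) fun j hj => by simp [hj]⟩ : timesSubmodule Λ)

open Classical in
lemma Times.coord_trunc (F : Finset ι) (t : Times Λ) (j : ι) :
    (t.trunc F).coord j = if j ∈ F then t.coord j else 0 := rfl

/-- The error is the tail of an absolutely convergent series. Through this density, partial
derivatives in the single times suffice to reach every point. -/
lemma Times.tendsto_trunc (t : Times Λ) : Tendsto (fun F => t.trunc F) atTop (𝓝 t) := by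
  classical
  rw [(withSeminorms_times Λ).tendsto_nhds]
  intro R ε hε
  have h := tendsto_tsum_compl_atTop_zero fun j => |t.coord j| * weight R (Λ j)
  filter_upwards [h.eventually (gt_mem_nhds hε)] with F hF
  refine lt_of_eq_of_lt ?_ hF
  rw [timesSeminorm_apply]
  have h1 : ∀ j, |(t.trunc F - t).coord j| * weight R (Λ j) =
      {j | j ∉ F}.indicator (fun j => |t.coord j| * weight R (Λ j)) j := fun j => by
    rw [Times.coord_sub, Times.coord_trunc]
    by_cases hj : j ∈ F <;> simp [hj]
  rw [tsum_congr h1, ← tsum_subtype]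
  rfl

/-- The exponent `∑ t_j Λ_j`. -/
def logG (t : Times Λ) (x : UnitAddCircle) : Mat n :=
  ∑' j, (t.coord j : ℂ) • evalAt (Λ j) (zed x)

/-- The inverse of `g(t; z)`. -/
def gInv (t : Times Λ) (x : UnitAddCircle) : Mat n := NormedSpace.exp (-logG t x)

lemma norm_logG_term_le (t : Times Λ) (x : UnitAddCircle) (j : ι) (a b : Fin n) :
    ‖(t.coord j : ℂ) * evalAt (Λ j) (zed x) a b‖ ≤ |t.coord j| * weight 1 (Λ j) := by
  rw [norm_mul, Complex.norm_real, Real.norm_eq_abs]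
  exact mul_le_mul_of_nonneg_left (norm_evalAt_le _ _ _ _) (abs_nonneg _)

lemma summable_logG (t : Times Λ) (x : UnitAddCircle) :
    Summable fun j => (t.coord j : ℂ) • evalAt (Λ j) (zed x) := by
  refine Pi.summable.2 fun a => Pi.summable.2 fun b => ?_
  exact Summable.of_norm_bounded (t.summable 1) fun j => norm_logG_term_le t x j a b

lemma logG_apply (t : Times Λ) (x : UnitAddCircle) (a b : Fin n) :
    logG t x a b = ∑' j, (t.coord j : ℂ) * evalAt (Λ j) (zed x) a b :=
  (Pi.hasSum.1 (Pi.hasSum.1 (summable_logG t x).hasSum a) b).tsum_eq.symm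

lemma norm_logG_apply_le (t : Times Λ) (x : UnitAddCircle) (a b : Fin n) :
    ‖logG t x a b‖ ≤ timesSeminorm Λ 1 t := by
  rw [logG_apply]
  exact tsum_of_norm_bounded (t.summable 1).hasSum fun j => norm_logG_term_le t x j a b

lemma logG_add (t u : Times Λ) (x : UnitAddCircle) : logG (t + u) x = logG t x + logG u x := by
  rw [logG, logG, logG, ← (summable_logG t x).tsum_add (summable_logG u x)]
  refine tsum_congr fun j => ?_
  rw [Times.coord_add, Complex.ofReal_add, add_smul]

lemma logG_zero (x : UnitAddCircle) : logG (0 : Times Λ) x = 0 := by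
  simp [logG, Times.coord_zero]

lemma logG_single (j : ι) (s : ℝ) (x : UnitAddCircle) :
    logG (Times.single j s : Times Λ) x = (s : ℂ) • evalAt (Λ j) (zed x) := by
  classical
  rw [logG, tsum_eq_single j]
  · rw [Times.coord_single, if_pos rfl]
  · intro k hk
    rw [Times.coord_single, if_neg hk, Complex.ofReal_zero, zero_smul]

lemma logG_mem (hpos : ∀ j, (fun x => evalAt (Λ j) (zed x)) ∈ matLoops n nonnegModes)
    (t : Times Λ) : logG t ∈ matLoops n nonnegModes := by
  intro a b
  simp only [logG_apply]
  exact (tsum_mem_hInf (t.summable 1) (fun j => Subalgebra.smul_mem _ (hpos j a b) (t.coord j : ℂ))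
    fun j x => norm_logG_term_le t x j a b).1

lemma commute_logG (hcomm : ∀ j k, ⁅Λ j, Λ k⁆ = 0) (t u : Times Λ) (x : UnitAddCircle) :
    Commute (logG t x) (logG u x) := by
  refine Commute.tsum_left _ fun j => Commute.tsum_right _ fun k => ?_
  refine (Commute.smul_left ?_ _).smul_right _
  have h := evalAt_lie (Λ j) (Λ k) (zed_ne_zero x)
  rw [hcomm, evalAt_zero] at h
  exact (sub_eq_zero.1 h.symm)

lemma trace_logG (htr : ∀ j x, (evalAt (Λ j) (zed x)).trace = 0) (t : Times Λ)
    (x : UnitAddCircle) : (logG t x).trace = 0 := by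
  rw [Matrix.trace]
  simp only [Matrix.diag_apply, logG_apply]
  rw [← Summable.tsum_finsetSum fun a _ =>
    Summable.of_norm_bounded (t.summable 1) fun j => norm_logG_term_le t x j a a]
  simp only [← Finset.mul_sum]
  convert! tsum_zero with j
  have := htr j x
  rw [Matrix.trace] at this
  simp only [Matrix.diag_apply] at this
  rw [this, mul_zero]

lemma gPlus_mem (hpos : ∀ j, (fun x => evalAt (Λ j) (zed x)) ∈ matLoops n nonnegModes)
    (t : Times Λ) : gPlus t ∈ matLoops n nonnegModes :=
  (exp_mem_matLoops (logG_mem hpos t) (norm_logG_apply_le t)).1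

lemma gInv_mem (hpos : ∀ j, (fun x => evalAt (Λ j) (zed x)) ∈ matLoops n nonnegModes)
    (t : Times Λ) : gInv t ∈ matLoops n nonnegModes :=
  (exp_mem_matLoops (L := fun x => -logG t x) (Subalgebra.neg_mem _ (logG_mem hpos t))
    (fun x a b => by rw [Matrix.neg_apply, norm_neg]; exact norm_logG_apply_le t x a b)).1

lemma gInv_eq_inv (t : Times Λ) (x : UnitAddCircle) : gInv t x = (gPlus t x)⁻¹ :=
  Matrix.exp_neg _

lemma isUnit_gPlus (t : Times Λ) (x : UnitAddCircle) : IsUnit (gPlus t x) :=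
  Matrix.isUnit_exp _

lemma gPlus_mul_gInv (t : Times Λ) (x : UnitAddCircle) : gPlus t x * gInv t x = 1 := by
  rw [gInv_eq_inv]
  exact Matrix.mul_nonsing_inv _ ((Matrix.isUnit_iff_isUnit_det _).1 (isUnit_gPlus t x))

lemma gInv_mul_gPlus (t : Times Λ) (x : UnitAddCircle) : gInv t x * gPlus t x = 1 := by
  rw [gInv_eq_inv]
  exact Matrix.nonsing_inv_mul _ ((Matrix.isUnit_iff_isUnit_det _).1 (isUnit_gPlus t x))

lemma gInv_zero (x : UnitAddCircle) : gInv (0 : Times Λ) x = 1 := by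
  rw [gInv, logG_zero, neg_zero, NormedSpace.exp_zero]

lemma det_gInv (htr : ∀ j x, (evalAt (Λ j) (zed x)).trace = 0) (t : Times Λ)
    (x : UnitAddCircle) : (gInv t x).det = 1 :=
  det_exp_of_trace_eq_zero (by rw [Matrix.trace_neg, trace_logG htr, neg_zero])

lemma norm_gInv_apply_le (t : Times Λ) (x : UnitAddCircle) (a b : Fin n) :
    ‖gInv t x a b‖ ≤ Real.exp (n * timesSeminorm Λ 1 t) :=
  norm_exp_apply_le (fun a b => by
    rw [Matrix.neg_apply, norm_neg]; exact norm_logG_apply_le t x a b) a b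

lemma gInv_add (hcomm : ∀ j k, ⁅Λ j, Λ k⁆ = 0) (t u : Times Λ) (x : UnitAddCircle) :
    gInv (t + u) x = gInv u x * gInv t x := by
  rw [gInv, gInv, gInv, logG_add, neg_add_rev]
  exact Matrix.exp_add_of_commute _ _ ((commute_logG hcomm u t x).neg_left.neg_right)

lemma norm_gInv_sub_one_apply_le (u : Times Λ) (x : UnitAddCircle) (a b : Fin n) :
    ‖(gInv u x - 1) a b‖ ≤ timesSeminorm Λ 1 u +
      (n * timesSeminorm Λ 1 u) ^ 2 * Real.exp (n * timesSeminorm Λ 1 u) := by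
  have hC : ∀ a b, ‖(-logG u x) a b‖ ≤ timesSeminorm Λ 1 u := fun a b => by
    rw [Matrix.neg_apply, norm_neg]; exact norm_logG_apply_le u x a b
  have h := norm_exp_sub_one_sub_apply_le hC a b
  have h1 : (gInv u x - 1) a b = (-logG u x) a b +
      (NormedSpace.exp (-logG u x) - 1 - -logG u x) a b := by
    rw [gInv, ← Matrix.add_apply, add_sub_cancel]
  rw [h1]
  exact (norm_add_le _ _).trans (add_le_add (hC a b) h)

/-- `g(t; z)⁻¹` depends continuously on `t`, uniformly in `z`. -/
lemma tendstoUniformly_gInv (hcomm : ∀ j k, ⁅Λ j, Λ k⁆ = 0) (t : Times Λ) (a b : Fin n) :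
    TendstoUniformly (fun t' x => gInv t' x a b) (fun x => gInv t x a b) (𝓝 t) := by
  set p := timesSeminorm Λ 1
  have hp : Tendsto (fun t' => p (t' - t)) (𝓝 t) (𝓝 0) := by
    have h1 : Continuous p := (withSeminorms_times Λ).continuous_seminorm 1
    have h2 : Continuous fun t' => p (t' - t) := h1.comp (continuous_id.sub continuous_const)
    simpa using h2.tendsto t
  have hη : Tendsto (fun t' => n * (p (t' - t) +
      (n * p (t' - t)) ^ 2 * Real.exp (n * p (t' - t))) * Real.exp (n * p t)) (𝓝 t) (𝓝 0) := by
    have h1 : Continuous fun r : ℝ => n * (r + (n * r) ^ 2 * Real.exp (n * r)) *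
      Real.exp (n * p t) := by fun_prop
    have h2 := (h1.tendsto 0).comp hp
    simpa [Function.comp_def] using h2
  rw [Metric.tendstoUniformly_iff]
  intro ε hε
  filter_upwards [hη.eventually (gt_mem_nhds hε)] with t' ht' x
  rw [dist_comm, dist_eq_norm]
  refine lt_of_le_of_lt ?_ ht'
  have h1 : gInv t' x a b - gInv t x a b = ((gInv (t' - t) x - 1) * gInv t x) a b := by
    rw [sub_mul, one_mul, ← gInv_add hcomm, add_sub_cancel, Matrix.sub_apply]
  rw [h1]
  exact norm_mul_apply_le (norm_gInv_sub_one_apply_le (t' - t) x) (norm_gInv_apply_le t x) a b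

/-- `∂g⁻¹/∂t_j = -Λ_j g⁻¹`, uniformly in `z`. -/
lemma tendstoUniformly_slope_gInv (hcomm : ∀ j k, ⁅Λ j, Λ k⁆ = 0) (t : Times Λ) (j : ι)
    (a b : Fin n) :
    TendstoUniformly
      (fun (s : ℝ) x => (s : ℂ)⁻¹ * (gInv (t + Times.single j s) x a b - gInv t x a b))
      (fun x => (-evalAt (Λ j) (zed x) * gInv t x) a b) (𝓝[≠] 0) := by
  set p := timesSeminorm Λ 1
  set w := weight 1 (Λ j)
  -- The second-order remainder of the exponential divided by `|s|`, then multiplied by the bound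
  -- for `g(t)⁻¹`; one factor `n` comes from the matrix product.
  have hη : Tendsto (fun s : ℝ => n * (n ^ 2 * w ^ 2 * |s| * Real.exp (n * (|s| * w))) *
      Real.exp (n * p t)) (𝓝[≠] 0) (𝓝 0) := by
    have h1 : Continuous fun s : ℝ => n * (n ^ 2 * w ^ 2 * |s| * Real.exp (n * (|s| * w))) *
      Real.exp (n * p t) := by fun_prop
    have h2 := (h1.tendsto 0).mono_left (nhdsWithin_le_nhds (s := {0}ᶜ))
    simpa using h2
  rw [Metric.tendstoUniformly_iff]
  intro ε hε
  filter_upwards [hη.eventually (gt_mem_nhds hε), self_mem_nhdsWithin] with s hs hs0 x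
  have hs0' : (s : ℂ) ≠ 0 := by exact_mod_cast hs0
  rw [dist_comm, dist_eq_norm]
  refine lt_of_le_of_lt ?_ hs
  set u : Mat n := (s : ℂ) • -evalAt (Λ j) (zed x) with hu
  have hul : gInv (Times.single j s : Times Λ) x = NormedSpace.exp u := by
    rw [gInv, logG_single, hu, smul_neg]
  have h1 : (s : ℂ)⁻¹ * (gInv (t + Times.single j s) x a b - gInv t x a b) -
      (-evalAt (Λ j) (zed x) * gInv t x) a b =
      (((s : ℂ)⁻¹ • (NormedSpace.exp u - 1 - u)) * gInv t x) a b := by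
    rw [gInv_add hcomm, hul, smul_sub, hu, smul_smul, inv_mul_cancel₀ hs0', one_smul, sub_mul,
      smul_mul_assoc, sub_mul, one_mul, Matrix.sub_apply, Matrix.smul_apply, smul_eq_mul,
      Matrix.sub_apply]
  rw [h1]
  refine norm_mul_apply_le (fun a b => ?_) (norm_gInv_apply_le t x) a b
  have hC : ∀ a b, ‖u a b‖ ≤ |s| * w := fun a b => by
    rw [hu, Matrix.smul_apply, norm_smul, Complex.norm_real, Real.norm_eq_abs, Matrix.neg_apply,
      norm_neg]
    exact mul_le_mul_of_nonneg_left (norm_evalAt_le _ _ _ _) (abs_nonneg _)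
  rw [Matrix.smul_apply, norm_smul, norm_inv, Complex.norm_real, Real.norm_eq_abs]
  have hs1 : 0 < |s| := abs_pos.2 hs0
  calc |s|⁻¹ * ‖(NormedSpace.exp u - 1 - u) a b‖
      ≤ |s|⁻¹ * ((n * (|s| * w)) ^ 2 * Real.exp (n * (|s| * w))) :=
        mul_le_mul_of_nonneg_left (norm_exp_sub_one_sub_apply_le hC a b) (by positivity)
    _ = n ^ 2 * w ^ 2 * |s| * Real.exp (n * (|s| * w)) := by
        field_simp

end Times

/-! ## Weak limits of Fourier coefficients of products -/

section Weak

variable {f g h : UnitAddCircle → ℂ}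

/-- `∑ₖ ‖fₖ‖² ≤ A²`. -/
def CoeffBound (f : UnitAddCircle → ℂ) (A : ℝ) : Prop :=
  ∀ s : Finset ℤ, ∑ k ∈ s, ‖fourierCoeff f k‖ ^ 2 ≤ A ^ 2

lemma coeffBound_of_bound (hf : MemLp f 2 circ) {A : ℝ} (hA : 0 ≤ A)
    (h : ∀ᵐ x ∂circ, ‖f x‖ ≤ A) : CoeffBound f A := by
  intro s
  have h1 := sum_norm_sq_fourierCoeff_le (hf.toLp f) s
  simp only [fourierCoeff_congr hf.coeFn_toLp] at h1
  refine h1.trans (pow_le_pow_left₀ (norm_nonneg _) ?_ 2)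
  rw [Lp.norm_toLp]
  refine ENNReal.toReal_le_of_le_ofReal hA ?_
  simpa using eLpNorm_le_of_ae_bound (p := 2) h

lemma exists_coeffBound (hf : MemLp f 2 circ) : ∃ A, 0 ≤ A ∧ CoeffBound f A := by
  refine ⟨‖hf.toLp f‖, norm_nonneg _, fun s => ?_⟩
  have h1 := sum_norm_sq_fourierCoeff_le (hf.toLp f) s
  simpa only [fourierCoeff_congr hf.coeFn_toLp] using h1

lemma norm_sum_mul_le {a b : ℤ → ℂ} {s : Finset ℤ} {A B : ℝ} (hA : 0 ≤ A) (hB : 0 ≤ B)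
    (ha : ∑ k ∈ s, ‖a k‖ ^ 2 ≤ A ^ 2) (hb : ∑ k ∈ s, ‖b k‖ ^ 2 ≤ B ^ 2) :
    ‖∑ k ∈ s, a k * b k‖ ≤ A * B := by
  refine (norm_sum_le _ _).trans ?_
  simp only [norm_mul]
  refine le_of_sq_le_sq ?_ (by positivity)
  refine (Finset.sum_mul_sq_le_sq_mul_sq s _ _).trans ?_
  rw [mul_pow]
  exact mul_le_mul ha hb (Finset.sum_nonneg fun _ _ => by positivity) (by positivity)

lemma CoeffBound.sum_sub {A : ℝ} (hf : CoeffBound f A) (m : ℤ) (s : Finset ℤ) :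
    ∑ k ∈ s, ‖fourierCoeff f (m - k)‖ ^ 2 ≤ A ^ 2 := by
  have h := hf (s.map ⟨fun k => m - k, fun a b hab => by simpa using hab⟩)
  rwa [Finset.sum_map] at h

/-- Cauchy–Schwarz on the tail of the convolution: `A` controls all coefficients of `f`, `B` those
of `g` outside `s`. Taking `s = ∅` bounds the full coefficient. -/
lemma norm_fourierCoeff_mul_sub_sum_le (hf : MemLp f 2 circ) (hg : MemLp g 2 circ) {A B : ℝ}
    (hA : 0 ≤ A) (hB : 0 ≤ B) (hfA : CoeffBound f A) (s : Finset ℤ)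
    (hgB : ∀ t, Disjoint t s → ∑ k ∈ t, ‖fourierCoeff g k‖ ^ 2 ≤ B ^ 2) (m : ℤ) :
    ‖fourierCoeff (fun x => f x * g x) m - ∑ k ∈ s, fourierCoeff f (m - k) * fourierCoeff g k‖
      ≤ A * B := by
  have h1 : Tendsto (fun t => ∑ k ∈ t, fourierCoeff f (m - k) * fourierCoeff g k) atTop
      (𝓝 (fourierCoeff (fun x => f x * g x) m)) := hasSum_fourierCoeff_mul hf hg m
  refine le_of_tendsto (h1.sub_const _).norm ?_
  filter_upwards [eventually_ge_atTop s] with t ht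
  rw [← Finset.sum_sdiff_eq_sub ht]
  exact norm_sum_mul_le hA hB (hfA.sum_sub m _) (hgB _ Finset.sdiff_disjoint)

lemma norm_fourierCoeff_mul_le (hf : MemLp f 2 circ) (hg : MemLp g 2 circ) {A B : ℝ}
    (hA : 0 ≤ A) (hB : 0 ≤ B) (hfA : CoeffBound f A) (hgB : CoeffBound g B) (m : ℤ) :
    ‖fourierCoeff (fun x => f x * g x) m‖ ≤ A * B := by
  simpa using norm_fourierCoeff_mul_sub_sum_le hf hg hA hB hfA ∅ (fun t _ => hgB t) m

variable {α : Type*} {l : Filter α} {F : α → UnitAddCircle → ℂ}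

/-- The Fourier coefficients of `f h` depend continuously on `f` in the weak topology of `L²`. -/
lemma tendsto_fourierCoeff_mul (hF : ∀ᶠ a in l, MemLp (F a) 2 circ) (hf : MemLp f 2 circ)
    (hh : MemLp h 2 circ) {A : ℝ} (hA : 0 ≤ A) (hFA : ∀ᶠ a in l, CoeffBound (F a) A)
    (hfA : CoeffBound f A)
    (hlim : ∀ k, Tendsto (fun a => fourierCoeff (F a) k) l (𝓝 (fourierCoeff f k))) (m : ℤ) :
    Tendsto (fun a => fourierCoeff (fun x => F a x * h x) m) l
      (𝓝 (fourierCoeff (fun x => f x * h x) m)) := by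
  have hsum : Summable fun k => ‖fourierCoeff h k‖ ^ 2 := by
    obtain ⟨B, -, hB⟩ := exists_coeffBound hh
    exact summable_of_sum_le (fun _ => by positivity) hB
  rw [Metric.tendsto_nhds]
  intro ε hε
  -- The two tails and the finite sum contribute at most `ε / 4` each.
  obtain ⟨B, hB, hAB⟩ : ∃ B, 0 < B ∧ A * B ≤ ε / 4 := by
    refine ⟨ε / (4 * (A + 1)), by positivity, ?_⟩
    rw [mul_div_assoc', div_le_div_iff₀ (by positivity) (by positivity)]
    nlinarith
  obtain ⟨s, hs⟩ := summable_iff_vanishing_norm.1 hsum (B ^ 2) (by positivity)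
  have hs' : ∀ t, Disjoint t s → ∑ k ∈ t, ‖fourierCoeff h k‖ ^ 2 ≤ B ^ 2 := fun t ht =>
    (le_abs_self _).trans (hs t ht).le
  have h1 : Tendsto (fun a => ∑ k ∈ s, fourierCoeff (F a) (m - k) * fourierCoeff h k) l
      (𝓝 (∑ k ∈ s, fourierCoeff f (m - k) * fourierCoeff h k)) :=
    tendsto_finsetSum _ fun k _ => (hlim _).mul_const _
  filter_upwards [hF, hFA, Metric.tendsto_nhds.1 h1 (ε / 4) (by positivity)] with a ha haA ha1
  have h2 := norm_fourierCoeff_mul_sub_sum_le ha hh hA hB.le haA s hs' m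
  have h3 := norm_fourierCoeff_mul_sub_sum_le hf hh hA hB.le hfA s hs' m
  rw [dist_eq_norm] at ha1 ⊢
  have h4 : fourierCoeff (fun x => F a x * h x) m - fourierCoeff (fun x => f x * h x) m =
      (fourierCoeff (fun x => F a x * h x) m -
        ∑ k ∈ s, fourierCoeff (F a) (m - k) * fourierCoeff h k) -
      (fourierCoeff (fun x => f x * h x) m -
        ∑ k ∈ s, fourierCoeff f (m - k) * fourierCoeff h k) +
      (∑ k ∈ s, fourierCoeff (F a) (m - k) * fourierCoeff h k -
        ∑ k ∈ s, fourierCoeff f (m - k) * fourierCoeff h k) := by ring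
  rw [h4]
  refine (norm_add_le _ _).trans_lt ?_
  have := norm_sub_le (fourierCoeff (fun x => F a x * h x) m -
        ∑ k ∈ s, fourierCoeff (F a) (m - k) * fourierCoeff h k)
      (fourierCoeff (fun x => f x * h x) m -
        ∑ k ∈ s, fourierCoeff f (m - k) * fourierCoeff h k)
  linarith

/-- The coefficients of `f e h` are jointly continuous for weak convergence of `f` and uniform
convergence of `e`. -/
lemma tendsto_fourierCoeff_mul_mul {e : α → UnitAddCircle → ℂ} {e₀ : UnitAddCircle → ℂ}
    (hF : ∀ᶠ a in l, F a ∈ hInf ⊤) (hf : f ∈ hInf ⊤) (hh : h ∈ hInf ⊤)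
    (he : ∀ᶠ a in l, e a ∈ hInf ⊤) (he₀ : e₀ ∈ hInf ⊤) {A : ℝ} (hA : 0 ≤ A)
    (hFA : ∀ᶠ a in l, CoeffBound (F a) A) (hfA : CoeffBound f A)
    (hlim : ∀ k, Tendsto (fun a => fourierCoeff (F a) k) l (𝓝 (fourierCoeff f k)))
    (hunif : TendstoUniformly e e₀ l) (m : ℤ) :
    Tendsto (fun a => fourierCoeff (fun x => F a x * (e a x * h x)) m) l
      (𝓝 (fourierCoeff (fun x => f x * (e₀ x * h x)) m)) := by
  obtain ⟨K, hK, hKh⟩ : ∃ K : ℝ, 0 ≤ K ∧ ∀ᵐ x ∂circ, ‖h x‖ ≤ K := by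
    obtain ⟨K, hK⟩ := exists_ae_bound (mem_hInf_top.1 hh)
    exact ⟨|K|, abs_nonneg K, hK.mono fun x hx => hx.trans (le_abs_self K)⟩
  have h1 := tendsto_fourierCoeff_mul (h := fun x => e₀ x * h x)
    (hF.mono fun a ha => hInf.memLp_two ha) (hInf.memLp_two hf)
    (hInf.memLp_two (mul_mem he₀ hh)) hA hFA hfA hlim m
  -- Writing `e = e₀ + (e - e₀)`, the previous result handles `e₀ h`; the rest is at most `A · η ·
  -- K`, where `η` is the uniform distance and `K` bounds `h`.
  have h2 : Tendsto (fun a => fourierCoeff (fun x => F a x * ((e a x - e₀ x) * h x)) m) l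
      (𝓝 0) := by
    rw [Metric.tendsto_nhds]
    intro ε hε
    obtain ⟨η, hη, hAη⟩ : ∃ η, 0 < η ∧ A * (η * K) < ε := by
      refine ⟨ε / (A * K + 1), by positivity, ?_⟩
      rw [div_mul_eq_mul_div, mul_div_assoc', div_lt_iff₀ (by positivity)]
      nlinarith
    filter_upwards [hF, hFA, he, Metric.tendstoUniformly_iff.1 hunif η hη] with a ha haA hea hη'
    rw [dist_zero_right]
    have hmem : (fun x => (e a x - e₀ x) * h x) ∈ hInf ⊤ := mul_mem (sub_mem hea he₀) hh
    refine (norm_fourierCoeff_mul_le (hInf.memLp_two ha) (hInf.memLp_two hmem) hA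
      (by positivity) haA (coeffBound_of_bound (hInf.memLp_two hmem) (A := η * K)
        (by positivity) ?_) m).trans_lt hAη
    filter_upwards [hKh] with x hx
    rw [norm_mul]
    refine mul_le_mul ?_ hx (norm_nonneg _) hη.le
    have := (hη' x).le
    rwa [dist_comm, dist_eq_norm] at this
  have h3 := h2.add h1
  rw [zero_add] at h3
  refine h3.congr' ?_
  filter_upwards [hF, he] with a ha hea
  refine (fourierCoeff_add_of_integrable
    (hInf.integrable (mul_mem ha (mul_mem (sub_mem hea he₀) hh)))
    (hInf.integrable (mul_mem ha (mul_mem he₀ hh))) m).symm.trans ?_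
  refine congrArg (fun u => fourierCoeff u m) (funext fun x => ?_)
  simp only [Pi.mul_apply, Pi.sub_apply]
  ring

/-- The product rule for the Fourier coefficients of `θ e h`, for a weakly differentiable `θ` and
a uniformly differentiable `e`. -/
lemma hasDerivAt_fourierCoeff_mul_mul {θ e : ℝ → UnitAddCircle → ℂ}
    {θ' e' : UnitAddCircle → ℂ} {r : ℝ}
    (hθ : ∀ᶠ s in 𝓝 r, θ s ∈ hInf ⊤) (hθ' : θ' ∈ hInf ⊤)
    (he : ∀ᶠ s in 𝓝 r, e s ∈ hInf ⊤) (he' : e' ∈ hInf ⊤) (hh : h ∈ hInf ⊤)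
    {A : ℝ} (hA : 0 ≤ A)
    (hquot : ∀ᶠ s in 𝓝[≠] r, CoeffBound (fun x => ((s - r : ℝ) : ℂ)⁻¹ * (θ s x - θ r x)) A)
    (hθ'A : CoeffBound θ' A)
    (hderiv : ∀ k, HasDerivAt (fun s => fourierCoeff (θ s) k) (fourierCoeff θ' k) r)
    (hunif : TendstoUniformly (fun s x => e s x) (e r) (𝓝 r))
    (hslope : TendstoUniformly (fun (s : ℝ) x => ((s - r : ℝ) : ℂ)⁻¹ * (e s x - e r x)) e'
      (𝓝[≠] r)) (m : ℤ) :
    HasDerivAt (fun s => fourierCoeff (fun x => θ s x * (e s x * h x)) m)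
      (fourierCoeff (fun x => θ' x * (e r x * h x)) m +
        fourierCoeff (fun x => θ r x * (e' x * h x)) m) r := by
  have hθr := hθ.self_of_nhds
  have her := he.self_of_nhds
  have hθn := hθ.filter_mono (nhdsWithin_le_nhds (s := {r}ᶜ))
  have hen := he.filter_mono (nhdsWithin_le_nhds (s := {r}ᶜ))
  have hqmem : ∀ᶠ s in 𝓝[≠] r, (fun x => ((s - r : ℝ) : ℂ)⁻¹ * (θ s x - θ r x)) ∈ hInf ⊤ :=
    hθn.mono fun s hs => Subalgebra.smul_mem _ (sub_mem hs hθr) _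
  have hsmem : ∀ᶠ s in 𝓝[≠] r, (fun x => ((s - r : ℝ) : ℂ)⁻¹ * (e s x - e r x)) ∈ hInf ⊤ :=
    hen.mono fun s hs => Subalgebra.smul_mem _ (sub_mem hs her) _
  -- The difference quotient is `(Δθ/Δs) e_s h + θ_r (Δe/Δs) h`. In the first term the quotient
  -- converges weakly and `e_s` uniformly; in the second the weak factor is constant and the
  -- quotient converges uniformly.
  have h1 := tendsto_fourierCoeff_mul_mul hqmem hθ' hh hen her hA hquot hθ'A (fun k => by
    refine (hasDerivAt_iff_tendsto_slope.1 (hderiv k)).congr' ?_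
    filter_upwards [hθn] with s hs
    rw [slope_def_module, ← Complex.coe_smul, Complex.ofReal_inv, smul_eq_mul,
      ← fourierCoeff_sub_of_integrable (hInf.integrable hs) (hInf.integrable hθr)]
    exact (fourierCoeff.const_mul _ _ _).symm)
    (fun u hu => (hunif u hu).filter_mono nhdsWithin_le_nhds) m
  obtain ⟨B, hB, hθB⟩ := exists_coeffBound (hInf.memLp_two hθr)
  have h2 := tendsto_fourierCoeff_mul_mul (F := fun _ => θ r) (Eventually.of_forall fun _ => hθr)
    hθr hh hsmem he' hB (Eventually.of_forall fun _ => hθB) hθB (fun k => tendsto_const_nhds)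
    hslope m
  rw [hasDerivAt_iff_tendsto_slope]
  refine (h1.add h2).congr' ?_
  filter_upwards [hθn, hen, hqmem, hsmem] with s hs hes hq hsl
  refine (fourierCoeff_add_of_integrable (hInf.integrable (mul_mem hq (mul_mem hes hh)))
    (hInf.integrable (mul_mem hθr (mul_mem hsl hh))) m).symm.trans ?_
  have h3 := fourierCoeff_sub_of_integrable (hInf.integrable (mul_mem hs (mul_mem hes hh)))
    (hInf.integrable (mul_mem hθr (mul_mem her hh))) m
  rw [slope_def_module, ← Complex.coe_smul, Complex.ofReal_inv, smul_eq_mul]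
  refine Eq.trans ?_ (congrArg (((s - r : ℝ) : ℂ)⁻¹ * ·) h3)
  rw [← fourierCoeff.const_mul]
  refine congrArg (fun u => fourierCoeff u m) (funext fun x => ?_)
  simp only [Pi.mul_apply]
  ring

end Weak

/-! ## Differential inequalities -/

section Gronwall

/-- The mean value inequality for the vector `(c_k)_{k ∈ F}` in Euclidean space. The constant is
independent of `F`, so it controls the full `ℓ²` norm although only single coefficients are
differentiable. -/
lemma sum_norm_sq_sub_le {κ : Type*} {F : Finset κ} {c c' : κ → ℝ → ℂ} {C r s : ℝ} {I : Set ℝ}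
    (hI : Convex ℝ I) (hr : r ∈ I) (hs : s ∈ I) (hC : 0 ≤ C)
    (hc : ∀ u ∈ I, ∀ k ∈ F, HasDerivAt (c k) (c' k u) u)
    (hc' : ∀ u ∈ I, ∑ k ∈ F, ‖c' k u‖ ^ 2 ≤ C ^ 2) :
    ∑ k ∈ F, ‖c k s - c k r‖ ^ 2 ≤ (C * |s - r|) ^ 2 := by
  let L := (PiLp.continuousLinearEquiv 2 ℝ fun _ : F => ℂ).symm
  have hnorm : ∀ v : F → ℂ, ‖L v‖ ^ 2 = ∑ k : F, ‖v k‖ ^ 2 := fun v =>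
    EuclideanSpace.norm_sq_eq (𝕜 := ℂ) _
  have h := hI.norm_image_sub_le_of_norm_hasDerivWithin_le (𝕜 := ℝ) (C := C)
    (f := fun u => L fun k : F => c k u) (f' := fun u => L fun k : F => c' k u)
    (fun u hu => (L.hasFDerivAt.comp_hasDerivAt u
      (hasDerivAt_pi.2 fun k : F => hc u hu k k.2)).hasDerivWithinAt)
    (fun u hu => by
      refine le_of_sq_le_sq ?_ hC
      rw [hnorm, Finset.sum_coe_sort F fun k => ‖c' k u‖ ^ 2]
      exact hc' u hu) hr hs
  rw [← map_sub] at h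
  have h2 := pow_le_pow_left₀ (norm_nonneg _) h 2
  rw [hnorm] at h2
  rw [← Finset.sum_coe_sort F fun k => ‖c k s - c k r‖ ^ 2]
  exact h2

variable {κ : Type*} {y y' : κ → ℝ → ℂ} {B K T : ℝ}

/-- Picard iteration on the estimate: a common bound `b` for all `y i` improves, after integration,
from `B (K s)^r / r!` to the next order, and these bounds tend to zero. The supremum over the
infinite index set never has to be differentiated. -/
lemma eq_zero_of_hasDerivAt_of_nonneg (hT : 0 ≤ T)
    (hd : ∀ i, ∀ s ∈ Set.Icc 0 T, HasDerivAt (y i) (y' i s) s)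
    (hB : ∀ i, ∀ s ∈ Set.Icc 0 T, ‖y i s‖ ≤ B)
    (hy' : ∀ s ∈ Set.Icc 0 T, ∀ b, (∀ i, ‖y i s‖ ≤ b) → ∀ i, ‖y' i s‖ ≤ K * b)
    (h0 : ∀ i, y i 0 = 0) (i : κ) : y i T = 0 := by
  have hB0 : 0 ≤ B := (norm_nonneg _).trans (hB i 0 ⟨le_rfl, hT⟩)
  have key : ∀ r : ℕ, ∀ i, ∀ s ∈ Set.Icc 0 T, ‖y i s‖ ≤ B * ((K * s) ^ r / r.factorial) := by
    intro r
    induction r with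
    | zero => simpa using hB
    | succ r ih =>
      intro i s hs
      refine image_norm_le_of_norm_deriv_right_le_deriv_boundary (f := y i) (f' := y' i)
        (B := fun s => B * ((K * s) ^ (r + 1) / (r + 1).factorial))
        (B' := fun s => K * (B * ((K * s) ^ r / r.factorial)))
        (fun u hu => (hd i u hu).continuousAt.continuousWithinAt)
        (fun u hu => (hd i u ⟨hu.1, hu.2.le⟩).hasDerivWithinAt) ?_ (fun u => ?_)
        (fun u hu => hy' u ⟨hu.1, hu.2.le⟩ _ (fun i => ih i u ⟨hu.1, hu.2.le⟩) i) hs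
      · simp [h0]
      · have h1 : HasDerivAt (fun s => K * s) K u := by simpa using (hasDerivAt_id u).const_mul K
        have h2 := ((h1.pow (r + 1)).div_const ((r + 1).factorial : ℝ)).const_mul B
        convert! h2 using 1
        rw [Nat.factorial_succ]
        push_cast
        field_simp
  have hlim := (FloorSemiring.tendsto_pow_div_factorial_atTop (K * T)).const_mul B
  rw [mul_zero] at hlim
  exact norm_le_zero_iff.1 (ge_of_tendsto' hlim fun r => key r i T ⟨hT, le_rfl⟩)

/-- Uniqueness for infinite systems of linear differential inequalities with a bounded
coefficient. -/
lemma eq_zero_of_hasDerivAt {I : Set ℝ} (hI : Convex ℝ I) (h0I : 0 ∈ I)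
    (hd : ∀ i, ∀ s ∈ I, HasDerivAt (y i) (y' i s) s) (hB : ∀ i, ∀ s ∈ I, ‖y i s‖ ≤ B)
    (hy' : ∀ s ∈ I, ∀ b, (∀ i, ‖y i s‖ ≤ b) → ∀ i, ‖y' i s‖ ≤ K * b)
    (h0 : ∀ i, y i 0 = 0) (hT : T ∈ I) (i : κ) : y i T = 0 := by
  have hI' := hI.ordConnected
  rcases le_total 0 T with h | h
  · have hsub : Set.Icc 0 T ⊆ I := hI'.out h0I hT
    exact eq_zero_of_hasDerivAt_of_nonneg h (fun i s hs => hd i s (hsub hs))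
      (fun i s hs => hB i s (hsub hs)) (fun s hs => hy' s (hsub hs)) h0 i
  -- Negative times are reduced to positive ones by reversing time.
  · have hsub : ∀ s ∈ Set.Icc 0 (-T), -s ∈ I := fun s hs =>
      hI'.out hT h0I ⟨by linarith [hs.2], by linarith [hs.1]⟩
    have h1 := eq_zero_of_hasDerivAt_of_nonneg (y := fun i s => y i (-s))
      (y' := fun i s => -y' i (-s)) (B := B) (K := K) (T := -T) (by linarith)
      (fun i s hs => by
        simpa [Function.comp_def] using (hd i (-s) (hsub s hs)).scomp s (hasDerivAt_neg s))
      (fun i s hs => hB i _ (hsub s hs))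
      (fun s hs b hb i => by rw [norm_neg]; exact hy' _ (hsub s hs) b hb i)
      (fun i => by simpa using h0 i) i
    simpa using h1

end Gronwall

/-! ## Positive and negative parts of matrix loops -/

section Parts

variable {n : ℕ} {S : AddSubmonoid ℤ} {M θ P Q : UnitAddCircle → Mat n}

lemma norm_fourier (k : ℤ) (x : UnitAddCircle) : ‖(fourier k x : ℂ)‖ = 1 := by
  rw [fourier_apply, Circle.norm_coe]

lemma loopCoeff_const_mul (B : Mat n) (hM : M ∈ matLoops n S) (k : ℤ) :
    loopCoeff (fun x => B * M x) k = B * loopCoeff M k := by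
  ext a b
  rw [loopCoeff_mul_apply (const_mem_matLoops (S := S) B) hM, Matrix.mul_apply]
  exact Finset.sum_congr rfl fun c _ => fourierCoeff.const_mul _ _ _

lemma loopCoeff_sub (hP : P ∈ matLoops n ⊤) (hQ : Q ∈ matLoops n ⊤) (k : ℤ) :
    loopCoeff (fun x => P x - Q x) k = loopCoeff P k - loopCoeff Q k := by
  ext a b
  exact fourierCoeff_sub_of_integrable (hInf.integrable (hP a b)) (hInf.integrable (hQ a b)) k

lemma loopCoeff_fourier_smul (j k : ℤ) (M : UnitAddCircle → Mat n) :
    loopCoeff (fun x => (fourier j x : ℂ) • M x) k = loopCoeff M (k - j) := by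
  ext a b
  exact fourierCoeff_fourier_mul (fun x => M x a b) j k

lemma loopCoeff_sum {κ : Type*} (s : Finset κ) {F : κ → UnitAddCircle → Mat n}
    (hF : ∀ i ∈ s, F i ∈ matLoops n ⊤) (k : ℤ) :
    loopCoeff (fun x => ∑ i ∈ s, F i x) k = ∑ i ∈ s, loopCoeff (F i) k := by
  ext a b
  rw [Matrix.sum_apply]
  have h : (fun x => (∑ i ∈ s, F i x) a b) = fun x => ∑ i ∈ s, F i x a b :=
    funext fun x => Matrix.sum_apply _ _ _ _
  change fourierCoeff (fun x => (∑ i ∈ s, F i x) a b) k = _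
  rw [h, fourierCoeff_sum_of_integrable s (F := fun i x => F i x a b)
    fun i hi => hInf.integrable (hF i hi a b)]
  rfl

lemma norm_loopCoeff_apply_le {C : ℝ} (h : ∀ᵐ x ∂circ, ∀ a b, ‖M x a b‖ ≤ C) (k : ℤ)
    (a b : Fin n) : ‖loopCoeff M k a b‖ ≤ C :=
  norm_fourierCoeff_le_of_bound (h.mono fun _ hx => hx a b) k

/-- The sum of the terms of index `0, …, N` of the Fourier series of `Q`. -/
def nonnegPart (Q : UnitAddCircle → Mat n) (N : ℕ) (x : UnitAddCircle) : Mat n :=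
  ∑ k ∈ Finset.range (N + 1), (fourier (k : ℤ) x : ℂ) • loopCoeff Q k

lemma nonnegPart_mem (Q : UnitAddCircle → Mat n) (N : ℕ) : nonnegPart Q N ∈ matLoops n ⊤ := by
  have h := Subalgebra.sum_mem (matLoops n ⊤) (t := Finset.range (N + 1))
    (f := fun k x => (fourier (k : ℤ) x : ℂ) • loopCoeff Q k) fun _ _ =>
      smul_mem_matLoops (fourier_mem_hInf trivial) (const_mem_matLoops _)
  convert! h using 1
  ext x : 1
  rw [Finset.sum_apply]
  rfl

lemma loopCoeff_nonnegPart_mul (Q : UnitAddCircle → Mat n) (N : ℕ) (hM : M ∈ matLoops n ⊤)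
    (m : ℤ) : loopCoeff (fun x => nonnegPart Q N x * M x) m =
      ∑ k ∈ Finset.range (N + 1), loopCoeff Q k * loopCoeff M (m - k) := by
  have h : (fun x => nonnegPart Q N x * M x) = fun x => ∑ k ∈ Finset.range (N + 1),
      (fun x => (fourier (k : ℤ) x : ℂ) • (loopCoeff Q k * M x)) x := by
    ext x : 1
    simp only [nonnegPart, Finset.sum_mul, smul_mul_assoc]
  rw [h, loopCoeff_sum]
  · exact Finset.sum_congr rfl fun k _ => by
      rw [loopCoeff_fourier_smul, loopCoeff_const_mul _ hM]
  · exact fun k _ => smul_mem_matLoops (fourier_mem_hInf trivial)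
      (mul_mem_matLoops (const_mem_matLoops _) hM)

lemma loopCoeff_nonnegPart (Q : UnitAddCircle → Mat n) (N : ℕ) (m : ℤ) :
    loopCoeff (nonnegPart Q N) m =
      if 0 ≤ m ∧ m ≤ N then loopCoeff Q m else 0 := by
  have h := loopCoeff_nonnegPart_mul Q N (const_mem_matLoops (1 : Mat n)) m
  simp only [mul_one, loopCoeff_one] at h
  refine h.trans ?_
  split_ifs with hm
  · lift m to ℕ using hm.1
    rw [Finset.sum_eq_single m]
    · simp
    · intro k _ hk
      rw [if_neg (by omega), mul_zero]
    · intro hk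
      exact absurd (Finset.mem_range.2 (by omega)) hk
  · refine Finset.sum_eq_zero fun k hk => ?_
    have := Finset.mem_range.1 hk
    rw [if_neg (by omega), mul_zero]

lemma norm_nonnegPart_apply_le {C : ℝ} (h : ∀ᵐ x ∂circ, ∀ a b, ‖Q x a b‖ ≤ C) (N : ℕ)
    (x : UnitAddCircle) (a b : Fin n) : ‖nonnegPart Q N x a b‖ ≤ (N + 1) * C := by
  rw [nonnegPart, Matrix.sum_apply]
  refine (norm_sum_le_of_le _ (n := fun _ => C) fun k _ => ?_).trans_eq (by simp)
  rw [Matrix.smul_apply, norm_smul, norm_fourier, one_mul]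
  exact norm_loopCoeff_apply_le h k a b

lemma loopCoeff_mul_of_neg (hP : P ∈ matLoops n ⊤) (hP0 : ∀ k, 0 ≤ k → loopCoeff P k = 0)
    (hθ : θ ∈ matLoops n nonposModes) (m : ℤ) :
    loopCoeff (fun x => P x * θ x) m = ∑ k ∈ Finset.Ico m 0, loopCoeff P k * loopCoeff θ (m - k) := by
  ext a b
  rw [loopCoeff_mul_apply hP hθ, Matrix.sum_apply]
  simp only [Matrix.mul_apply]
  rw [Finset.sum_comm]
  refine Finset.sum_congr rfl fun c _ => ?_
  have h := hasSum_fourierCoeff_mul (hInf.memLp_two (hθ c b)) (hInf.memLp_two (hP a c)) m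
  have h1 := h.unique (hasSum_sum_of_ne_finset_zero (s := Finset.Ico m 0) fun k hk => by
    rcases lt_or_ge k 0 with hk0 | hk0
    · have : 0 < m - k := by
        by_contra hc
        exact hk (Finset.mem_Ico.2 ⟨by omega, hk0⟩)
      rw [(mem_hInf_nonpos.1 (hθ c b)).2 _ this, zero_mul]
    · have := congrFun (congrFun (hP0 k hk0) a) c
      rw [show fourierCoeff (fun x => P x a c) k = 0 from this, mul_zero])
  simp only [mul_comm (θ _ c b)] at h1
  rw [h1]
  exact Finset.sum_congr rfl fun k _ => mul_comm _ _

lemma loopCoeff_mul_mul_apply {M₁ M₂ M₃ : UnitAddCircle → Mat n} (h₁ : M₁ ∈ matLoops n ⊤)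
    (h₂ : M₂ ∈ matLoops n ⊤) (h₃ : M₃ ∈ matLoops n ⊤) (m : ℤ) (a b : Fin n) :
    loopCoeff (fun x => M₁ x * (M₂ x * M₃ x)) m a b =
      ∑ c, ∑ d, fourierCoeff (fun x => M₁ x a c * (M₂ x c d * M₃ x d b)) m := by
  rw [loopCoeff_mul_apply h₁ (mul_mem_matLoops h₂ h₃)]
  refine Finset.sum_congr rfl fun c _ => ?_
  rw [← fourierCoeff_sum_of_integrable Finset.univ
    (F := fun d x => M₁ x a c * (M₂ x c d * M₃ x d b))
    fun d _ => hInf.integrable (mul_mem (h₁ a c) (mul_mem (h₂ c d) (h₃ d b)))]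
  simp only [Matrix.mul_apply, Finset.mul_sum]

/-- The product of the negative part of `Q` and `θ`, if `Q` has no terms of index `> N`. -/
def negPartMul (Q : UnitAddCircle → Mat n) (N : ℕ) (θ : UnitAddCircle → Mat n)
    (x : UnitAddCircle) : Mat n := (Q x - nonnegPart Q N x) * θ x

lemma negPartMul_mem (hQ : Q ∈ matLoops n ⊤) (N : ℕ) (hθ : θ ∈ matLoops n ⊤) :
    negPartMul Q N θ ∈ matLoops n ⊤ :=
  mul_mem_matLoops (Subalgebra.sub_mem _ hQ (nonnegPart_mem Q N)) hθ

/-- The right side of the hierarchy, given coefficientwise by finite sums, is recognized as the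
Fourier series of an honest bounded loop; its `ℓ²` norm can then be estimated. -/
lemma loopCoeff_negPartMul (hQ : Q ∈ matLoops n ⊤) {N : ℕ}
    (hQN : ∀ k : ℤ, N < k → loopCoeff Q k = 0) (hθ : θ ∈ matLoops n nonposModes) (m : ℤ) :
    loopCoeff (negPartMul Q N θ) m =
      ∑ k ∈ Finset.Ico m 0, loopCoeff Q k * loopCoeff θ (m - k) := by
  have hcoeff : ∀ k, loopCoeff (fun x => Q x - nonnegPart Q N x) k =
      loopCoeff Q k - if 0 ≤ k ∧ k ≤ N then loopCoeff Q k else 0 := fun k => by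
    rw [loopCoeff_sub hQ (nonnegPart_mem Q N), loopCoeff_nonnegPart]
  refine (loopCoeff_mul_of_neg (P := fun x => Q x - nonnegPart Q N x)
    (Subalgebra.sub_mem _ hQ (nonnegPart_mem Q N)) (fun k hk => ?_) hθ m).trans
    (Finset.sum_congr rfl fun k hk => ?_)
  · rw [hcoeff]
    split_ifs with h
    · exact sub_self _
    · rw [hQN k (by omega), sub_zero]
  · have := (Finset.mem_Ico.1 hk).2
    rw [hcoeff, if_neg (by omega), sub_zero]

/-- Projection to negative modes is not bounded in the supremum norm in general. Here it subtracts
only the `N + 1` terms of index `0, …, N`, each bounded by `C`. -/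
lemma norm_negPartMul_apply_le {C C' : ℝ} (h : ∀ᵐ x ∂circ, ∀ a b, ‖Q x a b‖ ≤ C)
    (h' : ∀ᵐ x ∂circ, ∀ a b, ‖θ x a b‖ ≤ C') (N : ℕ) :
    ∀ᵐ x ∂circ, ∀ a b, ‖negPartMul Q N θ x a b‖ ≤ n * (C + (N + 1) * C) * C' := by
  filter_upwards [h, h'] with x hx hx'
  exact norm_mul_apply_le (fun a b => (norm_sub_le _ _).trans
    (add_le_add (hx a b) (norm_nonnegPart_apply_le h N x a b))) hx'

lemma norm_adjugate_apply_le {A : Mat n} {C : ℝ} (hA : ∀ a b, ‖A a b‖ ≤ C) (a b : Fin n) :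
    ‖A.adjugate a b‖ ≤ n.factorial * (max C 1) ^ n := by
  rw [Matrix.adjugate_apply]
  let abv : AbsoluteValue ℂ ℝ :=
    ⟨⟨norm, norm_mul⟩, norm_nonneg, fun _ => norm_eq_zero, norm_add_le⟩
  -- A row is replaced by a unit vector, hence `max C 1` in place of `C`.
  have h := Matrix.det_le (A := A.updateRow b (Pi.single a 1)) (x := max C 1) (abv := abv)
    fun i j => by
      change ‖A.updateRow b (Pi.single a 1) i j‖ ≤ _
      rw [Matrix.updateRow_apply]
      split_ifs
      · rw [Pi.single_apply]
        split_ifs <;> simp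
      · exact (hA i j).trans (le_max_left _ _)
  rwa [nsmul_eq_mul, Fintype.card_fin] at h

lemma norm_inv_apply_le (hdet : ∀ᵐ x ∂circ, (θ x).det = 1) {C : ℝ}
    (h : ∀ᵐ x ∂circ, ∀ a b, ‖θ x a b‖ ≤ C) :
    ∀ᵐ x ∂circ, ∀ a b, ‖(θ x)⁻¹ a b‖ ≤ n.factorial * (max C 1) ^ n := by
  filter_upwards [h, inv_ae_eq_adjugate hdet] with x hx hx' a b
  rw [← hx']
  exact norm_adjugate_apply_le hx a b

end Parts

/-! ## Evolution of the product `Θ g⁻¹ γ` -/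

section Dressing

variable {ι : Type*} {n : ℕ}

/-- Solutions of the dressing equations, with values in the loops of determinant one without terms
of positive index. -/
structure IsUnimodularSolution (Λ : ι → LoopPoly n) (D : Set (Times Λ))
    (Θ : Times Λ → UnitAddCircle → Mat n) : Prop where
  isOpen : IsOpen D
  lie_eq_zero : ∀ j k, ⁅Λ j, Λ k⁆ = 0
  nonneg : ∀ j, (fun x => evalAt (Λ j) (zed x)) ∈ matLoops n nonnegModes
  mem : ∀ t ∈ D, Θ t ∈ matLoops n nonposModes
  det : ∀ t ∈ D, ∀ᵐ x ∂circ, (Θ t x).det = 1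
  continuousOn : ∀ (m : ℤ) (a b : Fin n), ContinuousOn (fun t => loopCoeff (Θ t) m a b) D
  locally_bounded : ∀ t ∈ D, ∃ C : ℝ, ∀ᶠ t' in 𝓝[D] t, ∀ a b, ∀ᵐ x ∂circ, ‖Θ t' x a b‖ ≤ C
  equation : ∀ t ∈ D, ∀ (j : ι) (m : ℤ) (a b : Fin n),
    HasDerivAt (fun s : ℝ => loopCoeff (Θ (t + Times.single j s)) m a b)
      ((∑ k ∈ Finset.Ico m 0,
        loopCoeff (fun x => Θ t x * evalAt (Λ j) (zed x) * (Θ t x)⁻¹) k *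
          loopCoeff (Θ t) (m - k)) a b) 0

/-- The loop `Θ Λ_j Θ⁻¹`. -/
def conjLoop {Λ : ι → LoopPoly n} (Θ : Times Λ → UnitAddCircle → Mat n) (t : Times Λ) (j : ι)
    (x : UnitAddCircle) : Mat n := Θ t x * evalAt (Λ j) (zed x) * (Θ t x)⁻¹

/-- The loop `Θ g⁻¹ γ`. -/
def dressedLoop {Λ : ι → LoopPoly n} (Θ : Times Λ → UnitAddCircle → Mat n)
    (γ : UnitAddCircle → Mat n) (t : Times Λ) (x : UnitAddCircle) : Mat n :=
  Θ t x * (gInv t x * γ x)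

namespace IsUnimodularSolution

variable {Λ : ι → LoopPoly n} {D : Set (Times Λ)} {Θ : Times Λ → UnitAddCircle → Mat n}
  {γ : UnitAddCircle → Mat n}

lemma mem_top (h : IsUnimodularSolution Λ D Θ) {t : Times Λ} (ht : t ∈ D) : Θ t ∈ matLoops n ⊤ := matLoops_mono le_top (h.mem t ht)

lemma gInv_mem_top (h : IsUnimodularSolution Λ D Θ) (t : Times Λ) : gInv t ∈ matLoops n ⊤ :=
  matLoops_mono le_top (gInv_mem h.nonneg t)

lemma conjLoop_mem (h : IsUnimodularSolution Λ D Θ) {t : Times Λ} (ht : t ∈ D) (j : ι) : conjLoop Θ t j ∈ matLoops n ⊤ :=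
  mul_mem_matLoops (mul_mem_matLoops (h.mem_top ht) (matLoops_mono le_top (h.nonneg j)))
    (inv_mem_matLoops (h.mem_top ht) (h.det t ht))

/-- The modes of `Λ_j` are bounded above, and conjugation by loops with nonpositive modes does not
raise them; so `N` serves all `t` at once. -/
lemma exists_loopCoeff_conjLoop_eq_zero (h : IsUnimodularSolution Λ D Θ) (j : ι) :
    ∃ N : ℕ, ∀ t ∈ D, ∀ k : ℤ, N < k → loopCoeff (conjLoop Θ t j) k = 0 := by
  obtain ⟨N, hN⟩ := exists_modes_le (Λ j)
  refine ⟨N, fun t ht k hk => ?_⟩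
  have h1 : (fun x => (fourier (-(N : ℤ)) x : ℂ) • conjLoop Θ t j x) ∈ matLoops n nonposModes := by
    have h2 := mul_mem_matLoops (mul_mem_matLoops (h.mem t ht) hN)
      (inv_mem_matLoops (h.mem t ht) (h.det t ht))
    simpa only [conjLoop, mul_smul_comm, smul_mul_assoc] using h2
  have h3 : loopCoeff (fun x => (fourier (-(N : ℤ)) x : ℂ) • conjLoop Θ t j x) (k - N) = 0 := by
    ext a b
    exact (mem_hInf_nonpos.1 (h1 a b)).2 _ (by omega)
  rw [loopCoeff_fourier_smul] at h3
  simpa using h3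

lemma norm_conjLoop_apply_le {t : Times Λ} (hdet : ∀ᵐ x ∂circ, (Θ t x).det = 1) (j : ι) {C : ℝ}
    (hC : ∀ᵐ x ∂circ, ∀ a b, ‖Θ t x a b‖ ≤ C) :
    ∀ᵐ x ∂circ, ∀ a b, ‖conjLoop Θ t j x a b‖ ≤
      n * (n * C * weight 1 (Λ j)) * (n.factorial * (max C 1) ^ n) := by
  filter_upwards [hC, norm_inv_apply_le hdet hC] with x hx hx'
  exact norm_mul_apply_le (norm_mul_apply_le hx (norm_evalAt_le _ _)) hx'

lemma eventually_mem (h : IsUnimodularSolution Λ D Θ) {t : Times Λ} (ht : t ∈ D) (j : ι) :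
    ∀ᶠ s : ℝ in 𝓝 0, t + Times.single j s ∈ D := by
  have h1 : Continuous fun s : ℝ => t + (Times.single j s : Times Λ) :=
    continuous_const.add (Times.continuous_single j)
  refine (h1.tendsto 0).eventually ?_
  rw [Times.single_zero, add_zero]
  exact h.isOpen.mem_nhds ht

lemma exists_eventually_bound (h : IsUnimodularSolution Λ D Θ) {t : Times Λ} (ht : t ∈ D) :
    ∃ C : ℝ, 0 ≤ C ∧ ∀ᶠ t' in 𝓝 t, t' ∈ D ∧ ∀ᵐ x ∂circ, ∀ a b, ‖Θ t' x a b‖ ≤ C := by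
  obtain ⟨C, hC⟩ := h.locally_bounded t ht
  rw [h.isOpen.nhdsWithin_eq ht] at hC
  refine ⟨|C|, abs_nonneg C, ?_⟩
  filter_upwards [hC, h.isOpen.mem_nhds ht] with t' ht' htD
  refine ⟨htD, ?_⟩
  simp only [ae_all_iff]
  exact fun a b => (ht' a b).mono fun x hx => hx.trans (le_abs_self C)

/-- The hierarchy only speaks of the derivative at the base point; translation along the `j`-th time
turns it into an ordinary differential equation on an interval. -/
lemma hasDerivAt_loopCoeff (h : IsUnimodularSolution Λ D Θ) {t : Times Λ} {j : ι} {N : ℕ}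
    (hN : ∀ t ∈ D, ∀ k : ℤ, N < k → loopCoeff (conjLoop Θ t j) k = 0) {s : ℝ}
    (ht : t + Times.single j s ∈ D) (m : ℤ) (a b : Fin n) :
    HasDerivAt (fun s : ℝ => loopCoeff (Θ (t + Times.single j s)) m a b)
      (loopCoeff (negPartMul (conjLoop Θ (t + Times.single j s) j) N
        (Θ (t + Times.single j s))) m a b) s := by
  rw [loopCoeff_negPartMul (h.conjLoop_mem ht j) (hN _ ht) (h.mem _ ht)]
  have h1 := h.equation _ ht j m a b
  rw [← sub_self s] at h1
  have h2 := h1.comp_sub_const s s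
  simp only [add_assoc, ← Times.single_add, add_sub_cancel] at h2
  exact h2

/-- Near `t` the derivative `(Θ Λ_j Θ⁻¹)_{<0} Θ` is bounded uniformly, so the mean value inequality
bounds the difference quotients in `ℓ²`. This upgrades coefficientwise differentiability of `Θ` to
weak differentiability. The terms `s - 0` and `Times.single j 0` fit the product rule at `r = 0`. -/
lemma exists_coeffBound_quotient (h : IsUnimodularSolution Λ D Θ) {t : Times Λ} (ht : t ∈ D) {j : ι} {N : ℕ}
    (hN : ∀ t ∈ D, ∀ k : ℤ, N < k → loopCoeff (conjLoop Θ t j) k = 0) :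
    ∃ A : ℝ, 0 ≤ A ∧ ∀ a b, CoeffBound
        (fun x => negPartMul (conjLoop Θ t j) N (Θ t) x a b) A ∧
      ∀ᶠ s : ℝ in 𝓝[≠] 0, CoeffBound (fun x => ((s - 0 : ℝ) : ℂ)⁻¹ *
        (Θ (t + Times.single j s) x a b - Θ (t + Times.single j 0) x a b)) A := by
  obtain ⟨C, hC0, hC⟩ := h.exists_eventually_bound ht
  have hcont : Continuous fun s : ℝ => t + (Times.single j s : Times Λ) :=
    continuous_const.add (Times.continuous_single j)
  have hev := (hcont.tendsto 0).eventually
    (by rw [Times.single_zero, add_zero]; exact hC)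
  obtain ⟨δ, hδ, hball⟩ := Metric.eventually_nhds_iff_ball.1 hev
  set q := n * (n * C * weight 1 (Λ j)) * (n.factorial * (max C 1) ^ n) with hq
  have hq0 : 0 ≤ q := by have := weight_nonneg 1 (Λ j); positivity
  have hmem : ∀ s ∈ Metric.ball (0 : ℝ) δ, ∀ a b,
      (fun x => negPartMul (conjLoop Θ (t + Times.single j s) j) N
        (Θ (t + Times.single j s)) x a b) ∈ hInf ⊤ := fun s hs a b =>
    negPartMul_mem (h.conjLoop_mem (hball s hs).1 j) N (h.mem_top (hball s hs).1) a b
  have hbd : ∀ s ∈ Metric.ball (0 : ℝ) δ, ∀ a b, CoeffBound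
      (fun x => negPartMul (conjLoop Θ (t + Times.single j s) j) N
        (Θ (t + Times.single j s)) x a b) (n * (q + (N + 1) * q) * C) := fun s hs a b =>
    coeffBound_of_bound (hInf.memLp_two (hmem s hs a b)) (by positivity)
      ((norm_negPartMul_apply_le (norm_conjLoop_apply_le (h.det _ (hball s hs).1) j
        (hball s hs).2) (hball s hs).2 N).mono fun x hx => hx a b)
  refine ⟨n * (q + (N + 1) * q) * C, by positivity, fun a b => ⟨?_, ?_⟩⟩
  · have := hbd 0 (Metric.mem_ball_self hδ) a b
    rwa [Times.single_zero, add_zero] at this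
  · filter_upwards [nhdsWithin_le_nhds (Metric.ball_mem_nhds (0 : ℝ) hδ), self_mem_nhdsWithin]
      with s hs hs0 F
    have hs1 : |s| ≠ 0 := abs_ne_zero.2 hs0
    have h1 := sum_norm_sq_sub_le (F := F) (convex_ball (0 : ℝ) δ) (Metric.mem_ball_self hδ) hs
      (C := n * (q + (N + 1) * q) * C) (by positivity)
      (c := fun k s => loopCoeff (Θ (t + Times.single j s)) k a b)
      (fun u hu k _ => h.hasDerivAt_loopCoeff hN (hball u hu).1 k a b)
      (fun u hu => hbd u hu a b F)
    have h2 : ∀ k, ‖fourierCoeff (fun x => ((s - 0 : ℝ) : ℂ)⁻¹ *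
        (Θ (t + Times.single j s) x a b - Θ (t + Times.single j 0) x a b)) k‖ ^ 2 =
        (|s| ^ 2)⁻¹ * ‖loopCoeff (Θ (t + Times.single j s)) k a b -
          loopCoeff (Θ (t + Times.single j 0)) k a b‖ ^ 2 := fun k => by
      rw [fourierCoeff.const_mul, norm_mul, mul_pow, sub_zero, norm_inv, Complex.norm_real,
        Real.norm_eq_abs, inv_pow]
      congr 3
      exact fourierCoeff_sub_of_integrable
        (hInf.integrable (h.mem_top (hball s hs).1 a b))
        (hInf.integrable (h.mem_top (hball 0 (Metric.mem_ball_self hδ)).1 a b)) k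
    simp only [h2]
    rw [← Finset.mul_sum, inv_mul_le_iff₀ (by positivity)]
    refine h1.trans_eq ?_
    rw [sub_zero]
    ring

lemma dressedLoop_mem (h : IsUnimodularSolution Λ D Θ) {t : Times Λ} (ht : t ∈ D) (hγ : γ ∈ matLoops n ⊤) :
    dressedLoop Θ γ t ∈ matLoops n ⊤ :=
  mul_mem_matLoops (h.mem_top ht) (mul_mem_matLoops (h.gInv_mem_top t) hγ)

/-- `∂(Θ g⁻¹ γ)/∂t_j = -(Θ Λ_j Θ⁻¹)_{≥ 0} Θ g⁻¹ γ`. -/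
lemma hasDerivAt_dressedLoop (h : IsUnimodularSolution Λ D Θ) (hγ : γ ∈ matLoops n ⊤) {t : Times Λ} (ht : t ∈ D) {j : ι} {N : ℕ}
    (hN : ∀ t ∈ D, ∀ k : ℤ, N < k → loopCoeff (conjLoop Θ t j) k = 0) (m : ℤ) (a b : Fin n) :
    HasDerivAt (fun s : ℝ => loopCoeff (dressedLoop Θ γ (t + Times.single j s)) m a b)
      (-(∑ k ∈ Finset.range (N + 1), loopCoeff (conjLoop Θ t j) k *
        loopCoeff (dressedLoop Θ γ t) (m - k)) a b) 0 := by
  have h0 : t + Times.single j 0 = t := by rw [Times.single_zero, add_zero]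
  have ht0 : t + Times.single j 0 ∈ D := by rwa [h0]
  obtain ⟨A, hA0, hA⟩ := h.exists_coeffBound_quotient ht hN
  have hev := h.eventually_mem ht j
  have hdΘ := negPartMul_mem (h.conjLoop_mem ht j) N (h.mem_top ht)
  have hdg : (fun x => -evalAt (Λ j) (zed x) * gInv t x) ∈ matLoops n ⊤ :=
    mul_mem_matLoops (Subalgebra.neg_mem _ (matLoops_mono le_top (h.nonneg j))) (h.gInv_mem_top t)
  have hcont : Tendsto (fun s : ℝ => t + (Times.single j s : Times Λ)) (𝓝 0) (𝓝 t) := by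
    have h1 : Continuous fun s : ℝ => t + (Times.single j s : Times Λ) :=
      continuous_const.add (Times.continuous_single j)
    simpa only [h0] using h1.tendsto 0
  have key : ∀ c d, HasDerivAt (fun s : ℝ => fourierCoeff (fun x =>
      Θ (t + Times.single j s) x a c * (gInv (t + Times.single j s) x c d * γ x d b)) m)
      (fourierCoeff (fun x => negPartMul (conjLoop Θ t j) N (Θ t) x a c *
          (gInv t x c d * γ x d b)) m +
        fourierCoeff (fun x => Θ t x a c *
          ((-evalAt (Λ j) (zed x) * gInv t x) c d * γ x d b)) m) 0 := fun c d => by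
    have h1 := hasDerivAt_fourierCoeff_mul_mul (r := 0) (h := fun x => γ x d b)
      (θ := fun s x => Θ (t + Times.single j s) x a c)
      (θ' := fun x => negPartMul (conjLoop Θ t j) N (Θ t) x a c)
      (e := fun s x => gInv (t + Times.single j s) x c d)
      (e' := fun x => (-evalAt (Λ j) (zed x) * gInv t x) c d)
      (hev.mono fun s hs => h.mem_top hs a c) (hdΘ a c)
      (Eventually.of_forall fun s => h.gInv_mem_top _ c d) (hdg c d) (hγ d b) hA0
      (hA a c).2 (hA a c).1
      (fun k => by
        have h2 := h.hasDerivAt_loopCoeff hN ht0 k a c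
        rwa [h0] at h2)
      (by
        simp only [h0]
        exact fun u hu => hcont.eventually (tendstoUniformly_gInv h.lie_eq_zero t c d u hu))
      (by
        simp only [h0, sub_zero]
        exact tendstoUniformly_slope_gInv h.lie_eq_zero t j c d) m
    simpa only [h0] using h1
  have hsum := HasDerivAt.fun_sum fun c (_ : c ∈ Finset.univ) =>
    HasDerivAt.fun_sum fun d (_ : d ∈ Finset.univ) => key c d
  simp only [Finset.sum_add_distrib] at hsum
  rw [← loopCoeff_mul_mul_apply hdΘ (h.gInv_mem_top t) hγ,
    ← loopCoeff_mul_mul_apply (h.mem_top ht) hdg hγ] at hsum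
  have hval : loopCoeff (fun x => negPartMul (conjLoop Θ t j) N (Θ t) x * (gInv t x * γ x)) m a b +
      loopCoeff (fun x => Θ t x * (-evalAt (Λ j) (zed x) * gInv t x * γ x)) m a b =
      -(∑ k ∈ Finset.range (N + 1), loopCoeff (conjLoop Θ t j) k *
        loopCoeff (dressedLoop Θ γ t) (m - k)) a b := by
    rw [← loopCoeff_nonnegPart_mul _ _ (h.dressedLoop_mem ht hγ)]
    refine (fourierCoeff_add_of_integrable
      (hInf.integrable (mul_mem_matLoops hdΘ (mul_mem_matLoops (h.gInv_mem_top t) hγ) a b))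
      (hInf.integrable (mul_mem_matLoops (h.mem_top ht) (mul_mem_matLoops hdg hγ) a b))
      m).symm.trans ?_
    refine Eq.trans (fourierCoeff_congr ?_ m) ((fourierCoeff.const_mul (fun x =>
      (nonnegPart (conjLoop Θ t j) N x * dressedLoop Θ γ t x) a b) (-1) m).trans
        (neg_one_mul _))
    filter_upwards [h.det t ht] with x hx
    have hinv : conjLoop Θ t j x * Θ t x = Θ t x * evalAt (Λ j) (zed x) := by
      rw [conjLoop, mul_assoc, Matrix.nonsing_inv_mul _ (by rw [hx]; exact isUnit_one), mul_one]
    -- Since `Q Θ = Θ Λ_j`, the term from `∂g⁻¹` cancels `Q Θ g⁻¹ γ` and leaves minus the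
    -- nonnegative part.
    have hmat : negPartMul (conjLoop Θ t j) N (Θ t) x * (gInv t x * γ x) +
        Θ t x * (-evalAt (Λ j) (zed x) * gInv t x * γ x) =
        -(nonnegPart (conjLoop Θ t j) N x * dressedLoop Θ γ t x) := by
      rw [negPartMul, sub_mul, hinv, dressedLoop]
      noncomm_ring
    rw [neg_one_mul]
    exact congrFun (congrFun hmat a) b
  rw [hval] at hsum
  refine hsum.congr_of_eventuallyEq ?_
  filter_upwards [hev] with s hs
  exact loopCoeff_mul_mul_apply (h.mem_top hs) (h.gInv_mem_top _) hγ m a b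

/-- `Θ` is locally bounded with continuous coefficients, hence weakly continuous, while `g⁻¹` is
continuous uniformly in `z`. -/
lemma continuousAt_dressedLoop (h : IsUnimodularSolution Λ D Θ) (hγ : γ ∈ matLoops n ⊤)
    {t : Times Λ} (ht : t ∈ D) (m : ℤ) (a b : Fin n) :
    Tendsto (fun t => loopCoeff (dressedLoop Θ γ t) m a b) (𝓝 t)
      (𝓝 (loopCoeff (dressedLoop Θ γ t) m a b)) := by
  obtain ⟨C, hC0, hC⟩ := h.exists_eventually_bound ht
  have hD : ∀ᶠ t' in 𝓝 t, t' ∈ D := h.isOpen.mem_nhds ht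
  have hbound : ∀ c, ∀ᶠ t' in 𝓝 t, CoeffBound (fun x => Θ t' x a c) C := fun c =>
    hC.mono fun t' ht' => coeffBound_of_bound (hInf.memLp_two (h.mem_top ht'.1 a c)) hC0
      (ht'.2.mono fun x hx => hx a c)
  have key := tendsto_finsetSum (Finset.univ : Finset (Fin n)) fun c _ =>
    tendsto_finsetSum (Finset.univ : Finset (Fin n)) fun d _ =>
      tendsto_fourierCoeff_mul_mul (l := 𝓝 t) (F := fun t x => Θ t x a c)
        (e := fun t x => gInv t x c d) (h := fun x => γ x d b)
        (hD.mono fun t' ht' => h.mem_top ht' a c) (h.mem_top ht a c) (hγ d b)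
        (Eventually.of_forall fun t' => h.gInv_mem_top t' c d) (h.gInv_mem_top t c d) hC0
        (hbound c) (hbound c).self_of_nhds
        (fun k => (h.continuousOn k a c).continuousAt (h.isOpen.mem_nhds ht))
        (tendstoUniformly_gInv h.lie_eq_zero t c d) m
  rw [← loopCoeff_mul_mul_apply (h.mem_top ht) (h.gInv_mem_top t) hγ] at key
  refine key.congr' ?_
  filter_upwards [hD] with t' ht'
  exact (loopCoeff_mul_mul_apply (h.mem_top ht') (h.gInv_mem_top t') hγ m a b).symm

/-- For `m < 0` and `k ≥ 0` the index `m - k` is again negative, so the negative coefficients form a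
closed linear system along the segment. The uniform bounds on `V` make its coefficients bounded, and
uniqueness applies. -/
lemma loopCoeff_dressedLoop_eq_zero_of_segment (h : IsUnimodularSolution Λ D Θ)
    (hγ : γ ∈ matLoops n ⊤) {V : Set (Times Λ)} (hVD : V ⊆ D) (hV : Convex ℝ V) {C R : ℝ}
    (hC : ∀ t ∈ V, ∀ᵐ x ∂circ, ∀ a b, ‖Θ t x a b‖ ≤ C)
    (hR : ∀ t ∈ V, timesSeminorm Λ 1 t ≤ R) {t : Times Λ} {j : ι} {s : ℝ} (ht : t ∈ V)
    (hs : t + Times.single j s ∈ V) (h0 : ∀ m < 0, loopCoeff (dressedLoop Θ γ t) m = 0) :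
    ∀ m < 0, loopCoeff (dressedLoop Θ γ (t + Times.single j s)) m = 0 := by
  classical
  obtain ⟨N, hN⟩ := h.exists_loopCoeff_conjLoop_eq_zero j
  obtain ⟨C', hC'0, hC'⟩ := exists_ae_bound_loop hγ
  set q := n * (n * C * weight 1 (Λ j)) * (n.factorial * (max C 1) ^ n) with hq
  have hI : Convex ℝ {u : ℝ | t + Times.single j u ∈ V} := by
    intro x hx y hy c d hc hd hcd
    have h1 := hV hx hy hc hd hcd
    change t + Times.single j (c * x + d * y) ∈ V
    refine Set.mem_of_eq_of_mem (Times.ext fun k => ?_) h1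
    change (t + Times.single j (c * x + d * y)).coord k =
      c * (t + Times.single j x).coord k + d * (t + Times.single j y).coord k
    simp only [Times.coord_add, Times.coord_single]
    split_ifs
    · linear_combination -(t.coord k) * hcd
    · linear_combination -(t.coord k) * hcd
  have h00 : t + Times.single j 0 = t := by rw [Times.single_zero, add_zero]
  -- `B` is the a priori bound for the entries of `Θ g⁻¹ γ`; `K` counts `N + 1` matrix products,
  -- each with a factor `Θ Λ_j Θ⁻¹` bounded by `q`.
  have key := eq_zero_of_hasDerivAt (κ := {m : ℤ // m < 0} × Fin n × Fin n)
    (y := fun i u => loopCoeff (dressedLoop Θ γ (t + Times.single j u)) i.1 i.2.1 i.2.2)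
    (y' := fun i u => -(∑ k ∈ Finset.range (N + 1),
      loopCoeff (conjLoop Θ (t + Times.single j u) j) k *
        loopCoeff (dressedLoop Θ γ (t + Times.single j u)) (i.1 - k)) i.2.1 i.2.2)
    (B := n * C * (n * Real.exp (n * R) * C')) (K := (N + 1) * (n * q)) hI
    (by change t + Times.single j 0 ∈ V; rwa [h00])
    (fun i u hu => by
      have h1 := h.hasDerivAt_dressedLoop hγ (hVD hu) hN i.1 i.2.1 i.2.2
      rw [← sub_self u] at h1
      have h2 := h1.comp_sub_const u u
      simp only [add_assoc, ← Times.single_add, add_sub_cancel] at h2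
      exact h2)
    (fun i u hu => by
      refine norm_loopCoeff_apply_le ?_ _ _ _
      filter_upwards [hC _ hu, hC'] with x hx hx'
      refine norm_mul_apply_le hx (norm_mul_apply_le (fun a b => ?_) hx')
      refine (norm_gInv_apply_le _ x a b).trans (Real.exp_le_exp.2 ?_)
      exact mul_le_mul_of_nonneg_left (hR _ hu) (Nat.cast_nonneg n))
    (fun u hu b hb i => by
      rw [norm_neg, Matrix.sum_apply]
      refine (norm_sum_le_of_le _ (n := fun _ => n * q * b) fun k _ => ?_).trans_eq ?_
      · refine norm_mul_apply_le (fun c d => ?_) (fun c d => hb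
          (⟨i.1 - k, by have := i.1.2; omega⟩, c, d)) _ _
        exact norm_loopCoeff_apply_le
          (norm_conjLoop_apply_le (h.det _ (hVD hu)) j (hC _ hu)) _ _ _
      · simp [mul_assoc])
    (fun i => by
      rw [h00, h0 _ i.1.2]
      rfl) hs
  intro m hm
  ext a b
  exact key (⟨m, hm⟩, a, b)

lemma eventually_loopCoeff_dressedLoop_eq_zero (h : IsUnimodularSolution Λ D Θ)
    (hγ : γ ∈ matLoops n ⊤) {t₀ : Times Λ} (ht₀ : t₀ ∈ D)
    (h0 : ∀ m < 0, loopCoeff (dressedLoop Θ γ t₀) m = 0) :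
    ∀ᶠ t in 𝓝 t₀, ∀ m < 0, loopCoeff (dressedLoop Θ γ t) m = 0 := by
  classical
  obtain ⟨C, hC0, hC⟩ := h.exists_eventually_bound ht₀
  have hp : ∀ᶠ t in 𝓝 t₀, timesSeminorm Λ 1 t < timesSeminorm Λ 1 t₀ + 1 :=
    ((withSeminorms_times Λ).continuous_seminorm 1).continuousAt.eventually
      (gt_mem_nhds (lt_add_one _))
  -- A seminorm ball on which `Θ` and `g⁻¹` are uniformly bounded. It is convex, for the segments,
  -- and solid, so that the finite truncations of `t - t₀` stay inside.
  obtain ⟨S, r, hr, hV⟩ := ((withSeminorms_times Λ).mem_nhds_iff t₀ _).1 (hC.and hp)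
  filter_upwards [((withSeminorms_times Λ).mem_nhds_iff t₀ _).2 ⟨S, r, hr, subset_rfl⟩] with t ht
  have hmem : ∀ F, t₀ + (t - t₀).trunc F ∈ (S.sup (timesSeminorm Λ)).ball t₀ r := fun F => by
    rw [Seminorm.mem_ball, add_sub_cancel_left]
    refine sup_timesSeminorm_lt_of_abs_le S (u := t - t₀) (fun j => ?_) ht
    rw [Times.coord_trunc]
    split_ifs
    · exact le_rfl
    · simp
  have key : ∀ F, ∀ m < 0, loopCoeff (dressedLoop Θ γ (t₀ + (t - t₀).trunc F)) m = 0 := by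
    intro F
    induction F using Finset.induction_on with
    | empty =>
      have h1 : (t - t₀).trunc ∅ = 0 := Times.ext fun j => by
        rw [Times.coord_trunc, if_neg (Finset.notMem_empty j), Times.coord_zero]
      rwa [h1, add_zero]
    | insert j F hj ih =>
      have h1 : t₀ + (t - t₀).trunc (insert j F) =
          t₀ + (t - t₀).trunc F + Times.single j ((t - t₀).coord j) := by
        rw [add_assoc]
        refine congrArg (t₀ + ·) (Times.ext fun k => ?_)
        rw [Times.coord_add, Times.coord_trunc, Times.coord_trunc, Times.coord_single]
        by_cases hk : k = j
        · subst hk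
          simp [hj]
        · simp [hk]
      rw [h1]
      refine h.loopCoeff_dressedLoop_eq_zero_of_segment hγ
        (V := (S.sup (timesSeminorm Λ)).ball t₀ r) (fun u hu => (hV hu).1.1)
        (Seminorm.convex_ball _ _ _) (fun u hu => (hV hu).1.2) (fun u hu => (hV hu).2.le)
        (hmem F) ?_ ih
      rw [← h1]
      exact hmem _
  intro m hm
  ext a b
  -- The truncated points, reached by changing one time after another, converge to `t`; continuity
  -- of the coefficients concludes.
  have hlim : Tendsto (fun F => t₀ + (t - t₀).trunc F) atTop (𝓝 t) := by
    simpa using (Times.tendsto_trunc (t - t₀)).const_add t₀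
  have h1 := (h.continuousAt_dressedLoop hγ (hV ht).1.1 m a b).comp hlim
  refine tendsto_nhds_unique h1 (tendsto_const_nhds.congr fun F => ?_)
  rw [Function.comp_apply, key F m hm]

/-- If `Θ g⁻¹ γ` has no negative modes at one point, it has none at all. -/
lemma loopCoeff_dressedLoop_eq_zero (h : IsUnimodularSolution Λ D Θ) (hD : IsPreconnected D)
    (hγ : γ ∈ matLoops n ⊤) {t₀ : Times Λ} (ht₀ : t₀ ∈ D)
    (h0 : ∀ m < 0, loopCoeff (dressedLoop Θ γ t₀) m = 0) {t : Times Λ} (ht : t ∈ D) {m : ℤ}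
    (hm : m < 0) : loopCoeff (dressedLoop Θ γ t) m = 0 := by
  -- The set where the negative modes vanish is open by the local result and relatively closed in
  -- `D` by continuity.
  have hsub : D ⊆ {t | t ∈ D ∧ ∀ m < 0, loopCoeff (dressedLoop Θ γ t) m = 0} := by
    refine hD.subset_of_closure_inter_subset ?_ ⟨t₀, ht₀, ht₀, h0⟩ ?_
    · rw [isOpen_iff_mem_nhds]
      rintro u ⟨hu, hu0⟩
      filter_upwards [h.isOpen.mem_nhds hu, h.eventually_loopCoeff_dressedLoop_eq_zero hγ hu hu0]
        with v hv hv0 using ⟨hv, hv0⟩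
    · rintro u ⟨hu, huD⟩
      refine ⟨huD, fun m hm => ?_⟩
      ext a b
      by_contra hne
      refine (mem_closure_iff_frequently.1 hu) ?_
      filter_upwards [(h.continuousAt_dressedLoop hγ huD m a b).eventually_ne hne] with v hv hv'
      exact hv (by rw [hv'.2 m hm])
  exact (hsub ht).2 m hm

end IsUnimodularSolution

end Dressing

/-! ## Baker functions -/

section Baker

variable {n : ℕ}

lemma loopImage_loopImage (γ δ : matLoops n ⊤) (W : Submodule ℂ (Hil n)) :
    loopImage γ.1 (loopImage δ.1 W) = loopImage (γ * δ).1 W := by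
  ext v
  rw [mem_loopImage, mem_loopImage]
  constructor
  · rintro ⟨u, hu, rfl⟩
    obtain ⟨u', hu', rfl⟩ := (mem_loopImage δ).1 hu
    exact ⟨u', hu', (mulOp_mul _ _ _).symm⟩
  · rintro ⟨u, hu, rfl⟩
    exact ⟨_, (mem_loopImage δ).2 ⟨u, hu, rfl⟩, mulOp_mul _ _ _⟩

/-- `ψ` and its inverse `φ` both preserve `H₊`, so `ψ H₊ = H₊` and a right factor `ψ` can be
dropped. -/
lemma loopImage_hardyPlus_eq {α β ψ φ : matLoops n ⊤} (hψ : ψ.1 ∈ matLoops n nonnegModes)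
    (hφ : φ.1 ∈ matLoops n nonnegModes) (h : ∀ᵐ x ∂circ, ψ.1 x * φ.1 x = 1)
    (hα : ∀ᵐ x ∂circ, α.1 x = β.1 x * ψ.1 x) :
    loopImage α.1 (hardyPlus n) = loopImage β.1 (hardyPlus n) := by
  have hα' : ∀ u, mulOp α u = mulOp β (mulOp ψ u) := fun u => by
    have h1 : α.1 =ᵐ[circ] (β * ψ).1 := hα
    rw [← mulOp_mul, mulOp_congr h1]
  ext v
  rw [mem_loopImage, mem_loopImage]
  constructor
  · rintro ⟨u, hu, hv⟩
    exact ⟨mulOp ψ u, mulOp_mem_hardyPlus hψ hu, hv.trans (hα' u)⟩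
  · rintro ⟨u, hu, hv⟩
    refine ⟨mulOp φ u, mulOp_mem_hardyPlus hφ hu, hv.trans ?_⟩
    rw [hα' (mulOp φ u)]
    exact congrArg (mulOp β) (mulOp_mulOp_of_mul_eq_one h u).symm

lemma coeFn_constVec (α : Fin n) :
    constVec n α =ᵐ[circ] fun _ => EuclideanSpace.single α (1 : ℂ) := MemLp.coeFn_toLp _

lemma coeFn_mulOp_constVec (γ : matLoops n ⊤) (α : Fin n) :
    mulOp γ (constVec n α) =ᵐ[circ] column γ.1 α := by
  filter_upwards [coeFn_mulOp γ (constVec n α), coeFn_constVec α] with x h1 h2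
  rw [h1, h2]
  ext i
  rw [act_apply]
  simp [column]

lemma constVec_mem_hardyPlus (α : Fin n) : constVec n α ∈ hardyPlus n := by
  rw [mem_hardyPlus]
  intro i k hk
  have h : (fun x => constVec n α x i) =ᵐ[circ] fun x => (1 : Mat n) i α := by
    filter_upwards [coeFn_constVec α] with x hx
    rw [hx]
    simp [Matrix.one_apply]
  rw [fourierCoeff_congr h]
  have h1 := congrFun (congrFun (loopCoeff_one (n := n) k) i) α
  rw [if_neg hk.ne] at h1
  exact h1

/-- A column of such a loop is `e_α` plus strictly negative modes. -/
lemma pPlus_mulOp_constVec {γ : matLoops n ⊤} (hγ : γ.1 ∈ matLoops n nonposModes)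
    (h0 : loopCoeff γ.1 0 = 1) (α : Fin n) :
    (pPlus n (mulOp γ (constVec n α)) : Hil n) = constVec n α := by
  refine pPlus_eq (constVec_mem_hardyPlus α) ?_
  rw [mem_hardyMinus]
  intro i k hk
  have h : (fun x => (mulOp γ (constVec n α) - constVec n α : Hil n) x i) =ᵐ[circ]
      fun x => (γ.1 x - 1) i α := by
    filter_upwards [coeFn_mulOp_constVec γ α, coeFn_constVec α,
      Lp.coeFn_sub (mulOp γ (constVec n α)) (constVec n α)] with x h1 h2 h3
    rw [h3, Pi.sub_apply, h1, h2]
    simp [column, Matrix.one_apply]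
  rw [fourierCoeff_congr h]
  have h1 := congrFun (congrFun (loopCoeff_sub γ.2 (const_mem_matLoops (1 : Mat n)) k) i) α
  refine h1.trans ?_
  rw [loopCoeff_one]
  rcases hk.eq_or_lt with rfl | hk
  · rw [h0, if_pos rfl, sub_self]
    rfl
  · rw [if_neg hk.ne', sub_zero]
    exact (mem_hInf_nonpos.1 (hγ i α)).2 k hk

namespace IsUnimodularSolution

variable {ι : Type*} {Λ : ι → LoopPoly n} {D : Set (Times Λ)}
  {Θ : Times Λ → UnitAddCircle → Mat n} {t : Times Λ}

lemma inv_mem (h : IsUnimodularSolution Λ D Θ) (ht : t ∈ D) :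
    (fun x => (Θ t x)⁻¹) ∈ matLoops n nonposModes :=
  inv_mem_matLoops (h.mem t ht) (h.det t ht)

lemma mul_inv (h : IsUnimodularSolution Λ D Θ) (ht : t ∈ D) :
    ∀ᵐ x ∂circ, Θ t x * (Θ t x)⁻¹ = 1 := by
  filter_upwards [h.det t ht] with x hx
  exact Matrix.mul_nonsing_inv _ (by rw [hx]; exact isUnit_one)

lemma inv_mul (h : IsUnimodularSolution Λ D Θ) (ht : t ∈ D) :
    ∀ᵐ x ∂circ, (Θ t x)⁻¹ * Θ t x = 1 := by
  filter_upwards [h.det t ht] with x hx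
  exact Matrix.nonsing_inv_mul _ (by rw [hx]; exact isUnit_one)

/-- The loop `Θ⁻¹`. -/
def invLoop (h : IsUnimodularSolution Λ D Θ) (ht : t ∈ D) : matLoops n ⊤ :=
  ⟨fun x => (Θ t x)⁻¹, matLoops_mono le_top (h.inv_mem ht)⟩

/-- The loop `g⁻¹`. -/
def gInvLoop (h : IsUnimodularSolution Λ D Θ) (t : Times Λ) : matLoops n ⊤ :=
  ⟨gInv t, h.gInv_mem_top t⟩

/-- The loop `g`. -/
def gLoop (h : IsUnimodularSolution Λ D Θ) (t : Times Λ) : matLoops n ⊤ :=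
  ⟨gPlus t, matLoops_mono le_top (gPlus_mem h.nonneg t)⟩

lemma isTransversal_invLoop (h : IsUnimodularSolution Λ D Θ) (ht : t ∈ D) :
    IsTransversal (loopImage (h.invLoop ht).1 (hardyPlus n)) :=
  isTransversal_loopImage (δ := ⟨Θ t, h.mem_top ht⟩) (h.inv_mem ht) (h.mem t ht) (h.inv_mul ht)
    (h.mul_inv ht)

/-- `g(t)⁻¹ Θ(0)⁻¹ H₊ = Θ(t)⁻¹ H₊`. -/
lemma loopImage_gInv (h : IsUnimodularSolution Λ D Θ) (hD : IsPreconnected D) (h0 : 0 ∈ D)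
    (htr : ∀ j x, (evalAt (Λ j) (zed x)).trace = 0) (ht : t ∈ D) :
    loopImage (gInv t) (loopImage (h.invLoop h0).1 (hardyPlus n)) =
      loopImage (h.invLoop ht).1 (hardyPlus n) := by
  have hmem := h.dressedLoop_mem ht (h.invLoop h0).2
  have hvan : ∀ m < 0, loopCoeff (dressedLoop Θ (h.invLoop h0).1 t) m = 0 := fun m hm => by
    refine h.loopCoeff_dressedLoop_eq_zero hD (h.invLoop h0).2 h0 (fun m hm => ?_) ht hm
    have h1 : dressedLoop Θ (h.invLoop h0).1 0 =ᵐ[circ] fun _ => 1 := by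
      filter_upwards [h.mul_inv h0] with x hx
      rw [dressedLoop, gInv_zero, one_mul]
      exact hx
    rw [loopCoeff_congr h1, loopCoeff_one, if_neg hm.ne]
  have hψ : dressedLoop Θ (h.invLoop h0).1 t ∈ matLoops n nonnegModes := fun a b =>
    mem_hInf_nonneg.2 ⟨mem_hInf_top.1 (hmem a b), fun k hk =>
      congrFun (congrFun (hvan k hk) a) b⟩
  -- Determinant one puts the inverse of `ψ` among the loops with nonnegative modes too.
  have hdet : ∀ᵐ x ∂circ, (dressedLoop Θ (h.invLoop h0).1 t x).det = 1 := by
    filter_upwards [h.det t ht, h.det 0 h0] with x h1 h2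
    have h3 : ((h.invLoop h0).1 x).det = 1 := by
      change ((Θ 0 x)⁻¹).det = 1
      rw [Matrix.det_nonsing_inv, h2, Ring.inverse_one]
    rw [dressedLoop, Matrix.det_mul, Matrix.det_mul, h1, det_gInv htr, h3, one_mul, one_mul]
  have hφ := inv_mem_matLoops hψ hdet
  refine (loopImage_loopImage (h.gInvLoop t) (h.invLoop h0) (hardyPlus n)).trans ?_
  refine loopImage_hardyPlus_eq (ψ := ⟨_, hmem⟩) (φ := ⟨_, matLoops_mono le_top hφ⟩) hψ hφ ?_ ?_
  · filter_upwards [hdet] with x hx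
    exact Matrix.mul_nonsing_inv _ (by rw [hx]; exact isUnit_one)
  · filter_upwards [h.inv_mul ht] with x hx
    change gInv t x * (Θ 0 x)⁻¹ = (Θ t x)⁻¹ * (Θ t x * (gInv t x * (Θ 0 x)⁻¹))
    rw [← mul_assoc (Θ t x)⁻¹, hx, one_mul]

/-- `g Θ⁻¹` is a Baker function. -/
lemma isBakerFunction (h : IsUnimodularSolution Λ D Θ) (hD : IsPreconnected D) (h0 : 0 ∈ D)
    (htr : ∀ j x, (evalAt (Λ j) (zed x)).trace = 0)
    (hone : ∀ t ∈ D, loopCoeff (fun x => (Θ t x)⁻¹) 0 = 1) :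
    IsBakerFunction D gPlus (fun t x => gPlus t x * (Θ t x)⁻¹)
      (loopImage (h.invLoop h0).1 (hardyPlus n)) := by
  refine ⟨fun t ht _ α => ?_, fun t ht α => ?_⟩
  -- The column `Θ(t)⁻¹ e_α` lies in `Θ(t)⁻¹ H₊ = g⁻¹ W`; multiplying by `g` gives the column of `w`
  -- in `W`.
  · have h1 : mulOp (h.invLoop ht) (constVec n α) ∈
        loopImage (h.gInvLoop t).1 (loopImage (h.invLoop h0).1 (hardyPlus n)) := by
      refine (h.loopImage_gInv hD h0 htr ht).symm ▸ ?_
      exact (mem_loopImage _).2 ⟨_, constVec_mem_hardyPlus α, rfl⟩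
    obtain ⟨u, hu, hu'⟩ := (mem_loopImage _).1 h1
    refine ⟨u, hu, ?_⟩
    have h2 : u = mulOp (h.gLoop t * h.invLoop ht) (constVec n α) := by
      rw [mulOp_mul, hu', mulOp_mulOp_of_mul_eq_one]
      exact Eventually.of_forall fun x => gPlus_mul_gInv t x
    rw [h2]
    exact coeFn_mulOp_constVec _ α
  · refine ⟨mulOp (h.invLoop ht) (constVec n α), ?_,
      pPlus_mulOp_constVec (γ := h.invLoop ht) (h.inv_mem ht) (hone t ht) α⟩
    filter_upwards [coeFn_mulOp_constVec (h.invLoop ht) α] with x hx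
    rw [hx, column, column, ← gInv_eq_inv, ← mul_assoc, gInv_mul_gPlus, one_mul]
    rfl

/-- After multiplication by `g⁻¹`, the columns of both functions lie in `g⁻¹ W` with projection
`e_α`, and `p₊` is injective there. Transversality also makes condition (1) available at every `t ∈
D`. -/
lemma ae_eq_of_isBakerFunction (h : IsUnimodularSolution Λ D Θ) (hD : IsPreconnected D)
    (h0 : 0 ∈ D) (htr : ∀ j x, (evalAt (Λ j) (zed x)).trace = 0)
    (hone : ∀ t ∈ D, loopCoeff (fun x => (Θ t x)⁻¹) 0 = 1)
    {w' : Times Λ → UnitAddCircle → Mat n}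
    (hw' : IsBakerFunction D gPlus w' (loopImage (h.invLoop h0).1 (hardyPlus n))) (ht : t ∈ D) :
    ∀ᵐ x ∂circ, w' t x = gPlus t x * (Θ t x)⁻¹ := by
  have himg := h.loopImage_gInv hD h0 htr ht
  have hg : (fun x => (gPlus t x)⁻¹) = gInv t := funext fun x => (gInv_eq_inv t x).symm
  have hcol : ∀ α, ∀ᵐ x ∂circ, column (w' t) α x =
      column (fun x => gPlus t x * (Θ t x)⁻¹) α x := fun α => by
    obtain ⟨v, hvW, hv⟩ := hw'.1 t ht (by rw [hg, himg]; exact h.isTransversal_invLoop ht) α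
    obtain ⟨v₂, hv₂, hp⟩ := hw'.2 t ht α
    have h2 : v₂ = mulOp (h.gInvLoop t) v := by
      apply Lp.ext
      filter_upwards [hv, hv₂, coeFn_mulOp (h.gInvLoop t) v] with x h3 h4 h5
      rw [h4, h5, h3]
      ext i
      rw [act_apply, column, ← gInv_eq_inv]
      rfl
    have h3 : v₂ ∈ loopImage (h.invLoop ht).1 (hardyPlus n) := by
      rw [← himg]
      exact (mem_loopImage (h.gInvLoop t)).2 ⟨v, hvW, h2⟩
    have h4 : mulOp (h.invLoop ht) (constVec n α) ∈ loopImage (h.invLoop ht).1 (hardyPlus n) :=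
      (mem_loopImage _).2 ⟨_, constVec_mem_hardyPlus α, rfl⟩
    have h5 : (⟨v₂, h3⟩ : loopImage (h.invLoop ht).1 (hardyPlus n)) = ⟨_, h4⟩ :=
      (h.isTransversal_invLoop ht).1 (Subtype.ext (hp.trans
        (pPlus_mulOp_constVec (γ := h.invLoop ht) (h.inv_mem ht) (hone t ht) α).symm))
    have h6 : v₂ = mulOp (h.invLoop ht) (constVec n α) := congrArg Subtype.val h5
    have h7 : v = mulOp (h.gLoop t * h.invLoop ht) (constVec n α) := by
      rw [mulOp_mul, ← h6, h2, mulOp_mulOp_of_mul_eq_one]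
      exact Eventually.of_forall fun x => gPlus_mul_gInv t x
    rw [h7] at hv
    filter_upwards [hv, coeFn_mulOp_constVec (h.gLoop t * h.invLoop ht) α] with x h8 h9
    rw [← h8, h9]
    rfl
  rw [← ae_all_iff] at hcol
  filter_upwards [hcol] with x hx
  ext i α
  exact congrArg (fun u : EuclideanSpace ℂ (Fin n) => u i) (hx α)

end IsUnimodularSolution

/-- All that the analysis needs from the Lie algebra: unit determinants, nonnegative modes of the
`Λ_j`, and their commutation. -/
lemma MatrixRealization.isUnimodularSolution {l : ℕ}
    {A : Matrix (Fin (l + 1)) (Fin (l + 1)) ℤ} (hA : IsAffineCartan A) (G : MatrixRealization A n)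
    {E : Type*} {deg : E → ℕ} {Λ : E → LoopPoly n} (hΛ : G.IsPositiveHeisenberg deg Λ) {J : Set E}
    {D : Set (Times fun j : J => Λ j)} (hD : IsOpen D)
    {Θ : (Times fun j : J => Λ j) → UnitAddCircle → Mat n}
    (hΘ : G.IsDressingSolution (fun j : J => Λ j) D Θ) :
    IsUnimodularSolution (fun j : J => Λ j) D Θ where
  isOpen := hD
  lie_eq_zero j k := hΛ.lie_eq_zero j k
  nonneg j := HasDegree.mem_matLoops_nonneg (hΛ.deg_pos j) (hΛ.hasDegree j)
  mem t ht := (hΘ.inGMinus t ht).mem_matLoops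
  det t ht := (hΘ.inGMinus t ht).det_eq_one hA
  continuousOn := hΘ.continuousOn
  locally_bounded := hΘ.locally_bounded
  equation := hΘ.equation

end Baker

end DSBaker

end

/-! ### The proposition -/

theorem proposition4p3 {l n : ℕ} (A : Matrix (Fin (l + 1)) (Fin (l + 1)) ℤ)
    (hA : DSBaker.IsAffineCartan A) (G : DSBaker.MatrixRealization A n)
    {E : Type*} (deg : E → ℕ) (Λ : E → DSBaker.LoopPoly n)
    (hΛ : G.IsPositiveHeisenberg deg Λ) (J : Set E)
    (D : Set (DSBaker.Times (fun j : J => Λ j)))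
    (hD_open : IsOpen D) (hD_conn : IsPreconnected D) (hD_zero : 0 ∈ D)
    (Θ : DSBaker.Times (fun j : J => Λ j) → UnitAddCircle → DSBaker.Mat n)
    (hΘ : G.IsDressingSolution (fun j : J => Λ j) D Θ)
    (γ : UnitAddCircle → DSBaker.Mat n) (hγ : γ = fun x => (Θ 0 x)⁻¹)
    (W : Submodule ℂ (DSBaker.Hil n)) (hW : W = DSBaker.loopImage γ (DSBaker.hardyPlus n))
    (w : DSBaker.Times (fun j : J => Λ j) → UnitAddCircle → DSBaker.Mat n)
    (hw : w = fun t x => DSBaker.gPlus t x * (Θ t x)⁻¹) :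
    G.InGMinus γ ∧
    DSBaker.IsBigCell W ∧
    (∀ t ∈ D, DSBaker.IsTransversal (DSBaker.loopImage (fun x => (DSBaker.gPlus t x)⁻¹) W)) ∧
    DSBaker.IsBakerFunction D DSBaker.gPlus w W ∧
    (∀ w' : DSBaker.Times (fun j : J => Λ j) → UnitAddCircle → DSBaker.Mat n,
      DSBaker.IsBakerFunction D DSBaker.gPlus w' W →
        ∀ t ∈ D, ∀ᵐ x ∂DSBaker.circ, w' t x = w t x) := by
  subst hγ hW hw
  have h := DSBaker.MatrixRealization.isUnimodularSolution hA G hΛ hD_open hΘ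
  have htr : ∀ (j : J) x, (DSBaker.evalAt (Λ j) (DSBaker.zed x)).trace = 0 := fun j x =>
    DSBaker.MatrixRealization.HasDegree.trace_evalAt hA (hΛ.hasDegree j) (DSBaker.zed_ne_zero x)
  have hγ := (hΘ.inGMinus 0 hD_zero).inv hA
  have hone : ∀ t ∈ D, DSBaker.loopCoeff (fun x => (Θ t x)⁻¹) 0 = 1 := fun t ht =>
    ((hΘ.inGMinus t ht).inv hA).loopCoeff_zero
  refine ⟨hγ, ?_, fun t ht => ?_, h.isBakerFunction hD_conn hD_zero htr hone,
    fun w' hw' t ht => h.ae_eq_of_isBakerFunction hD_conn hD_zero htr hone hw' ht⟩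
  · exact DSBaker.isBigCell_loopImage (γ := h.invLoop hD_zero) (δ := ⟨Θ 0, h.mem_top hD_zero⟩)
      (h.inv_mem hD_zero) (h.mem 0 hD_zero) hγ.1.2.1 (h.inv_mul hD_zero) (h.mul_inv hD_zero)
  · have hg : (fun x => (DSBaker.gPlus t x)⁻¹) = DSBaker.gInv t :=
      funext fun x => (DSBaker.gInv_eq_inv t x).symm
    have himg := h.loopImage_gInv hD_conn hD_zero htr ht
    rw [hg]
    exact himg.symm ▸ h.isTransversal_invLoop ht
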